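/- **Setting.** Let $\Lambda=\bigcup_i\Lambda_i\subset(\mathbb R^3,\ \alpha_{std}=dz-y\,dx)$ be a Legendrian link with finitely many components, each carrying a surgery coefficient $c_i\in\{-1,0,1\}$; write $\Lambda^0,\Lambda^\pm$ for the sublinks with coefficient $0$, $\pm1$. Assume each $\Lambda_i$ has a unit-speed parameterization by $\mathbb R/\mathbb Z$ (for the metric making $\partial_x+y\partial_z,\ \partial_y$ orthonormal on $\ker\alpha_{std}$), and that $\Lambda$ is in good position: all its Reeb chords $r_j$ (vertical segments with both ends on $\Lambda$) are non-degenerate, distinct chords are disjoint, and near each double point $(x_0,y_0)$ of the $xy$-projection the over-strand lies on the line $(x_0+a,y_0-a)$ and the under-strand on the line $(x_0+a,y_0+a)$. A *standard neighborhood* of $\Lambda$ consists of disjoint embeddings $\Phi_i$ of $\{|z|<\rho,\ |p|<\rho\}\times\mathbb R/\mathbb Z$ (coordinates $(z,p,q)$) into $\mathbb R^3$ with $\Phi_i^*\alpha_{std}=dz+p\,dq$, with $q\mapsto\Phi_i(0,0,q)$ the given parameterization of $\Lambda_i$, with $J_0\partial_p=\partial_q$ along $p=0$ (where $J_0$ is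 the lift to $\ker\alpha_{std}$ of the standard complex structure of the $xy$-plane), and such that near the endpoints of chords, up to a shift of $q$ and possibly $(p,q)\mapsto(-p,-q)$, the $xy$-component of $\Phi_i$ is $$\Big(x_0+\tfrac{q-p}{\sqrt2},\,y_0-\tfrac{p+q}{\sqrt2}\Big)\ \text{(tips)},\qquad \Big(x_0+\tfrac{p+q}{\sqrt2},\,y_0+\tfrac{q-p}{\sqrt2}\Big)\ \text{(tails)}.$$ Let $N_\varepsilon$ be the union of the images of $\{|z|\le\varepsilon,\ |p|\le\varepsilon\}$ over the components with $c_i\neq0$. For a chord $r_j$ whose tip has parameter $q_j^+$ on a component of $\Lambda^+\cup\Lambda^-$, let $\mathcal D^{en}_j=\{z=-\varepsilon,\ |p|\le\varepsilon,\ |q-q_j^+|\le\varepsilon\}$; if its tail has parameter $q_j^-$ on a component of $\Lambda^+\cup\Lambda^-$, let $\mathcal D^{ex}_j=\{z=\varepsilon,\ |p|\le\varepsilon,\ |q-q_j^-|\le\varepsilon\}$. Let $f:\mathbb R\to[0,1]$ be smooth, with $f=0$ near $(-\infty,-1]$ and $f=1$ near $[1,\infty)$, with $f'$ even and $0\le f'\le1$,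 and put $f_\varepsilon(p)=f(p/\varepsilon)$, $H_\varepsilon(p)=\int_{-\infty}^pP f_\varepsilon'(P)\,dP$. Call $f$ *adapted* to $\varepsilon$ if for some $\delta\in(0,\frac12)$ we have $f'=1$ on $[-\frac12+\delta,\frac12-\delta]$, and $|p|\le\varepsilon(\frac12-\delta)$ whenever $(p,q)\in\mathcal D^{en}_j$ and $(p,q+c_if_\varepsilon(p))\in\mathcal D^{ex}_{j'}$, where $r_j$ ends and $r_{j'}$ begins on the same component $\Lambda_i$ with $c_i\ne0$. The surgered manifold $(\mathbb R^3_{\Lambda^\pm},\alpha_\varepsilon)$ is obtained from $\mathbb R^3$ by replacing the neighborhood $N_{\varepsilon}$ of each $\Lambda_i$ with $c_i\neq 0$ by the handle $\{|p|\le\varepsilon,\ -\varepsilon\le z\le\varepsilon+c_iH_\varepsilon(p)\}$ with the form $dz+p\,dq$, glued along a collar of its boundary by the identity on the bottom and the sides and by $(z,p,q)\mapsto(z-c_iH_\varepsilon(p),\,p,\,q+c_if_\varepsilon(p))$ on the top; $\alpha_\varepsilon=\alpha_{std}$ outside the handles, and $R_\varepsilon$ is its Reeb vector field. A *Reeb chord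 of $\Lambda^0$* is an orbit of $R_\varepsilon$ parameterized by some $[0,A]$, $A>0$, with both ends on $\Lambda^0$. A *word of chords with boundary on $\Lambda^0$* is a non-empty word $r_{j_1}\cdots r_{j_n}$ of Reeb chords of $\Lambda\subset\mathbb R^3$ such that $r_{j_k}$ ends on the component on which $r_{j_{k+1}}$ begins, $r_{j_1}$ begins on $\Lambda^0$, $r_{j_n}$ ends on $\Lambda^0$, and all other endpoints are on $\Lambda^+\cup\Lambda^-$. A Reeb chord $\kappa$ of $\Lambda^0$ has $\mathrm{word}(\kappa)=r_{j_1}\cdots r_{j_n}$ if the squares $\mathcal D^{en},\mathcal D^{ex}$ it passes through are, in order, $\mathcal D^{en}_{j_1},\mathcal D^{ex}_{j_2},\mathcal D^{en}_{j_2},\dots,\mathcal D^{en}_{j_{n-1}},\mathcal D^{ex}_{j_n}$ and, when $n=1$, $\kappa$ meets none of the squares and has the same endpoints as $r_{j_1}$. **Theorem.** Standard neighborhoods of $\Lambda$ exist, and for each of them there is $\varepsilon_0>0$ such that for every $\varepsilon\in(0,\varepsilon_0)$ adapted functions exist, and for every adapted $f$: 1. every Reeb chord $\kappa$ of $\Lambda^0\subset(\mathbb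 R^3_{\Lambda^\pm},\alpha_\varepsilon)$ has exactly one word, and $\kappa\mapsto\mathrm{word}(\kappa)$ is a bijection from the set of Reeb chords of $\Lambda^0$ for $\alpha_\varepsilon$ onto the set of words of chords with boundary on $\Lambda^0\subset\mathbb R^3$; 2. every such Reeb chord $\kappa$, say of length $A$, is non-degenerate: the differential of the time-$A$ flow of $R_\varepsilon$ maps $T_{\kappa(0)}\Lambda^0$ to a line transverse to $T_{\kappa(A)}\Lambda^0$ inside the contact plane at $\kappa(A)$. -/

import Mathlib

open Set Filter Topology
open scoped ContDiff

noncomputable section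

namespace ChordSurgery

/-- Coordinate 3-space. On `ℝ³` the coordinates are `(x, y, z)`; on the neighbourhoods of Legendrian
knots and on surgery handles they are `(z, p, q)`. -/
abbrev E3 : Type := ℝ × ℝ × ℝ

/-- The standard contact form `dz - y dx`, in coordinates `(x, y, z)`. -/
def alphaStd (u : E3) : E3 →L[ℝ] ℝ :=
  (ContinuousLinearMap.snd ℝ ℝ ℝ).comp (ContinuousLinearMap.snd ℝ ℝ (ℝ × ℝ))
    - u.2.1 • ContinuousLinearMap.fst ℝ ℝ (ℝ × ℝ)

/-- The contact form `dz + p dq`, in coordinates `(z, p, q)`. -/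
def alphaModel (u : E3) : E3 →L[ℝ] ℝ :=
  ContinuousLinearMap.fst ℝ ℝ (ℝ × ℝ)
    + u.2.1 • (ContinuousLinearMap.snd ℝ ℝ ℝ).comp (ContinuousLinearMap.snd ℝ ℝ (ℝ × ℝ))

/-- A field of covectors as a differential 1-form in Mathlib's sense. -/
def asForm (α : E3 → E3 →L[ℝ] ℝ) (u : E3) : E3 [⋀^Fin 1]→L[ℝ] ℝ :=
  ContinuousAlternatingMap.ofSubsingleton ℝ E3 ℝ (0 : Fin 1) (α u)

/-- `v` is the Reeb vector of the contact form `α` at `u`: `α(v) = 1` and `dα(v, ·) = 0`. -/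
def IsReebVector (α : E3 → E3 →L[ℝ] ℝ) (u v : E3) : Prop :=
  α u v = 1 ∧ ∀ w : E3, extDeriv (asForm α) u ![v, w] = 0

/-! ### Legendrian links and their chords in `(ℝ³, dz - y dx)` -/

/-- A Legendrian link in `ℝ³` whose components, indexed by `ι`, are parameterized by `ℝ/ℤ`
(that is, by 1-periodic maps). -/
structure LegendrianLink (ι : Type*) where
  param : ι → ℝ → E3
  smooth : ∀ i, ContDiff ℝ ∞ (param i)
  periodic : ∀ i s, param i (s + 1) = param i s
  immersed : ∀ i s, deriv (param i) s ≠ 0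
  embedded : ∀ i j s t, param i s = param j t → i = j ∧ ∃ n : ℤ, t = s + n
  legendrian : ∀ i s, alphaStd (param i s) (deriv (param i) s) = 0

namespace LegendrianLink

variable {ι : Type*} (Λ : LegendrianLink ι)

/-- The component `Λ_i` as a subset of `ℝ³`. -/
def component (i : ι) : Set E3 := range (Λ.param i)

/-- All parameterizations have unit speed for the metric on `ℝ³` for which
`∂_x + y ∂_z`, `∂_y` is an orthonormal frame of the contact planes. As the parameter runs over
`ℝ/ℤ`, every component has arc length `1`. -/
def UnitSpeed : Prop :=
  ∀ i s, (deriv (Λ.param i) s).1 ^ 2 + (deriv (Λ.param i) s).2.1 ^ 2 = 1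

/-- A Reeb chord of `Λ` for `dz - y dx` (Reeb vector field `∂_z`): a vertical segment from a point
`tail` of `Λ` up to a point `tip` of `Λ`. The components containing the endpoints are `src`, `tgt`
(they are determined by the endpoints). -/
@[ext] structure Chord where
  src : ι
  tgt : ι
  tail : E3
  tip : E3
  tail_mem : tail ∈ Λ.component src
  tip_mem : tip ∈ Λ.component tgt
  same_x : tip.1 = tail.1
  same_y : tip.2.1 = tail.2.1
  height_lt : tail.2.2 < tip.2.2

/-- All chords are non-degenerate (the two strands project to transverse strands in the `xy`-plane)
and distinct chords are disjoint subsets of `ℝ³`. -/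
def ChordGeneric : Prop :=
  (∀ (r : Λ.Chord) (s t : ℝ), Λ.param r.src s = r.tail → Λ.param r.tgt t = r.tip →
    (deriv (Λ.param r.src) s).1 * (deriv (Λ.param r.tgt) t).2.1
      - (deriv (Λ.param r.src) s).2.1 * (deriv (Λ.param r.tgt) t).1 ≠ 0) ∧
  ∀ r r' : Λ.Chord, r ≠ r' → Disjoint (segment ℝ r.tail r.tip) (segment ℝ r'.tail r'.tip)

/-- Good position: chord generic, and over each double point `(x₀, y₀)` of the `xy`-projection the
over-crossing strand projects near the tip of the chord to the line `(x₀ + a, y₀ - a)`, the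
under-crossing strand near the tail to the line `(x₀ + a, y₀ + a)`. -/
def GoodPosition : Prop :=
  Λ.ChordGeneric ∧
  ∀ (r : Λ.Chord) (s t : ℝ), Λ.param r.src s = r.tail → Λ.param r.tgt t = r.tip →
    (∀ᶠ t' in 𝓝 t, ∃ a : ℝ,
      (Λ.param r.tgt t').1 = r.tip.1 + a ∧ (Λ.param r.tgt t').2.1 = r.tip.2.1 - a) ∧
    (∀ᶠ s' in 𝓝 s, ∃ a : ℝ,
      (Λ.param r.src s').1 = r.tail.1 + a ∧ (Λ.param r.src s').2.1 = r.tail.2.1 + a)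

/-- With surgery coefficients `c`, a word of chords with boundary on `Λ⁰ = {c = 0}`: a non-empty word
`r₁ ⋯ rₙ` in which consecutive chords are composable (`r_k` ends on the component on which `r_{k+1}`
begins), whose first chord begins on `Λ⁰`, whose last chord ends on `Λ⁰`, and all of whose other
endpoints lie on `Λ⁺ ∪ Λ⁻ = {c ≠ 0}`. -/
def IsBoundaryWord (c : ι → SignType) (w : List Λ.Chord) : Prop :=
  ∃ h : w ≠ [], c (w.head h).src = 0 ∧ c (w.getLast h).tgt = 0 ∧
    List.IsChain (fun r r' : Λ.Chord => r.tgt = r'.src ∧ c r.tgt ≠ 0) w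

/-- The set of words of chords with boundary on `Λ⁰`. -/
abbrev BoundaryWord (c : ι → SignType) : Type _ := {w : List Λ.Chord // Λ.IsBoundaryWord c w}

end LegendrianLink

/-! ### Standard neighbourhoods -/

/-- Model embedding near an over-crossing strand through `(x₀, y₀, z₀)`. -/
def overModel (b : E3) (u : E3) : E3 :=
  (b.1 - u.2.1 / √2 + u.2.2 / √2,
   b.2.1 - u.2.1 / √2 - u.2.2 / √2,
   b.2.2 + u.1 + b.2.1 * ((u.2.2 - u.2.1) / √2)
     + u.2.1 ^ 2 / 4 + u.2.1 * u.2.2 / 2 - u.2.2 ^ 2 / 4)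

/-- Model embedding near an under-crossing strand through `(x₀, y₀, z₀)`. -/
def underModel (b : E3) (u : E3) : E3 :=
  (b.1 + u.2.1 / √2 + u.2.2 / √2,
   b.2.1 - u.2.1 / √2 + u.2.2 / √2,
   b.2.2 + u.1 + b.2.1 * ((u.2.1 + u.2.2) / √2)
     - u.2.1 ^ 2 / 4 + u.2.1 * u.2.2 / 2 + u.2.2 ^ 2 / 4)

/-- The set `{|z| < r, |p| < r}` in coordinates `(z, p, q)`; `q` is read modulo `1`. -/
def openBox (r : ℝ) : Set E3 := {u | |u.1| < r ∧ |u.2.1| < r}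

/-- A standard neighbourhood of a link: disjoint embeddings `Φ_i` of
`{|z| < radius, |p| < radius} × ℝ/ℤ`, one around each component, with `Φ_i^* (dz - y dx) = dz + p dq`,
with the given parameterization as core, for which the standard complex structure on the contact
planes is the standard one along `{p = 0}` (the frame `∂_p, ∂_q - p ∂_z` projects there to a pair
`(a, J₀ a)` in the `xy`-plane), and which agrees with the model embeddings near the endpoints of
chords, up to the symmetry `(z, p, q) ↦ (z, -p, -q)`. -/
structure StandardNeighborhood {ι : Type*} (Λ : LegendrianLink ι) where
  radius : ℝ
  radius_pos : 0 < radius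
  map : ι → E3 → E3
  smooth : ∀ i, ContDiffOn ℝ ∞ (map i) (openBox radius)
  periodic : ∀ i, ∀ u ∈ openBox radius, map i (u.1, u.2.1, u.2.2 + 1) = map i u
  injective : ∀ i j, ∀ u ∈ openBox radius, ∀ v ∈ openBox radius, map i u = map j v →
    i = j ∧ v.1 = u.1 ∧ v.2.1 = u.2.1 ∧ ∃ n : ℤ, v.2.2 = u.2.2 + n
  contact : ∀ i, ∀ u ∈ openBox radius, ∀ v : E3,
    alphaStd (map i u) (fderiv ℝ (map i) u v) = alphaModel u v
  core : ∀ i q, map i (0, 0, q) = Λ.param i q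
  complex : ∀ i z q, |z| < radius →
    (fderiv ℝ (map i) (z, 0, q) (0, 0, 1)).1 = -(fderiv ℝ (map i) (z, 0, q) (0, 1, 0)).2.1 ∧
    (fderiv ℝ (map i) (z, 0, q) (0, 0, 1)).2.1 = (fderiv ℝ (map i) (z, 0, q) (0, 1, 0)).1
  over_crossing : ∀ (r : Λ.Chord) (t : ℝ), Λ.param r.tgt t = r.tip →
    ∃ η > 0, ∃ σ : ℝ, (σ = 1 ∨ σ = -1) ∧ ∀ z p q : ℝ, |z| < η → |p| < η → |q| < η →
      map r.tgt (z, p, t + q) = overModel r.tip (z, σ * p, σ * q)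
  under_crossing : ∀ (r : Λ.Chord) (s : ℝ), Λ.param r.src s = r.tail →
    ∃ η > 0, ∃ σ : ℝ, (σ = 1 ∨ σ = -1) ∧ ∀ z p q : ℝ, |z| < η → |p| < η → |q| < η →
      map r.src (z, p, s + q) = underModel r.tail (z, σ * p, σ * q)

/-! ### Twist functions -/

/-- `f_ε(p) = f(p / ε)`. -/
def scaledTwist (f : ℝ → ℝ) (ε p : ℝ) : ℝ := f (p / ε)

/-- `H_ε(p) = ∫_{-∞}^p P f_ε'(P) dP`. -/
def twistPrimitive (f : ℝ → ℝ) (ε p : ℝ) : ℝ :=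
  ∫ P in Iic p, P * deriv (scaledTwist f ε) P

/-- The function defining the model negative Dehn twist `(p, q) ↦ (p, q + f(p))`, lifted to a
real-valued function: it increases from `0` to `1`, its derivative is even, takes values in `[0, 1]`
and is supported in `[-(1 - η), 1 - η] ⊂ (-1, 1)`. -/
structure IsTwist (η : ℝ) (f : ℝ → ℝ) : Prop where
  margin_pos : 0 < η
  smooth : ContDiff ℝ ∞ f
  eq_zero : ∀ p ≤ -(1 - η), f p = 0
  eq_one : ∀ p, 1 - η ≤ p → f p = 1
  deriv_nonneg : ∀ p, 0 ≤ deriv f p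
  deriv_le_one : ∀ p, deriv f p ≤ 1
  deriv_even : ∀ p, deriv f (-p) = deriv f p

/-- A twist function adapted to the link and to the size `ε` of the neighbourhood: it is affine with
slope `1` on `[-(1/2 - δ), 1/2 - δ]` with `δ` so small that whenever a point `(p, q)` of the entry
square of a chord `r` is carried by the handle twist `(p, q) ↦ (p, q + c f_ε(p))` into the exit square
of a chord `r'`, the twist is affine at that point (`p/ε` lies in that interval). -/
structure IsAdaptedTwist {ι : Type*} (Λ : LegendrianLink ι) (c : ι → SignType) (ε η : ℝ)
    (f : ℝ → ℝ) : Prop extends IsTwist η f where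
  affine : ∃ δ : ℝ, 0 < δ ∧ δ < 1 / 2 ∧ (∀ p, |p| ≤ 1 / 2 - δ → deriv f p = 1) ∧
    ∀ r r' : Λ.Chord, r.tgt = r'.src → c r.tgt ≠ 0 →
      ∀ t s : ℝ, Λ.param r.tgt t = r.tip → Λ.param r'.src s = r'.tail →
        ∀ p q : ℝ, |p| ≤ ε → |q - t| ≤ ε →
          |q + (c r.tgt : ℝ) * scaledTwist f ε p - s| ≤ ε → |p| ≤ ε * (1 / 2 - δ)

/-! ### The surgered contact manifold -/

/-- The data from which the surgered contact manifold is built: a link, the surgery coefficients of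
its components (`0` means no surgery), a standard neighbourhood, the size `ε` of the surgered
neighbourhood `N_ε`, the width `η ε` of the collar along which the handles are glued, and the twist
function `f`. -/
structure SurgeryData (ι : Type*) where
  link : LegendrianLink ι
  coeff : ι → SignType
  nbhd : StandardNeighborhood link
  ε : ℝ
  η : ℝ
  f : ℝ → ℝ

namespace SurgeryData

variable {ι : Type*} (S : SurgeryData ι)

/-- The open sets of `ℝ³` from which the surgered manifold is glued. The piece `none` is the
exterior: `ℝ³`, coordinates `(x, y, z)`, minus the closed neighbourhoods
`{|z| ≤ (1-η)ε, |p| ≤ (1-η)ε}` of the components of `Λ⁺ ∪ Λ⁻`. The piece `some i` is the open handle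
`{|p| < ε, -ε < z < ε + c_i H_ε(p)}`, coordinates `(z, p, q)`, of a component of `Λ⁺ ∪ Λ⁻`. -/
def pieceDomain : Option ι → Set E3
  | none => {u | ∀ i, S.coeff i ≠ 0 →
      u ∉ S.nbhd.map i '' {v | |v.1| ≤ (1 - S.η) * S.ε ∧ |v.2.1| ≤ (1 - S.η) * S.ε}}
  | some i => {v | S.coeff i ≠ 0 ∧ |v.2.1| < S.ε ∧ -S.ε < v.1 ∧
      v.1 < S.ε + (S.coeff i : ℝ) * twistPrimitive S.f S.ε v.2.1}

/-- Disjoint union of the pieces. -/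
abbrev Pieces : Type _ := Σ a : Option ι, S.pieceDomain a

/-- The surgery gluing. In handles `q` is read modulo `1`. Along the bottom and the sides the handle
is glued to the exterior by the identity, and along the top by
`(z, p, q) ↦ (z - c H_ε(p), p, q + c f_ε(p))`. -/
inductive Glue : S.Pieces → S.Pieces → Prop
  | period (i : ι) (z p q : ℝ) (h : (z, p, q) ∈ S.pieceDomain (some i))
      (h' : (z, p, q + 1) ∈ S.pieceDomain (some i)) :
      Glue ⟨some i, (z, p, q), h⟩ ⟨some i, (z, p, q + 1), h'⟩
  | bottomSide (i : ι) (z p q : ℝ) (h : (z, p, q) ∈ S.pieceDomain (some i))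
      (h' : S.nbhd.map i (z, p, q) ∈ S.pieceDomain none)
      (hz : z < -((1 - S.η) * S.ε) ∨ (1 - S.η) * S.ε < |p|) :
      Glue ⟨some i, (z, p, q), h⟩ ⟨none, S.nbhd.map i (z, p, q), h'⟩
  | top (i : ι) (z p q z' q' : ℝ) (h : (z, p, q) ∈ S.pieceDomain (some i))
      (h' : S.nbhd.map i (z', p, q') ∈ S.pieceDomain none)
      (hz' : z' = z - (S.coeff i : ℝ) * twistPrimitive S.f S.ε p)
      (hq' : q' = q + (S.coeff i : ℝ) * scaledTwist S.f S.ε p)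
      (hz : (1 - S.η) * S.ε < z') :
      Glue ⟨some i, (z, p, q), h⟩ ⟨none, S.nbhd.map i (z', p, q'), h'⟩

/-- The surgered manifold, with the quotient topology. Its smooth structure and its contact form
`α_ε` are those for which the projections from the pieces are local diffeomorphisms pulling `α_ε`
back to `pieceForm`. -/
def Manifold : Type _ := Quot S.Glue

instance : TopologicalSpace S.Manifold := inferInstanceAs (TopologicalSpace (Quot S.Glue))

/-- The projection of a piece to the surgered manifold. -/
def point (a : Option ι) (u : E3) (h : u ∈ S.pieceDomain a) : S.Manifold :=
  Quot.mk S.Glue ⟨a, u, h⟩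

/-- The contact form `α_ε` on the pieces: `dz - y dx` on the exterior, `dz + p dq` on handles. -/
def pieceForm : Option ι → E3 → E3 →L[ℝ] ℝ
  | none => alphaStd
  | some _ => alphaModel

/-- `γ` restricted to `[0, A]` is an integral curve of the Reeb vector field `R_ε` of `α_ε`: near
every time it lifts to a differentiable curve in a piece whose velocity is the Reeb vector of the
contact form of that piece. -/
def IsReebCurve (A : ℝ) (γ : ℝ → S.Manifold) : Prop :=
  ∀ t ∈ Icc 0 A, ∃ (a : Option ι) (u : ℝ → E3), ∀ᶠ s in 𝓝[Icc 0 A] t,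
    (∃ h : u s ∈ S.pieceDomain a, γ s = S.point a (u s) h) ∧
    ∃ v : E3, HasDerivWithinAt u v (Icc 0 A) s ∧ IsReebVector (pieceForm a) (u s) v

/-- `x` is the point of (the image in the surgered manifold of) the component `i` of `Λ⁰` with
parameter `s`. -/
def IsBoundaryPoint (i : ι) (s : ℝ) (x : S.Manifold) : Prop :=
  S.coeff i = 0 ∧ ∃ h, x = S.point none (S.link.param i s) h

/-- A Reeb chord of `Λ⁰` in the surgered manifold for `α_ε`: an orbit of `R_ε` parameterized by a
compact interval `[0, A]`, `A > 0`, which begins and ends on `Λ⁰`. Outside `[0, A]` the map is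
constantly extended, so that chords are equal when `A` and the orbit are. -/
@[ext] structure ReebChord where
  length : ℝ
  toFun : ℝ → S.Manifold
  length_pos : 0 < length
  const : ∀ t, toFun t = toFun (max 0 (min t length))
  reeb : S.IsReebCurve length toFun
  start_mem : ∃ i s, S.IsBoundaryPoint i s (toFun 0)
  end_mem : ∃ i s, S.IsBoundaryPoint i s (toFun length)

/-- The square at which orbits enter the surgered neighbourhood along the chord `r`, whose tip is on
a component of `Λ⁺ ∪ Λ⁻`: centred at `q = q(tip)` in the bottom `{z = -ε}`, `|p| ≤ ε`. -/
def entrySquare (r : S.link.Chord) : Set S.Manifold :=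
  {x | S.coeff r.tgt ≠ 0 ∧ ∃ t p q : ℝ, S.link.param r.tgt t = r.tip ∧ |p| ≤ S.ε ∧ |q - t| ≤ S.ε ∧
    ∃ h, x = S.point none (S.nbhd.map r.tgt (-S.ε, p, q)) h}

/-- The square at which orbits leave the surgered neighbourhood along the chord `r`, whose tail is on
a component of `Λ⁺ ∪ Λ⁻`: centred at `q = q(tail)` in the top `{z = ε}`, `|p| ≤ ε`. -/
def exitSquare (r : S.link.Chord) : Set S.Manifold :=
  {x | S.coeff r.src ≠ 0 ∧ ∃ s p q : ℝ, S.link.param r.src s = r.tail ∧ |p| ≤ S.ε ∧ |q - s| ≤ S.ε ∧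
    ∃ h, x = S.point none (S.nbhd.map r.src (S.ε, p, q)) h}

namespace ReebChord

variable {S}

/-- `word(κ) = r₁ ⋯ rₙ`: the entry and exit squares through which `κ` passes are, in this order,
`entry r₁, exit r₂, entry r₂, …, exit r_{n-1}, entry r_{n-1}, exit r_n`, passed at times
`a 0 < b 0 < a 1 < b 1 < …`. If `n = 1`, then `κ` meets no square and has the endpoints of `r₁`. -/
def HasWord (κ : S.ReebChord) (w : List S.link.Chord) : Prop :=
  w ≠ [] ∧
  (∀ r, w = [r] → (∃ h, κ.toFun 0 = S.point none r.tail h) ∧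
    ∃ h, κ.toFun κ.length = S.point none r.tip h) ∧
  ∃ a b : ℕ → ℝ,
    (∀ k, k + 1 < w.length → 0 < a k ∧ a k < b k ∧ b k < κ.length) ∧
    (∀ k, k + 2 < w.length → b k < a (k + 1)) ∧
    (∀ (k : ℕ) (h : k + 1 < w.length),
      κ.toFun (a k) ∈ S.entrySquare (w[k]'(Nat.lt_of_succ_lt h)) ∧
      κ.toFun (b k) ∈ S.exitSquare (w[k + 1]'h)) ∧
    ∀ τ ∈ Icc 0 κ.length, ∀ r : S.link.Chord,
      (κ.toFun τ ∈ S.entrySquare r → ∃ k, k + 1 < w.length ∧ τ = a k) ∧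
      (κ.toFun τ ∈ S.exitSquare r → ∃ k, k + 1 < w.length ∧ τ = b k)

/-- Non-degeneracy of a chord `κ` of length `A`: the differential `L` of the time `A` flow `ψ` of
`R_ε` (written in the exterior coordinates near the endpoints) at the start of `κ` maps the tangent
line of `Λ⁰` to a line which is transverse, inside the contact plane, to the tangent line of `Λ⁰` at
the end of `κ`. -/
def Nondegenerate (κ : S.ReebChord) : Prop :=
  ∃ (i j : ι) (s t : ℝ), S.IsBoundaryPoint i s (κ.toFun 0) ∧
    S.IsBoundaryPoint j t (κ.toFun κ.length) ∧
    ∃ (ψ : E3 → E3) (L : E3 →L[ℝ] E3),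
      ψ (S.link.param i s) = S.link.param j t ∧
      (∀ᶠ u in 𝓝 (S.link.param i s), ∃ (γ : ℝ → S.Manifold) (h : u ∈ S.pieceDomain none)
        (h' : ψ u ∈ S.pieceDomain none), S.IsReebCurve κ.length γ ∧
          γ 0 = S.point none u h ∧ γ κ.length = S.point none (ψ u) h') ∧
      HasFDerivAt ψ L (S.link.param i s) ∧
      Submodule.span ℝ {L (deriv (S.link.param i) s)}
          ⊔ Submodule.span ℝ {deriv (S.link.param j) t}
        = LinearMap.ker (alphaStd (S.link.param j t)).toLinearMap

end ReebChord

end SurgeryData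

end ChordSurgery

end

open Set Filter Topology
open scoped ContDiff

noncomputable section

namespace ChordSurgery

theorem HasDerivAt.fst_E3 {f : ℝ → E3} {f' : E3} {t : ℝ} (hf : HasDerivAt f f' t) :
    HasDerivAt (fun t => (f t).1) f'.1 t :=
  (hasFDerivAt_fst (𝕜 := ℝ) (p := f t)).comp_hasDerivAt t hf

theorem HasDerivAt.snd_E3 {f : ℝ → E3} {f' : E3} {t : ℝ} (hf : HasDerivAt f f' t) :
    HasDerivAt (fun t => (f t).2) f'.2 t :=
  (hasFDerivAt_snd (𝕜 := ℝ) (p := f t)).comp_hasDerivAt t hf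

theorem HasDerivAt.snd_fst_E3 {f : ℝ → E3} {f' : E3} {t : ℝ} (hf : HasDerivAt f f' t) :
    HasDerivAt (fun t => (f t).2.1) f'.2.1 t :=
  HasFDerivAt.comp_hasDerivAt (f := fun t => (f t).2) t hasFDerivAt_fst (HasDerivAt.snd_E3 hf)

theorem HasDerivAt.snd_snd_E3 {f : ℝ → E3} {f' : E3} {t : ℝ} (hf : HasDerivAt f f' t) :
    HasDerivAt (fun t => (f t).2.2) f'.2.2 t :=
  HasFDerivAt.comp_hasDerivAt (f := fun t => (f t).2) t hasFDerivAt_snd (HasDerivAt.snd_E3 hf)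

/-! ### Construction of standard neighbourhoods -/

/-- The solution `g` of `g + k g² / 2 = p` which vanishes for `p = 0`. -/
def tubeHeight (k p : ℝ) : ℝ := 2 * p / (1 + √(1 + 2 * k * p))

theorem tubeHeight_spec {k p : ℝ} (h : 0 < 1 + 2 * k * p) :
    tubeHeight k p + k * tubeHeight k p ^ 2 / 2 = p := by
  have hs := Real.sq_sqrt h.le
  have h0 := Real.sqrt_nonneg (1 + 2 * k * p)
  unfold tubeHeight
  set s := √(1 + 2 * k * p)
  have : 1 + s ≠ 0 := by positivity
  field_simp
  linear_combination (-p) * hs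

theorem tubeHeight_zero_left (p : ℝ) : tubeHeight 0 p = p := by
  simp [tubeHeight]; ring

theorem tubeHeight_zero_right (k : ℝ) : tubeHeight k 0 = 0 := by
  simp [tubeHeight]

section Tube

variable (γ : ℝ → E3)

/-- Curvature of the planar projection of a curve with planar speed one. -/
def planarCurvature (q : ℝ) : ℝ :=
  (deriv γ q).1 * (deriv (deriv γ) q).2.1 - (deriv γ q).2.1 * (deriv (deriv γ) q).1

/-- The distance from the curve at which the point with coordinates `(p, q)` lies. -/
def tubeDist (u : E3) : ℝ := tubeHeight (planarCurvature γ u.2.2) u.2.1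

/-- Darboux coordinates near a Legendrian curve whose planar projection has unit speed. -/
def tube (u : E3) : E3 :=
  ((γ u.2.2).1 + tubeDist γ u * (deriv γ u.2.2).2.1,
   (γ u.2.2).2.1 - tubeDist γ u * (deriv γ u.2.2).1,
   u.1 + (γ u.2.2).2.2 + (γ u.2.2).2.1 * (deriv γ u.2.2).2.1 * tubeDist γ u
     - (deriv γ u.2.2).1 * (deriv γ u.2.2).2.1 * tubeDist γ u ^ 2 / 2)

variable {γ}

theorem contDiff_deriv_of_infty {γ : ℝ → E3} (h : ContDiff ℝ ∞ γ) : ContDiff ℝ ∞ (deriv γ) :=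
  (contDiff_infty_iff_deriv.1 h).2

theorem contDiff_planarCurvature (h : ContDiff ℝ ∞ γ) : ContDiff ℝ ∞ (planarCurvature γ) := by
  have h1 := contDiff_deriv_of_infty h
  have h2 := contDiff_deriv_of_infty h1
  unfold planarCurvature
  fun_prop

theorem contDiffAt_tubeDist (h : ContDiff ℝ ∞ γ) {u : E3}
    (hu : 0 < 1 + 2 * planarCurvature γ u.2.2 * u.2.1) : ContDiffAt ℝ ∞ (tubeDist γ) u := by
  have hk := contDiff_planarCurvature h
  unfold tubeDist tubeHeight
  have h1 : ContDiffAt ℝ ∞ (fun u : E3 => 1 + 2 * planarCurvature γ u.2.2 * u.2.1) u := by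
    fun_prop
  have h2 := h1.sqrt hu.ne'
  refine ContDiffAt.div (by fun_prop) (contDiffAt_const.add h2) ?_
  have := Real.sqrt_nonneg (1 + 2 * planarCurvature γ u.2.2 * u.2.1)
  positivity

theorem contDiffAt_tube (h : ContDiff ℝ ∞ γ) {u : E3}
    (hu : 0 < 1 + 2 * planarCurvature γ u.2.2 * u.2.1) : ContDiffAt ℝ ∞ (tube γ) u := by
  have h1 := contDiff_deriv_of_infty h
  have h2 := contDiffAt_tubeDist h hu
  unfold tube
  fun_prop

/-- The differential of `tube γ` in terms of the differential of `tubeDist γ`. -/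
theorem fderiv_tube (h : ContDiff ℝ ∞ γ) {u : E3}
    (hu : 0 < 1 + 2 * planarCurvature γ u.2.2 * u.2.1) (v : E3) :
    fderiv ℝ (tube γ) u v =
      ((deriv γ u.2.2).1 * v.2.2 + (fderiv ℝ (tubeDist γ) u v * (deriv γ u.2.2).2.1
          + tubeDist γ u * ((deriv (deriv γ) u.2.2).2.1 * v.2.2)),
       (deriv γ u.2.2).2.1 * v.2.2 - (fderiv ℝ (tubeDist γ) u v * (deriv γ u.2.2).1
          + tubeDist γ u * ((deriv (deriv γ) u.2.2).1 * v.2.2)),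
       v.1 + (deriv γ u.2.2).2.2 * v.2.2
        + (((deriv γ u.2.2).2.1 * v.2.2 * (deriv γ u.2.2).2.1
            + (γ u.2.2).2.1 * ((deriv (deriv γ) u.2.2).2.1 * v.2.2)) * tubeDist γ u
          + (γ u.2.2).2.1 * (deriv γ u.2.2).2.1 * fderiv ℝ (tubeDist γ) u v)
        - (((deriv (deriv γ) u.2.2).1 * v.2.2 * (deriv γ u.2.2).2.1
            + (deriv γ u.2.2).1 * ((deriv (deriv γ) u.2.2).2.1 * v.2.2)) * tubeDist γ u ^ 2
          + (deriv γ u.2.2).1 * (deriv γ u.2.2).2.1 *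
            (2 * tubeDist γ u * fderiv ℝ (tubeDist γ) u v)) / 2) := by
  have h1 := contDiff_deriv_of_infty h
  have hd := (contDiffAt_tubeDist h hu).differentiableAt (by simp)
  have ht := (contDiffAt_tube h hu).differentiableAt (by simp)
  have hline : HasDerivAt (fun t : ℝ => u + t • v) v 0 := by
    simpa using ((hasDerivAt_id (0 : ℝ)).smul_const v).const_add u
  have hline0 : u + (0 : ℝ) • v = u := by simp
  have hq : HasDerivAt (fun t : ℝ => u.2.2 + t * v.2.2) v.2.2 0 := by
    simpa using ((hasDerivAt_id (0 : ℝ)).mul_const v.2.2).const_add u.2.2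
  have hz : HasDerivAt (fun t : ℝ => u.1 + t * v.1) v.1 0 := by
    simpa using ((hasDerivAt_id (0 : ℝ)).mul_const v.1).const_add u.1
  have hG : HasDerivAt (fun t : ℝ => tubeDist γ (u + t • v)) (fderiv ℝ (tubeDist γ) u v) 0 := by
    have := hd.hasFDerivAt
    nth_rw 2 [← hline0] at this
    exact HasFDerivAt.comp_hasDerivAt (0 : ℝ) this hline
  have hT : HasDerivAt (fun t : ℝ => tube γ (u + t • v)) (fderiv ℝ (tube γ) u v) 0 := by
    have := ht.hasFDerivAt
    nth_rw 2 [← hline0] at this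
    exact HasFDerivAt.comp_hasDerivAt (0 : ℝ) this hline
  have hγ : HasDerivAt (fun t : ℝ => γ (u.2.2 + t * v.2.2)) (v.2.2 • deriv γ u.2.2) 0 := by
    have hh : HasDerivAt γ (deriv γ u.2.2) (u.2.2 + 0 * v.2.2) := by
      simpa using (h.differentiable (by simp) u.2.2).hasDerivAt
    exact hh.scomp (0 : ℝ) hq
  have hγ' : HasDerivAt (fun t : ℝ => deriv γ (u.2.2 + t * v.2.2))
      (v.2.2 • deriv (deriv γ) u.2.2) 0 := by
    have hh : HasDerivAt (deriv γ) (deriv (deriv γ) u.2.2) (u.2.2 + 0 * v.2.2) := by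
      simpa using (h1.differentiable (by simp) u.2.2).hasDerivAt
    exact hh.scomp (0 : ℝ) hq
  have H := ((HasDerivAt.fst_E3 hγ).add (hG.mul (HasDerivAt.snd_fst_E3 hγ'))).prodMk
    (((HasDerivAt.snd_fst_E3 hγ).sub (hG.mul (HasDerivAt.fst_E3 hγ'))).prodMk
      (((hz.add (HasDerivAt.snd_snd_E3 hγ)).add
        (((HasDerivAt.snd_fst_E3 hγ).mul (HasDerivAt.snd_fst_E3 hγ')).mul hG)).sub
        ((((HasDerivAt.fst_E3 hγ').mul (HasDerivAt.snd_fst_E3 hγ')).mul (hG.pow 2)).div_const 2)))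
  have H' : HasDerivAt (fun t : ℝ => tube γ (u + t • v)) _ 0 := H
  rw [hT.unique H']
  simp
  refine ⟨by ring, by ring, by ring⟩

theorem tube_contact (h : ContDiff ℝ ∞ γ)
    (hunit : ∀ s, (deriv γ s).1 ^ 2 + (deriv γ s).2.1 ^ 2 = 1)
    (hleg : ∀ s, alphaStd (γ s) (deriv γ s) = 0) {u : E3}
    (hu : 0 < 1 + 2 * planarCurvature γ u.2.2 * u.2.1) (v : E3) :
    alphaStd (tube γ u) (fderiv ℝ (tube γ) u v) = alphaModel u v := by
  have h1 := tubeHeight_spec hu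
  have h2 := hunit u.2.2
  have h3 := hleg u.2.2
  rw [fderiv_tube h hu]
  change tubeDist γ u + planarCurvature γ u.2.2 * tubeDist γ u ^ 2 / 2 = u.2.1 at h1
  simp only [planarCurvature] at h1
  simp [alphaStd, alphaModel, tube] at h3 ⊢
  linear_combination v.2.2 * h1 + v.2.2 * tubeDist γ u * h2 + v.2.2 * h3

theorem fderiv_tubeDist_zero (h : ContDiff ℝ ∞ γ) (z q : ℝ) (v : E3) :
    fderiv ℝ (tubeDist γ) (z, 0, q) v = v.2.1 := by
  have hu : (0 : ℝ) < 1 + 2 * planarCurvature γ ((z, 0, q) : E3).2.2 * ((z, 0, q) : E3).2.1 := by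
    simp
  have hd := ((contDiffAt_tubeDist h hu).differentiableAt (by simp)).hasFDerivAt
  have hk := ((contDiff_planarCurvature h).differentiable (by simp) q).hasFDerivAt
  have hk' : HasFDerivAt (fun u : E3 => planarCurvature γ u.2.2) _ ((z, 0, q) : E3) :=
    HasFDerivAt.comp (f := fun u : E3 => u.2.2) ((z, 0, q) : E3) hk
      ((hasFDerivAt_snd (𝕜 := ℝ)).comp _ hasFDerivAt_snd)
  have h1 := hd.add (((hk'.mul (hd.pow 2))).mul_const (1 / 2))
  have h2 : HasFDerivAt (fun u : E3 => u.2.1) _ ((z, 0, q) : E3) :=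
    (hasFDerivAt_fst (𝕜 := ℝ) (p := ((0, q) : ℝ × ℝ))).comp ((z, 0, q) : E3) hasFDerivAt_snd
  have hev : ∀ᶠ u : E3 in 𝓝 (z, 0, q), 0 < 1 + 2 * planarCurvature γ u.2.2 * u.2.1 := by
    have hc : Continuous fun u : E3 => 1 + 2 * planarCurvature γ u.2.2 * u.2.1 := by
      have := (contDiff_planarCurvature h).continuous
      fun_prop
    exact hc.continuousAt.eventually (lt_mem_nhds hu)
  have h3 := h1.unique (h2.congr_of_eventuallyEq (hev.mono fun u hu => by
    have := tubeHeight_spec hu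
    simp only [Pi.add_apply, Pi.mul_apply, tubeDist]
    linear_combination this))
  have h4 := congrArg (fun L => L v) h3
  have h0 : tubeDist γ (z, 0, q) = 0 := tubeHeight_zero_right _
  simpa [h0] using h4

end Tube

theorem exists_injOn_of_fderiv_ker {f : E3 → E3} {a : E3} (hf : ContDiffAt ℝ ∞ f a)
    (hker : ∀ v, fderiv ℝ f a v = 0 → v = 0) : ∃ U ∈ 𝓝 a, InjOn f U := by
  have hinj : Function.Injective (fderiv ℝ f a : E3 →ₗ[ℝ] E3) :=
    (injective_iff_map_eq_zero _).2 hker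
  let e : E3 ≃L[ℝ] E3 := (LinearEquiv.ofInjectiveEndo _ hinj).toContinuousLinearEquiv
  have he : (e : E3 →L[ℝ] E3) = fderiv ℝ f a := by ext1 <;> rfl
  have hs : HasStrictFDerivAt f (e : E3 →L[ℝ] E3) a := he ▸ hf.hasStrictFDerivAt (by simp)
  refine ⟨hs.toOpenPartialHomeomorph.source, ?_, ?_⟩
  · exact hs.toOpenPartialHomeomorph.open_source.mem_nhds hs.mem_toOpenPartialHomeomorph_source
  · exact hs.toOpenPartialHomeomorph.injOn

/-- A Legendrian curve with planar speed one whose planar projection runs in a line of slope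
`m = ±1`. -/
theorem exists_linear_model {γ : ℝ → E3} (h : ContDiff ℝ ∞ γ)
    (hunit : ∀ s, (deriv γ s).1 ^ 2 + (deriv γ s).2.1 ^ 2 = 1)
    (hleg : ∀ s, alphaStd (γ s) (deriv γ s) = 0) {b : E3} {t m : ℝ} (hm : m ^ 2 = 1)
    (hb : γ t = b) (hline : ∀ᶠ t' in 𝓝 t, (γ t').2.1 - b.2.1 = m * ((γ t').1 - b.1)) :
    ∃ η > 0, ∃ σ : ℝ, (σ = 1 ∨ σ = -1) ∧ ∀ q, |q| < η →
      γ (t + q) = (b.1 + σ * q / √2, b.2.1 + m * σ * q / √2,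
        b.2.2 + b.2.1 * (σ * q / √2) + m * q ^ 2 / 4) ∧
      (deriv γ (t + q)).1 = σ / √2 ∧ (deriv γ (t + q)).2.1 = m * σ / √2 ∧
      planarCurvature γ (t + q) = 0 := by
  obtain ⟨η, hη, hball⟩ := Metric.eventually_nhds_iff_ball.1 hline
  have hs2 : √(2 : ℝ) ^ 2 = 2 := Real.sq_sqrt (by norm_num)
  have hs0 : √(2 : ℝ) ≠ 0 := by positivity
  have hd : ∀ s, HasDerivAt γ (deriv γ s) s := fun s =>
    (h.differentiable (by simp) s).hasDerivAt
  have h1 := contDiff_deriv_of_infty h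
  have hd' : ∀ s, HasDerivAt (deriv γ) (deriv (deriv γ) s) s := fun s =>
    (h1.differentiable (by simp) s).hasDerivAt
  have hopen : IsOpen (Metric.ball t η) := Metric.isOpen_ball
  have hpre : IsPreconnected (Metric.ball t η) := (convex_ball t η).isPreconnected
  have hslope : ∀ s ∈ Metric.ball t η, (deriv γ s).2.1 = m * (deriv γ s).1 := by
    intro s hs
    have e1 := (HasDerivAt.snd_fst_E3 (hd s)).sub_const b.2.1
    have e2 := ((HasDerivAt.fst_E3 (hd s)).sub_const b.1).const_mul m
    exact e1.unique (e2.congr_of_eventuallyEq ((hopen.mem_nhds hs) |> fun hh =>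
      Filter.mem_of_superset hh fun x hx => hball x hx))
  have hsq : ∀ s ∈ Metric.ball t η, (deriv γ s).1 ^ 2 = 1 / 2 := by
    intro s hs
    have := hunit s
    rw [hslope s hs] at this
    nlinarith [hm]
  have hcase : ∃ σ : ℝ, (σ = 1 ∨ σ = -1) ∧ ∀ s ∈ Metric.ball t η, (deriv γ s).1 = σ / √2 := by
    have hc : ContinuousOn (fun s => (deriv γ s).1) (Metric.ball t η) := by
      have := h1.continuous
      fun_prop
    rcases hpre.eq_or_eq_neg_of_sq_eq hc (g := fun _ => 1 / √2) continuousOn_const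
      (fun s hs => by
        have := hsq s hs
        simp only [Pi.pow_apply, this, div_pow, hs2]; norm_num)
      (fun _ => by positivity) with hh | hh
    · exact ⟨1, Or.inl rfl, fun s hs => hh hs⟩
    · exact ⟨-1, Or.inr rfl, fun s hs => (hh hs).trans (by simp; ring)⟩
  obtain ⟨σ, hσ, hx'⟩ := hcase
  have hσ2 : σ ^ 2 = 1 := by rcases hσ with rfl | rfl <;> norm_num
  have hconst : ∀ (F G F' : ℝ → ℝ), (∀ s ∈ Metric.ball t η, HasDerivAt F (F' s) s) →
      (∀ s ∈ Metric.ball t η, HasDerivAt G (F' s) s) → F t = G t →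
      ∀ s ∈ Metric.ball t η, F s = G s := by
    intro F G F' hF hG h0 s hs
    have := hopen.is_const_of_deriv_eq_zero (f := fun s => F s - G s) hpre
      (fun s hs => ((hF s hs).sub (hG s hs)).differentiableAt.differentiableWithinAt)
      (fun s hs => (((hF s hs).sub (hG s hs)).congr_deriv (sub_self _)).deriv) hs
      (Metric.mem_ball_self hη)
    simp only [h0, sub_self] at this
    linarith
  have hX : ∀ s ∈ Metric.ball t η, (γ s).1 = b.1 + σ * (s - t) / √2 := by
    refine hconst _ _ (fun _ => σ / √2) (fun s hs => ?_) (fun s hs => ?_) (by simp [hb])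
    · rw [← hx' s hs]; exact HasDerivAt.fst_E3 (hd s)
    · have := (((hasDerivAt_id s).sub_const t).const_mul (σ / √2)).const_add b.1
      simp only [mul_one, id] at this
      exact this.congr_of_eventuallyEq (Eventually.of_forall fun x => by ring)
  have hY : ∀ s ∈ Metric.ball t η, (γ s).2.1 = b.2.1 + m * σ * (s - t) / √2 := by
    intro s hs
    have := hball s hs
    rw [hX s hs] at this
    linear_combination this
  have hZ : ∀ s ∈ Metric.ball t η, (γ s).2.2 =
      b.2.2 + b.2.1 * (σ * (s - t) / √2) + m * (s - t) ^ 2 / 4 := by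
    refine hconst _ _ (fun s => (γ s).2.1 * (deriv γ s).1) (fun s hs => ?_) (fun s hs => ?_)
      (by simp [hb])
    · have h3 := hleg s
      simp [alphaStd] at h3
      have h4 := HasDerivAt.snd_snd_E3 (hd s)
      rwa [show (deriv γ s).2.2 = (γ s).2.1 * (deriv γ s).1 by linarith] at h4
    · rw [hY s hs, hx' s hs]
      have e0 := (hasDerivAt_id s).sub_const t
      have := ((e0.const_mul (b.2.1 * (σ / √2))).const_add b.2.2).add
        ((e0.pow 2).const_mul (m / 4))
      refine (this.congr_of_eventuallyEq (Eventually.of_forall fun x => ?_)).congr_deriv ?_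
      · simp; ring
      · simp
        have h5 : (σ / √2) * (σ / √2) = 1 / 2 := by
          rw [div_mul_div_comm, ← sq, ← sq, hσ2, hs2]
        linear_combination (-(m * (s - t))) * h5
  refine ⟨η, hη, σ, hσ, fun q hq => ?_⟩
  have hmem : t + q ∈ Metric.ball t η := by simpa using hq
  have hX2 : (deriv (deriv γ) (t + q)).1 = 0 := by
    refine (HasDerivAt.fst_E3 (hd' (t + q))).unique
      ((hasDerivAt_const (t + q) (σ / √2)).congr_of_eventuallyEq ?_)
    exact Filter.mem_of_superset (hopen.mem_nhds hmem) fun s hs => hx' s hs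
  have hY2 : (deriv (deriv γ) (t + q)).2.1 = 0 := by
    refine (HasDerivAt.snd_fst_E3 (hd' (t + q))).unique
      ((hasDerivAt_const (t + q) (m * (σ / √2))).congr_of_eventuallyEq ?_)
    refine Filter.mem_of_superset (hopen.mem_nhds hmem) fun s hs => ?_
    change (deriv γ s).2.1 = _
    rw [hslope s hs, hx' s hs]
  refine ⟨?_, hx' _ hmem, ?_, ?_⟩
  · ext
    · simpa using hX _ hmem
    · simpa using hY _ hmem
    · simpa using hZ _ hmem
  · rw [hslope _ hmem, hx' _ hmem]; ring
  · simp [planarCurvature, hX2, hY2]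

theorem periodic_add_int {α : Type*} {g : ℝ → α} (h : ∀ s, g (s + 1) = g s) (s : ℝ) (n : ℤ) :
    g (s + n) = g s := by
  have hp : Function.Periodic g 1 := h
  simpa using hp.int_mul n s

theorem deriv_periodic {γ : ℝ → E3} (h : ∀ s, γ (s + 1) = γ s) (s : ℝ) :
    deriv γ (s + 1) = deriv γ s := by
  rw [← deriv_comp_add_const, funext h]

theorem tube_periodic {γ : ℝ → E3} (h : ∀ s, γ (s + 1) = γ s) (z p q : ℝ) :
    tube γ (z, p, q + 1) = tube γ (z, p, q) := by
  have h1 := deriv_periodic h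
  have h2 := deriv_periodic h1
  simp only [tube, tubeDist, planarCurvature, h, h1, h2]

theorem planarCurvature_periodic {γ : ℝ → E3} (h : ∀ s, γ (s + 1) = γ s) (s : ℝ) :
    planarCurvature γ (s + 1) = planarCurvature γ s := by
  have h1 := deriv_periodic h
  have h2 := deriv_periodic h1
  simp only [planarCurvature, h1, h2]

theorem tube_core (γ : ℝ → E3) (q : ℝ) : tube γ (0, 0, q) = γ q := by
  simp [tube, tubeDist, tubeHeight_zero_right]

namespace LegendrianLink

variable {ι : Type*} (Λ : LegendrianLink ι)

theorem param_add_int (i : ι) (s : ℝ) (n : ℤ) : Λ.param i (s + n) = Λ.param i s :=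
  periodic_add_int (Λ.periodic i) s n

theorem exists_tube_injOn (hunit : Λ.UnitSpeed) (i : ι) (q : ℝ) :
    ∃ U ∈ 𝓝 ((0, 0, q) : E3), InjOn (tube (Λ.param i)) U := by
  have hpos : (0 : ℝ) < 1 + 2 * planarCurvature (Λ.param i) ((0, 0, q) : E3).2.2
      * ((0, 0, q) : E3).2.1 := by simp
  refine exists_injOn_of_fderiv_ker (contDiffAt_tube (Λ.smooth i) hpos) fun v hv => ?_
  have hc := tube_contact (Λ.smooth i) (hunit i) (Λ.legendrian i) hpos v
  rw [hv] at hc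
  rw [fderiv_tube (Λ.smooth i) hpos, fderiv_tubeDist_zero (Λ.smooth i)] at hv
  have h0 : tubeDist (Λ.param i) (0, 0, q) = 0 := tubeHeight_zero_right _
  simp only [h0, Prod.ext_iff] at hv
  have hu := hunit i q
  obtain ⟨h1, h2, -⟩ := hv
  simp at h1 h2
  simp [alphaModel] at hc
  have hq : v.2.2 = 0 := by
    linear_combination (deriv (Λ.param i) q).1 * h1 + (deriv (Λ.param i) q).2.1 * h2 - v.2.2 * hu
  have hp : v.2.1 = 0 := by
    linear_combination (deriv (Λ.param i) q).2.1 * h1 - (deriv (Λ.param i) q).1 * h2 - v.2.1 * hu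
  ext
  · simpa using hc.symm
  · simpa using hp
  · simpa using hq

/-- On a small box the tubes are disjoint embeddings. -/
theorem exists_tube_radius [Finite ι] (hunit : Λ.UnitSpeed) : ∃ R : ℝ, 0 < R ∧
    (∀ i, ∀ u ∈ openBox R, 0 < 1 + 2 * planarCurvature (Λ.param i) u.2.2 * u.2.1) ∧
    ∀ i j, ∀ u ∈ openBox R, ∀ v ∈ openBox R, tube (Λ.param i) u = tube (Λ.param j) v →
      i = j ∧ v.1 = u.1 ∧ v.2.1 = u.2.1 ∧ ∃ n : ℤ, v.2.2 = u.2.2 + n := by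
  have key : ∀ i j : ι, ∀ᶠ w : (ℝ × ℝ) × (ℝ × ℝ) in 𝓝 0, ∀ y ∈ Icc (0 : ℝ) 1 ×ˢ Icc (0 : ℝ) 1,
      0 < 1 + 2 * planarCurvature (Λ.param i) y.1 * w.1.2 ∧
      (tube (Λ.param i) (w.1.1, w.1.2, y.1) = tube (Λ.param j) (w.2.1, w.2.2, y.2) →
        i = j ∧ w.2.1 = w.1.1 ∧ w.2.2 = w.1.2 ∧ ∃ n : ℤ, y.2 = y.1 + n) := by
    intro i j
    refine IsCompact.eventually_forall_of_forall_eventually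
      (isCompact_Icc.prod isCompact_Icc) fun y _ => ?_
    obtain ⟨s, t⟩ := y
    have hk := (contDiff_planarCurvature (Λ.smooth i)).continuous
    refine Eventually.and ?_ ?_
    · have hc : Continuous fun z : ((ℝ × ℝ) × (ℝ × ℝ)) × (ℝ × ℝ) =>
          1 + 2 * planarCurvature (Λ.param i) z.2.1 * z.1.1.2 := by fun_prop
      exact hc.continuousAt.eventually (lt_mem_nhds (by simp))
    · have hcont : ∀ (k : ι) (r : ℝ), ContinuousAt (tube (Λ.param k)) (0, 0, r) := fun k r =>
        (contDiffAt_tube (Λ.smooth k) (by simp)).continuousAt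
      have c1 : ContinuousAt (fun z : ((ℝ × ℝ) × (ℝ × ℝ)) × (ℝ × ℝ) =>
          ((z.1.1.1, z.1.1.2, z.2.1) : E3)) (0, (s, t)) := by fun_prop
      have c2 : ContinuousAt (fun z : ((ℝ × ℝ) × (ℝ × ℝ)) × (ℝ × ℝ) =>
          ((z.1.2.1, z.1.2.2, z.2.2) : E3)) (0, (s, t)) := by fun_prop
      have c2' : ∀ n : ℤ, ContinuousAt (fun z : ((ℝ × ℝ) × (ℝ × ℝ)) × (ℝ × ℝ) =>
          ((z.1.2.1, z.1.2.2, z.2.2 - n) : E3)) (0, (s, t)) := fun n => by fun_prop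
      by_cases heq : Λ.param i s = Λ.param j t
      · obtain ⟨rfl, n, rfl⟩ := Λ.embedded i j s t heq
        obtain ⟨U, hU, hinj⟩ := Λ.exists_tube_injOn hunit i s
        have e1 := c1.eventually_mem (s := U) hU
        have e2 := (c2' n).eventually_mem (s := U) (by simpa using hU)
        filter_upwards [e1, e2] with z h1 h2 h
        have h3 : tube (Λ.param i) (z.1.2.1, z.1.2.2, z.2.2)
            = tube (Λ.param i) (z.1.2.1, z.1.2.2, z.2.2 - n) := by
          simpa using periodic_add_int (g := fun q => tube (Λ.param i) (z.1.2.1, z.1.2.2, q))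
            (fun q => tube_periodic (Λ.periodic i) _ _ q) (z.2.2 - n) n
        have h4 := hinj h1 h2 (h.trans h3)
        simp only [Prod.mk.injEq] at h4
        exact ⟨rfl, h4.1.symm, h4.2.1.symm, n, by linarith [h4.2.2]⟩
      · have d1 := ContinuousAt.comp (f := fun z : ((ℝ × ℝ) × (ℝ × ℝ)) × (ℝ × ℝ) =>
          ((z.1.1.1, z.1.1.2, z.2.1) : E3)) (x := (0, (s, t))) (hcont i s) c1
        have d2 := ContinuousAt.comp (f := fun z : ((ℝ × ℝ) × (ℝ × ℝ)) × (ℝ × ℝ) =>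
          ((z.1.2.1, z.1.2.2, z.2.2) : E3)) (x := (0, (s, t))) (hcont j t) c2
        have hne := (ContinuousAt.ne_iff_eventually_ne d1 d2).1 (by simpa [tube_core] using heq)
        filter_upwards [hne] with z hz h
        exact absurd h hz
  have key' := eventually_all.2 fun i => eventually_all.2 (key i)
  obtain ⟨R, hR, hball⟩ := Metric.eventually_nhds_iff_ball.1 key'
  have hmem : ∀ u ∈ openBox R, ∀ v ∈ openBox R,
      (((u.1, u.2.1), (v.1, v.2.1)) : (ℝ × ℝ) × (ℝ × ℝ)) ∈ Metric.ball 0 R := by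
    intro u hu v hv
    simp only [openBox, mem_ofPred_eq] at hu hv
    simp [Prod.norm_def, hu.1, hu.2, hv.1, hv.2]
  have hfr : ∀ i z p q, tube (Λ.param i) (z, p, Int.fract q) = tube (Λ.param i) (z, p, q) := by
    intro i z p q
    have := periodic_add_int (g := fun q => tube (Λ.param i) (z, p, q))
            (fun q => tube_periodic (Λ.periodic i) _ _ q) (Int.fract q) ⌊q⌋
    rw [Int.fract_add_floor] at this
    exact this.symm
  have hfm : ∀ q : ℝ, Int.fract q ∈ Icc (0 : ℝ) 1 := fun q =>
    ⟨Int.fract_nonneg q, (Int.fract_lt_one q).le⟩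
  refine ⟨R, hR, fun i u hu => ?_, fun i j u hu v hv h => ?_⟩
  · have := (hball _ (hmem u hu u hu) i i (Int.fract u.2.2, Int.fract u.2.2) ⟨hfm _, hfm _⟩).1
    have h2 := periodic_add_int (planarCurvature_periodic (Λ.periodic i)) (Int.fract u.2.2) ⌊u.2.2⌋
    rw [Int.fract_add_floor] at h2
    rw [h2]
    exact this
  · obtain ⟨h1, h2, h3, n, h4⟩ := (hball _ (hmem u hu v hv) i j
      (Int.fract u.2.2, Int.fract v.2.2) ⟨hfm _, hfm _⟩).2 (by simpa only [hfr] using h)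
    refine ⟨h1, h2, h3, n + ⌊v.2.2⌋ - ⌊u.2.2⌋, ?_⟩
    simp only at h4
    have e1 := Int.fract_add_floor u.2.2
    have e2 := Int.fract_add_floor v.2.2
    push_cast
    linarith

theorem nonempty_standardNeighborhood [Finite ι] (hunit : Λ.UnitSpeed) (hgood : Λ.GoodPosition) :
    Nonempty (StandardNeighborhood Λ) := by
  obtain ⟨R, hR, hpos, hinj⟩ := Λ.exists_tube_radius hunit
  have hs2 : √(2 : ℝ) ^ 2 = 2 := Real.sq_sqrt (by norm_num)
  have h20 : √(2 : ℝ) ≠ 0 := by positivity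
  have hfrac : ∀ a c : ℝ, (a / √2) * (c / √2) = a * c / 2 := fun a c => by
    rw [div_mul_div_comm, ← sq, hs2]
  exact ⟨{
    radius := R
    radius_pos := hR
    map := fun i => tube (Λ.param i)
    smooth := fun i u hu => (contDiffAt_tube (Λ.smooth i) (hpos i u hu)).contDiffWithinAt
    periodic := fun i u _ => tube_periodic (Λ.periodic i) _ _ _
    injective := hinj
    contact := fun i u hu v =>
      tube_contact (Λ.smooth i) (hunit i) (Λ.legendrian i) (hpos i u hu) v
    core := fun i q => tube_core _ q
    complex := fun i z q hz => by
      have h0 : tubeDist (Λ.param i) (z, 0, q) = 0 := tubeHeight_zero_right _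
      simp [fderiv_tube (Λ.smooth i) (u := (z, 0, q)) (by simp),
        fderiv_tubeDist_zero (Λ.smooth i), h0]
    over_crossing := fun r t ht => by
      obtain ⟨s, hs⟩ := r.tail_mem
      have hl := (hgood.2 r s t hs ht).1
      obtain ⟨η, hη, σ, hσ, H⟩ := exists_linear_model (Λ.smooth r.tgt) (hunit _)
        (Λ.legendrian _) (m := -1) (by norm_num) ht (hl.mono fun t' ⟨a, h1, h2⟩ => by
          rw [h1, h2]; ring)
      have hσ2 : σ * σ = 1 := by rcases hσ with rfl | rfl <;> norm_num
      refine ⟨η, hη, σ, hσ, fun z p q _ _ hq => ?_⟩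
      obtain ⟨h1, h2, h3, h4⟩ := H q hq
      simp only [tube, tubeDist, h1, h2, h3, h4, tubeHeight_zero_left, overModel, Prod.mk.injEq]
      refine ⟨by ring, by ring, ?_⟩
      rw [hfrac]
      have e1 := hfrac (-1 * σ * q) (-1 * σ)
      have e2 : -1 * σ * q / √2 * (-1 * σ / √2) = q / 2 := by
        rw [e1]; linear_combination (q / 2) * hσ2
      linear_combination p * e2 + (q ^ 2 / 4 - p * q / 2) * hσ2
    under_crossing := fun r s hs => by
      obtain ⟨t, ht⟩ := r.tip_mem
      have hl := (hgood.2 r s t hs ht).2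
      obtain ⟨η, hη, σ, hσ, H⟩ := exists_linear_model (Λ.smooth r.src) (hunit _)
        (Λ.legendrian _) (m := 1) (by norm_num) hs (hl.mono fun t' ⟨a, h1, h2⟩ => by
          rw [h1, h2]; ring)
      have hσ2 : σ * σ = 1 := by rcases hσ with rfl | rfl <;> norm_num
      refine ⟨η, hη, σ, hσ, fun z p q _ _ hq => ?_⟩
      obtain ⟨h1, h2, h3, h4⟩ := H q hq
      simp only [tube, tubeDist, h1, h2, h3, h4, tubeHeight_zero_left, underModel, Prod.mk.injEq]
      refine ⟨by ring, by ring, ?_⟩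
      rw [hfrac]
      have e1 := hfrac (1 * σ * q) (1 * σ)
      have e2 : 1 * σ * q / √2 * (1 * σ / √2) = q / 2 := by
        rw [e1]; linear_combination (q / 2) * hσ2
      linear_combination p * e2 + (-(p * q) / 2 - q ^ 2 / 4) * hσ2 }⟩

end LegendrianLink

/-! ### Twist functions -/

namespace IsTwist

variable {η : ℝ} {f : ℝ → ℝ} (hf : IsTwist η f)
include hf

theorem margin_lt_one : η < 1 := by
  by_contra h
  have h0 := hf.eq_zero 0 (by linarith)
  rw [hf.eq_one 0 (by linarith)] at h0
  exact one_ne_zero h0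

theorem hasDerivAt (p : ℝ) : HasDerivAt f (deriv f p) p :=
  (hf.smooth.differentiable (by simp) p).hasDerivAt

theorem monotone : Monotone f :=
  monotone_of_deriv_nonneg (hf.smooth.differentiable (by simp)) hf.deriv_nonneg

theorem nonneg (p : ℝ) : 0 ≤ f p := by
  rw [← hf.eq_zero (min p (-(1 - η))) (min_le_right _ _)]
  exact hf.monotone (min_le_left _ _)

theorem le_one (p : ℝ) : f p ≤ 1 := by
  rw [← hf.eq_one (max p (1 - η)) (le_max_right _ _)]
  exact hf.monotone (le_max_left _ _)

theorem deriv_eq_zero {p : ℝ} (hp : 1 - η < |p|) : deriv f p = 0 := by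
  rcases lt_abs.1 hp with h | h
  · have : f =ᶠ[𝓝 p] fun _ => 1 := by
      filter_upwards [lt_mem_nhds h] with x hx using hf.eq_one x hx.le
    simpa using this.deriv_eq
  · have : f =ᶠ[𝓝 p] fun _ => 0 := by
      filter_upwards [gt_mem_nhds (show p < -(1 - η) by linarith)] with x hx
        using hf.eq_zero x hx.le
    simpa using this.deriv_eq

theorem add_neg (p : ℝ) : f p + f (-p) = 1 := by
  have hd : ∀ x, HasDerivAt (fun x => f x + f (-x)) 0 x := fun x => by
    have h1 := (hf.hasDerivAt (-x)).scomp x (hasDerivAt_neg x)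
    have h2 := (hf.hasDerivAt x).add h1
    refine h2.congr_deriv ?_
    rw [hf.deriv_even]; simp
  have := is_const_of_deriv_eq_zero (fun x => (hd x).differentiableAt) (fun x => (hd x).deriv) p 1
  have h0 := hf.margin_pos
  rw [this, hf.eq_one 1 (by linarith), hf.eq_zero (-1) (by linarith), add_zero]

theorem eq_of_deriv_eq_one {m : ℝ} (h : ∀ p, |p| ≤ m → deriv f p = 1) {p : ℝ} (hp : |p| ≤ m) :
    f p = p + 1 / 2 := by
  have h0 : f 0 = 1 / 2 := by have := hf.add_neg 0; simp at this; linarith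
  have hm : 0 ≤ m := (abs_nonneg p).trans hp
  rcases hm.eq_or_lt with rfl | hm'
  · simp [abs_nonpos_iff.1 hp, h0]
  have := (convex_Icc (-m) m).is_const_of_fderivWithin_eq_zero (𝕜 := ℝ) (f := fun x => f x - x)
    (fun x _ => ((hf.hasDerivAt x).sub (hasDerivAt_id x)).differentiableAt.differentiableWithinAt)
    (fun x hx => by
      have hu := uniqueDiffOn_Icc (show -m < m by linarith) x hx
      have hd := ((hf.hasDerivAt x).sub (hasDerivAt_id x))
      rw [h x (abs_le.2 hx), sub_self] at hd
      have h3 : HasFDerivWithinAt (fun x => f x - x) (0 : ℝ →L[ℝ] ℝ) (Icc (-m) m) x := by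
        have := hd.hasFDerivAt.hasFDerivWithinAt (s := Icc (-m) m)
        refine this.congr_fderiv ?_
        ext; simp
      exact h3.fderivWithin hu)
    (abs_le.1 hp) (x := p) (y := 0) (by simp [hm])
  simp only [h0] at this
  linarith

end IsTwist

/-- The smooth function used to build twists: `0` left of `-δ`, `1` right of `δ`. -/
def smoothStep (δ x : ℝ) : ℝ := Real.smoothTransition ((x / δ + 1) / 2)

theorem smoothStep_neg (δ x : ℝ) : smoothStep δ (-x) = 1 - smoothStep δ x := by
  unfold smoothStep Real.smoothTransition
  have h := Real.smoothTransition.pos_denom ((x / δ + 1) / 2)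
  rw [show (-x / δ + 1) / 2 = 1 - (x / δ + 1) / 2 by ring, sub_sub_cancel,
    add_comm (expNegInvGlue (1 - _)), eq_sub_iff_add_eq, ← add_div, add_comm,
    div_self h.ne']

theorem contDiff_smoothStep (δ : ℝ) : ContDiff ℝ ∞ (smoothStep δ) := by
  unfold smoothStep
  exact Real.smoothTransition.contDiff.comp (by fun_prop)

theorem smoothStep_eq_zero {δ x : ℝ} (hδ : 0 < δ) (hx : x ≤ -δ) : smoothStep δ x = 0 := by
  apply Real.smoothTransition.zero_of_nonpos
  have : x / δ ≤ -1 := by rw [div_le_iff₀ hδ]; linarith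
  linarith

theorem smoothStep_eq_one {δ x : ℝ} (hδ : 0 < δ) (hx : δ ≤ x) : smoothStep δ x = 1 := by
  apply Real.smoothTransition.one_of_one_le
  have : 1 ≤ x / δ := by rw [le_div_iff₀ hδ]; linarith
  linarith

theorem smoothStep_monotone {δ : ℝ} (hδ : 0 < δ) : Monotone (smoothStep δ) := fun x y h =>
  Real.smoothTransition.monotone (by gcongr)

theorem exists_isTwist {δ : ℝ} (hδ : 0 < δ) (hδ' : δ < 1 / 2) :
    ∃ (η : ℝ) (f : ℝ → ℝ), IsTwist η f ∧ ∀ p, |p| ≤ 1 / 2 - δ → deriv f p = 1 := by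
  have hT := contDiff_smoothStep δ
  have hTd : ∀ x, HasDerivAt (fun x => ∫ t in (0 : ℝ)..x, smoothStep δ t) (smoothStep δ x) x :=
    fun x => intervalIntegral.integral_hasDerivAt_right (hT.continuous.intervalIntegrable _ _)
      (hT.continuous.stronglyMeasurableAtFilter _ _) hT.continuous.continuousAt
  let F : ℝ → ℝ := fun x => ∫ t in (0 : ℝ)..x, smoothStep δ t
  have hF : ContDiff ℝ ∞ F := by
    refine contDiff_infty_iff_deriv.2 ⟨fun x => (hTd x).differentiableAt, ?_⟩
    rwa [show deriv F = smoothStep δ from funext fun x => (hTd x).deriv]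
  let f : ℝ → ℝ := fun p => F (p + 1 / 2) - F (p - 1 / 2)
  have hfe : ∀ p, f p = ∫ t in (p - 1 / 2)..(p + 1 / 2), smoothStep δ t := fun p =>
    intervalIntegral.integral_interval_sub_left (hT.continuous.intervalIntegrable _ _)
      (hT.continuous.intervalIntegrable _ _)
  have hfd : ∀ p, deriv f p = smoothStep δ (p + 1 / 2) - smoothStep δ (p - 1 / 2) := fun p =>
    (((hTd _).comp_add_const p (1 / 2)).sub ((hTd _).comp_sub_const p (1 / 2))).deriv
  refine ⟨1 / 2 - δ, f, ⟨by linarith, ?_, ?_, ?_, ?_, ?_, ?_⟩, ?_⟩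
  · exact (hF.comp (by fun_prop)).sub (hF.comp (by fun_prop))
  · intro p hp
    rw [hfe, intervalIntegral.integral_congr (g := fun _ => (0 : ℝ))]
    · simp
    · intro x hx
      rw [uIcc_of_le (by linarith)] at hx
      exact smoothStep_eq_zero hδ (by linarith [hx.2])
  · intro p hp
    rw [hfe, intervalIntegral.integral_congr (g := fun _ => (1 : ℝ))]
    · simp; norm_num
    · intro x hx
      rw [uIcc_of_le (by linarith)] at hx
      exact smoothStep_eq_one hδ (by linarith [hx.1])
  · intro p
    rw [hfd]
    linarith [smoothStep_monotone hδ (show p - 1 / 2 ≤ p + 1 / 2 by linarith)]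
  · intro p
    rw [hfd]
    have h1 : smoothStep δ (p + 1 / 2) ≤ 1 := Real.smoothTransition.le_one _
    have h2 : 0 ≤ smoothStep δ (p - 1 / 2) := Real.smoothTransition.nonneg _
    linarith
  · intro p
    rw [hfd, hfd, show -p + 1 / 2 = -(p - 1 / 2) by ring, show -p - 1 / 2 = -(p + 1 / 2) by ring,
      smoothStep_neg, smoothStep_neg]
    ring
  · intro p hp
    obtain ⟨h1, h2⟩ := abs_le.1 hp
    rw [hfd, smoothStep_eq_one hδ (by linarith), smoothStep_eq_zero hδ (by linarith), sub_zero]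

namespace IsTwist

variable {η ε : ℝ} {f : ℝ → ℝ} (hf : IsTwist η f)
include hf

theorem contDiff_scaledTwist : ContDiff ℝ ∞ (scaledTwist f ε) :=
  hf.smooth.comp (by fun_prop)

theorem hasDerivAt_scaledTwist (p : ℝ) :
    HasDerivAt (scaledTwist f ε) (deriv f (p / ε) / ε) p := by
  exact ((hf.hasDerivAt (p / ε)).comp p ((hasDerivAt_id p).div_const ε)).congr_deriv (by ring)

theorem deriv_scaledTwist (p : ℝ) : deriv (scaledTwist f ε) p = deriv f (p / ε) / ε :=
  (hf.hasDerivAt_scaledTwist p).deriv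

theorem deriv_scaledTwist_eq_zero (hε : 0 < ε) {p : ℝ} (hp : (1 - η) * ε < |p|) :
    deriv (scaledTwist f ε) p = 0 := by
  rw [hf.deriv_scaledTwist, hf.deriv_eq_zero, zero_div]
  rwa [abs_div, abs_of_pos hε, lt_div_iff₀ hε]

theorem scaledTwist_nonneg (p : ℝ) : 0 ≤ scaledTwist f ε p := hf.nonneg _

theorem scaledTwist_le_one (p : ℝ) : scaledTwist f ε p ≤ 1 := hf.le_one _

theorem scaledTwist_eq_zero (hε : 0 < ε) {p : ℝ} (hp : p ≤ -((1 - η) * ε)) :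
    scaledTwist f ε p = 0 := hf.eq_zero _ (by rw [div_le_iff₀ hε]; linarith)

theorem scaledTwist_eq_one (hε : 0 < ε) {p : ℝ} (hp : (1 - η) * ε ≤ p) :
    scaledTwist f ε p = 1 := hf.eq_one _ (by rwa [le_div_iff₀ hε])

theorem continuous_twistDensity : Continuous fun P => P * deriv (scaledTwist f ε) P := by
  have := (contDiff_infty_iff_deriv.1 (hf.contDiff_scaledTwist (ε := ε))).2.continuous
  fun_prop

theorem twistPrimitive_eq_zero_of_le (hε : 0 < ε) {p : ℝ} (hp : p ≤ -((1 - η) * ε)) :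
    twistPrimitive f ε p = 0 := by
  have h1 := mul_pos (sub_pos.2 hf.margin_lt_one) hε
  unfold twistPrimitive
  rw [MeasureTheory.integral_Iic_eq_integral_Iio]
  refine MeasureTheory.setIntegral_eq_zero_of_forall_eq_zero fun x hx => ?_
  rw [hf.deriv_scaledTwist_eq_zero hε, mul_zero]
  have hx : x < p := hx
  rw [abs_of_neg (by linarith)]
  linarith

theorem hasDerivAt_twistPrimitive (hε : 0 < ε) (p : ℝ) :
    HasDerivAt (twistPrimitive f ε) (p * (deriv f (p / ε) / ε)) p := by
  have hc := hf.continuous_twistDensity (ε := ε)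
  have hi : MeasureTheory.Integrable fun P => P * deriv (scaledTwist f ε) P := by
    refine hc.integrable_of_hasCompactSupport ?_
    refine HasCompactSupport.intro (K := Icc (-((1 - η) * ε)) ((1 - η) * ε)) isCompact_Icc
      fun x hx => ?_
    rw [hf.deriv_scaledTwist_eq_zero hε, mul_zero]
    by_contra h
    exact hx (abs_le.1 (not_lt.1 h))
  have he : twistPrimitive f ε = fun p =>
      twistPrimitive f ε 0 + ∫ P in (0 : ℝ)..p, P * deriv (scaledTwist f ε) P := by
    funext p
    have := intervalIntegral.integral_Iic_sub_Iic hi.integrableOn (hi.integrableOn (s := Iic p))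
      (a := (0 : ℝ))
    unfold twistPrimitive
    linarith
  rw [he, ← hf.deriv_scaledTwist]
  exact (intervalIntegral.integral_hasDerivAt_right (hc.intervalIntegrable _ _)
      (hc.stronglyMeasurableAtFilter _ _) hc.continuousAt).const_add _

theorem continuous_twistPrimitive (hε : 0 < ε) : Continuous (twistPrimitive f ε) :=
  continuous_iff_continuousAt.2 fun p => (hf.hasDerivAt_twistPrimitive hε p).continuousAt

theorem twistPrimitive_neg (hε : 0 < ε) (p : ℝ) :
    twistPrimitive f ε (-p) = twistPrimitive f ε p := by
  have hd : ∀ x, HasDerivAt (fun x => twistPrimitive f ε x - twistPrimitive f ε (-x)) 0 x :=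
    fun x => by
    have h1 := (hf.hasDerivAt_twistPrimitive hε (-x)).scomp x (hasDerivAt_neg x)
    refine ((hf.hasDerivAt_twistPrimitive hε x).sub h1).congr_deriv ?_
    rw [neg_div, hf.deriv_even]; simp
  have := is_const_of_deriv_eq_zero (fun x => (hd x).differentiableAt) (fun x => (hd x).deriv) p 0
  simp at this
  linarith

theorem twistPrimitive_eq_zero (hε : 0 < ε) {p : ℝ} (hp : (1 - η) * ε ≤ |p|) :
    twistPrimitive f ε p = 0 := by
  rcases le_abs.1 hp with h | h
  · rw [← hf.twistPrimitive_neg hε]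
    exact hf.twistPrimitive_eq_zero_of_le hε (by linarith)
  · exact hf.twistPrimitive_eq_zero_of_le hε (by linarith)

theorem abs_twistPrimitive_le (hε : 0 < ε) (p : ℝ) : |twistPrimitive f ε p| ≤ (1 - η) * ε := by
  have hm := mul_pos (sub_pos.2 hf.margin_lt_one) hε
  have key : ∀ s : ℝ, (s = 1 ∨ s = -1) → 0 ≤ (1 - η) * ε + s * twistPrimitive f ε p := by
    intro s hs
    have hd : ∀ x, HasDerivAt
        (fun x => (1 - η) * ε * scaledTwist f ε x + s * twistPrimitive f ε x)
        (((1 - η) * ε + s * x) * (deriv f (x / ε) / ε)) x := fun x => by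
      refine (((hf.hasDerivAt_scaledTwist x).const_mul ((1 - η) * ε)).add
        ((hf.hasDerivAt_twistPrimitive hε x).const_mul s)).congr_deriv (by ring)
    have hmono := monotone_of_deriv_nonneg (fun x => (hd x).differentiableAt) fun x => by
      rw [(hd x).deriv]
      by_cases hx : (1 - η) * ε < |x|
      · rw [← hf.deriv_scaledTwist, hf.deriv_scaledTwist_eq_zero hε hx, mul_zero]
      · have := abs_le.1 (not_lt.1 hx)
        refine mul_nonneg ?_ (div_nonneg (hf.deriv_nonneg _) hε.le)
        rcases hs with rfl | rfl <;> linarith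
    have h1 := hmono (min_le_left p (-((1 - η) * ε)))
    simp only [hf.scaledTwist_eq_zero hε (min_le_right p (-((1 - η) * ε))),
      hf.twistPrimitive_eq_zero_of_le hε (min_le_right p (-((1 - η) * ε)))] at h1
    have h2 : (1 - η) * ε * scaledTwist f ε p ≤ (1 - η) * ε * 1 :=
      mul_le_mul_of_nonneg_left (hf.scaledTwist_le_one p) hm.le
    linarith
  have h1 := key 1 (Or.inl rfl)
  have h2 := key (-1) (Or.inr rfl)
  rw [abs_le]
  constructor <;> linarith

end IsTwist

/-! ### Reeb vector fields of the two model forms -/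

theorem differentiableAt_asForm {α : E3 → E3 →L[ℝ] ℝ} {u : E3} (h : DifferentiableAt ℝ α u) :
    DifferentiableAt ℝ (asForm α) u := by
  let e : (E3 →L[ℝ] ℝ) ≃ₗᵢ[ℝ] (E3 [⋀^Fin 1]→L[ℝ] ℝ) :=
    ContinuousAlternatingMap.ofSubsingletonLIE (0 : Fin 1)
  exact e.toContinuousLinearEquiv.toContinuousLinearMap.differentiableAt.comp u h

theorem extDeriv_asForm {α : E3 → E3 →L[ℝ] ℝ} {u : E3} {α' : E3 →L[ℝ] E3 →L[ℝ] ℝ}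
    (h : HasFDerivAt α α' u) (v w : E3) :
    extDeriv (asForm α) u ![v, w] = α' v w - α' w v := by
  have hap : ∀ x, HasFDerivAt (fun u => α u x) (α'.flip x) u := fun x =>
    ((ContinuousLinearMap.apply ℝ ℝ x).hasFDerivAt (x := α u)).comp u h
  rw [extDeriv_apply (differentiableAt_asForm h.differentiableAt)]
  have e : ∀ x : E3, (fun u => asForm α u ![x]) = fun u => α u x := fun x => rfl
  have r0 : Fin.removeNth (0 : Fin 2) ![v, w] = ![w] := by ext i : 1; fin_cases i; rfl
  have r1 : Fin.removeNth (1 : Fin 2) ![v, w] = ![v] := by ext i : 1; fin_cases i; rfl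
  rw [Fin.sum_univ_two, r0, r1, e, e, (hap w).fderiv, (hap v).fderiv]
  simp
  ring

theorem hasFDerivAt_alphaStd (u : E3) : HasFDerivAt alphaStd
    (-(((ContinuousLinearMap.fst ℝ ℝ ℝ).comp (ContinuousLinearMap.snd ℝ ℝ (ℝ × ℝ))).smulRight
      (ContinuousLinearMap.fst ℝ ℝ (ℝ × ℝ)))) u := by
  have h : HasFDerivAt (fun u : E3 => u.2.1)
      ((ContinuousLinearMap.fst ℝ ℝ ℝ).comp (ContinuousLinearMap.snd ℝ ℝ (ℝ × ℝ))) u :=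
    ((ContinuousLinearMap.fst ℝ ℝ ℝ).comp (ContinuousLinearMap.snd ℝ ℝ (ℝ × ℝ))).hasFDerivAt
  exact (h.smul_const (ContinuousLinearMap.fst ℝ ℝ (ℝ × ℝ))).const_sub _

theorem hasFDerivAt_alphaModel (u : E3) : HasFDerivAt alphaModel
    (((ContinuousLinearMap.fst ℝ ℝ ℝ).comp (ContinuousLinearMap.snd ℝ ℝ (ℝ × ℝ))).smulRight
      ((ContinuousLinearMap.snd ℝ ℝ ℝ).comp (ContinuousLinearMap.snd ℝ ℝ (ℝ × ℝ)))) u := by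
  have h : HasFDerivAt (fun u : E3 => u.2.1)
      ((ContinuousLinearMap.fst ℝ ℝ ℝ).comp (ContinuousLinearMap.snd ℝ ℝ (ℝ × ℝ))) u :=
    ((ContinuousLinearMap.fst ℝ ℝ ℝ).comp (ContinuousLinearMap.snd ℝ ℝ (ℝ × ℝ))).hasFDerivAt
  exact (h.smul_const ((ContinuousLinearMap.snd ℝ ℝ ℝ).comp
    (ContinuousLinearMap.snd ℝ ℝ (ℝ × ℝ)))).const_add _

theorem extDeriv_alphaStd (u v w : E3) :
    extDeriv (asForm alphaStd) u ![v, w] = v.1 * w.2.1 - v.2.1 * w.1 := by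
  rw [extDeriv_asForm (hasFDerivAt_alphaStd u)]
  simp
  ring

theorem extDeriv_alphaModel (u v w : E3) :
    extDeriv (asForm alphaModel) u ![v, w] = v.2.1 * w.2.2 - v.2.2 * w.2.1 := by
  rw [extDeriv_asForm (hasFDerivAt_alphaModel u)]
  simp
  ring

theorem isReebVector_alphaStd {u v : E3} : IsReebVector alphaStd u v ↔ v = (0, 0, 1) := by
  simp only [IsReebVector, extDeriv_alphaStd]
  constructor
  · rintro ⟨h1, h2⟩
    have h3 := h2 (0, 1, 0)
    have h4 := h2 (1, 0, 0)
    simp at h3 h4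
    simp [alphaStd, h3] at h1
    ext <;> simp [h1, h3, h4]
  · rintro rfl
    simp [alphaStd]

theorem isReebVector_alphaModel {u v : E3} : IsReebVector alphaModel u v ↔ v = (1, 0, 0) := by
  simp only [IsReebVector, extDeriv_alphaModel]
  constructor
  · rintro ⟨h1, h2⟩
    have h3 := h2 (0, 1, 0)
    have h4 := h2 (0, 0, 1)
    simp at h3 h4
    simp [alphaModel, h3] at h1
    ext <;> simp [h1, h3, h4]
  · rintro rfl
    simp [alphaModel]

/-! ### Geometry of a standard neighbourhood -/

theorem isOpen_openBox (r : ℝ) : IsOpen (openBox r) := by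
  have h1 : IsOpen {u : E3 | |u.1| < r} := isOpen_lt (by fun_prop) continuous_const
  have h2 : IsOpen {u : E3 | |u.2.1| < r} := isOpen_lt (by fun_prop) continuous_const
  exact h1.inter h2

namespace StandardNeighborhood

variable {ι : Type*} {Λ : LegendrianLink ι} (N : StandardNeighborhood Λ)

theorem contDiffAt (i : ι) {u : E3} (hu : u ∈ openBox N.radius) : ContDiffAt ℝ ∞ (N.map i) u :=
  (N.smooth i).contDiffAt ((isOpen_openBox _).mem_nhds hu)

theorem hasFDerivAt (i : ι) {u : E3} (hu : u ∈ openBox N.radius) :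
    HasFDerivAt (N.map i) (fderiv ℝ (N.map i) u) u :=
  ((N.contDiffAt i hu).differentiableAt (by simp)).hasFDerivAt

/-- `Φ_i` pulls `dx ∧ dy` back to `dp ∧ dq`. -/
theorem area (i : ι) {u : E3} (hu : u ∈ openBox N.radius) (v w : E3) :
    (fderiv ℝ (N.map i) u v).1 * (fderiv ℝ (N.map i) u w).2.1
      - (fderiv ℝ (N.map i) u v).2.1 * (fderiv ℝ (N.map i) u w).1
      = v.2.1 * w.2.2 - v.2.2 * w.2.1 := by
  have h1 := extDeriv_pullback (f := N.map i) (x := u) (r := ∞)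
    (differentiableAt_asForm (hasFDerivAt_alphaStd _).differentiableAt) (N.contDiffAt i hu)
    (by simpa using (by exact_mod_cast le_top : ((2 : ℕ∞) : WithTop ℕ∞) ≤ ∞))
  have h2 : (fun x => (asForm alphaStd (N.map i x)).compContinuousLinearMap
      (fderiv ℝ (N.map i) x)) =ᶠ[𝓝 u] asForm alphaModel := by
    filter_upwards [(isOpen_openBox _).mem_nhds hu] with x hx
    ext m
    exact N.contact i x hx (m 0)
  rw [h2.extDeriv_eq] at h1
  have h3 := congrArg (fun A => A ![v, w]) h1
  have e : (⇑(fderiv ℝ (N.map i) u) ∘ ![v, w]) =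
      ![fderiv ℝ (N.map i) u v, fderiv ℝ (N.map i) u w] := by
    ext k : 1; fin_cases k <;> rfl
  simp only [ContinuousAlternatingMap.compContinuousLinearMap_apply, e, extDeriv_alphaModel,
    extDeriv_alphaStd] at h3
  exact h3.symm

theorem fderiv_vertical (i : ι) {u : E3} (hu : u ∈ openBox N.radius) :
    fderiv ℝ (N.map i) u (1, 0, 0) = (0, 0, 1) := by
  have h1 := N.area i hu (1, 0, 0) (0, 1, 0)
  have h2 := N.area i hu (1, 0, 0) (0, 0, 1)
  have h3 := N.area i hu (0, 1, 0) (0, 0, 1)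
  have h4 := N.contact i u hu (1, 0, 0)
  simp at h1 h2 h3
  simp [alphaModel, alphaStd] at h4
  generalize fderiv ℝ (N.map i) u (1, 0, 0) = V at *
  generalize fderiv ℝ (N.map i) u (0, 1, 0) = P at *
  generalize fderiv ℝ (N.map i) u (0, 0, 1) = Q at *
  have e1 : V.1 = 0 := by linear_combination -(Q.1 * h1) + P.1 * h2 - V.1 * h3
  have e2 : V.2.1 = 0 := by linear_combination -(Q.2.1 * h1) + P.2.1 * h2 - V.2.1 * h3
  rw [e1] at h4
  ext
  · exact e1
  · exact e2
  · simpa using h4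

/-- `Φ_i` is equivariant for translations in the Reeb direction. -/
theorem map_vertical (i : ι) {z z' p q : ℝ} (hz : |z| < N.radius) (hz' : |z'| < N.radius)
    (hp : |p| < N.radius) :
    N.map i (z', p, q) = ((N.map i (z, p, q)).1, (N.map i (z, p, q)).2.1,
      (N.map i (z, p, q)).2.2 + (z' - z)) := by
  have hd : ∀ x ∈ Ioo (-N.radius) N.radius,
      HasDerivAt (fun x => N.map i (x, p, q) - (0, 0, x)) 0 x := by
    intro x hx
    have hu : ((x, p, q) : E3) ∈ openBox N.radius := ⟨abs_lt.2 hx, hp⟩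
    have h1 : HasDerivAt (fun x : ℝ => ((x, p, q) : E3)) (1, 0, 0) x :=
      (hasDerivAt_id x).prodMk (hasDerivAt_const x (p, q))
    have h2 := (N.hasFDerivAt i hu).comp_hasDerivAt x h1
    rw [N.fderiv_vertical i hu] at h2
    have h3 : HasDerivAt (fun x : ℝ => ((0, 0, x) : E3)) (0, 0, 1) x :=
      (hasDerivAt_const x 0).prodMk ((hasDerivAt_const x 0).prodMk (hasDerivAt_id x))
    exact (h2.sub h3).congr_deriv (sub_self _)
  have := isOpen_Ioo.is_const_of_deriv_eq_zero isPreconnected_Ioo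
    (fun x hx => (hd x hx).differentiableAt.differentiableWithinAt)
    (fun x hx => (hd x hx).deriv) (abs_lt.1 hz) (abs_lt.1 hz')
  rw [Prod.ext_iff, Prod.ext_iff] at this
  simp at this
  ext
  · exact this.1.symm
  · exact this.2.1.symm
  · simp only; linarith [this.2.2]

theorem map_add_int (i : ι) {z p : ℝ} (hz : |z| < N.radius) (hp : |p| < N.radius) (q : ℝ) (n : ℤ) :
    N.map i (z, p, q + n) = N.map i (z, p, q) :=
  periodic_add_int (g := fun q => N.map i (z, p, q)) (fun q => N.periodic i (z, p, q) ⟨hz, hp⟩) q n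

theorem isClosed_image (i : ι) {K : Set (ℝ × ℝ)} (hK : IsCompact K)
    (hsub : ∀ x ∈ K, |x.1| < N.radius ∧ |x.2| < N.radius) :
    IsClosed (N.map i '' {v | (v.1, v.2.1) ∈ K}) := by
  have hc : IsCompact (K ×ˢ Icc (0 : ℝ) 1) := hK.prod isCompact_Icc
  have himg := hc.image_of_continuousOn (f := fun y => N.map i (y.1.1, y.1.2, y.2)) fun y hy => by
    have h1 : ContinuousAt (N.map i) (y.1.1, y.1.2, y.2) :=
      (N.contDiffAt i (hsub _ hy.1)).continuousAt
    have h2 : Continuous fun y : (ℝ × ℝ) × ℝ => ((y.1.1, y.1.2, y.2) : E3) := by fun_prop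
    exact (ContinuousAt.comp (f := fun y : (ℝ × ℝ) × ℝ => ((y.1.1, y.1.2, y.2) : E3))
      h1 h2.continuousAt).continuousWithinAt
  convert himg.isClosed using 1
  ext x
  constructor
  · rintro ⟨v, hv, rfl⟩
    refine ⟨((v.1, v.2.1), Int.fract v.2.2), ⟨hv, Int.fract_nonneg _,
      (Int.fract_lt_one _).le⟩, ?_⟩
    have := N.map_add_int i (hsub _ hv).1 (hsub _ hv).2 (Int.fract v.2.2) ⌊v.2.2⌋
    rw [Int.fract_add_floor] at this
    exact this.symm
  · rintro ⟨y, ⟨h1, -⟩, rfl⟩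
    exact ⟨_, h1, rfl⟩

end StandardNeighborhood

/-- Translation in the Reeb direction of `(ℝ³, dz - y dx)`. -/
def lift (T : ℝ) (u : E3) : E3 := (u.1, u.2.1, u.2.2 + T)

theorem lift_lift (S T : ℝ) (u : E3) : lift S (lift T u) = lift (T + S) u := by
  simp [lift, add_assoc]

theorem lift_zero (u : E3) : lift 0 u = u := by simp [lift]

theorem lift_underModel_eq_overModel {b b' : E3} (h1 : b'.1 = b.1) (h2 : b'.2.1 = b.2.1)
    (z P Q z' P' Q' T : ℝ) :
    lift T (underModel b (z, P, Q)) = overModel b' (z', P', Q') ↔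
      P' = -Q ∧ Q' = P ∧ z' = z + T - (b'.2.2 - b.2.2) + P * Q := by
  have h0 : √(2 : ℝ) ≠ 0 := by positivity
  simp only [lift, underModel, overModel, Prod.mk.injEq, h1, h2]
  constructor
  · rintro ⟨e1, e2, e3⟩
    field_simp at e1 e2
    have hP : P' = -Q := by linarith
    have hQ : Q' = P := by linarith
    subst hP hQ
    refine ⟨rfl, rfl, ?_⟩
    linear_combination -e3
  · rintro ⟨rfl, rfl, rfl⟩
    refine ⟨by ring, by ring, by ring⟩

namespace LegendrianLink

variable {ι : Type*} {Λ : LegendrianLink ι}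

namespace Chord

variable (r : Λ.Chord)

/-- A parameter of the tail of a chord. -/
def tailParam : ℝ := r.tail_mem.choose

/-- A parameter of the tip of a chord. -/
def tipParam : ℝ := r.tip_mem.choose

theorem param_tailParam : Λ.param r.src r.tailParam = r.tail := r.tail_mem.choose_spec

theorem param_tipParam : Λ.param r.tgt r.tipParam = r.tip := r.tip_mem.choose_spec

/-- The length of a chord. -/
def height : ℝ := r.tip.2.2 - r.tail.2.2

theorem height_pos : 0 < r.height := sub_pos.2 r.height_lt

theorem lift_tail : lift r.height r.tail = r.tip := by
  ext
  · exact r.same_x.symm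
  · exact r.same_y.symm
  · simp [lift, height]

theorem exists_eq_tailParam_add {s : ℝ} (h : Λ.param r.src s = r.tail) :
    ∃ n : ℤ, s = r.tailParam + n :=
  (Λ.embedded _ _ _ _ (r.param_tailParam.trans h.symm)).2

theorem exists_eq_tipParam_add {t : ℝ} (h : Λ.param r.tgt t = r.tip) :
    ∃ n : ℤ, t = r.tipParam + n :=
  (Λ.embedded _ _ _ _ (r.param_tipParam.trans h.symm)).2

variable {r} {r' : Λ.Chord}

theorem eq_of_mem_segment (hgen : Λ.ChordGeneric) {u : E3} (h : u ∈ segment ℝ r.tail r.tip)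
    (h' : u ∈ segment ℝ r'.tail r'.tip) : r = r' := by
  by_contra hne
  exact Set.disjoint_left.1 (hgen.2 r r' hne) h h'

theorem eq_of_tail_eq (hgen : Λ.ChordGeneric) (h : r.tail = r'.tail) : r = r' :=
  eq_of_mem_segment hgen (left_mem_segment _ _ _) (h ▸ left_mem_segment _ _ _)

theorem eq_of_tip_eq (hgen : Λ.ChordGeneric) (h : r.tip = r'.tip) : r = r' :=
  eq_of_mem_segment hgen (right_mem_segment _ _ _) (h ▸ right_mem_segment _ _ _)

theorem tip_ne_tail (hgen : Λ.ChordGeneric) : r.tip ≠ r'.tail := by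
  intro h
  have h1 : r.tip ∈ segment ℝ r'.tail r'.tip := by rw [h]; exact left_mem_segment _ _ _
  have := eq_of_mem_segment hgen (right_mem_segment _ _ _) h1
  subst this
  exact r.height_lt.ne (by rw [h])

end Chord

end LegendrianLink

namespace StandardNeighborhood

variable {ι : Type*} {Λ : LegendrianLink ι} (N : StandardNeighborhood Λ)

theorem lift_map (i : ι) {z p q T : ℝ} (hz : |z| < N.radius) (hz' : |z + T| < N.radius)
    (hp : |p| < N.radius) : lift T (N.map i (z, p, q)) = N.map i (z + T, p, q) := by
  rw [N.map_vertical i hz hz' hp, add_sub_cancel_left]; rfl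

/-- Near the ends of a chord, vertical translation is a quarter turn in the coordinates. -/
theorem exists_transit (r : Λ.Chord) : ∃ η > 0, ∃ e : ℝ, (e = 1 ∨ e = -1) ∧
    ∀ z p y z' p' q' T : ℝ, |z| < η → |p| < η → |y| < η → |z'| < η → |p'| < η → |q'| < η →
      (lift T (N.map r.src (z, p, r.tailParam + y)) = N.map r.tgt (z', p', r.tipParam + q') ↔
        p' = -(e * y) ∧ q' = e * p ∧ z' = z + T - r.height + p * y) := by
  obtain ⟨η₁, h₁, σ, hσ, H⟩ := N.under_crossing r _ r.param_tailParam
  obtain ⟨η₂, h₂, σ', hσ', H'⟩ := N.over_crossing r _ r.param_tipParam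
  refine ⟨min η₁ η₂, lt_min h₁ h₂, σ * σ', ?_, ?_⟩
  · rcases hσ with rfl | rfl <;> rcases hσ' with rfl | rfl <;> norm_num
  · intro z p y z' p' q' T hz hp hy hz' hp' hq'
    simp only [lt_min_iff] at hz hp hy hz' hp' hq'
    rw [H z p y hz.1 hp.1 hy.1, H' z' p' q' hz'.2 hp'.2 hq'.2,
      lift_underModel_eq_overModel r.same_x r.same_y]
    have e1 : σ * σ = 1 := by rcases hσ with rfl | rfl <;> norm_num
    have e2 : σ' * σ' = 1 := by rcases hσ' with rfl | rfl <;> norm_num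
    simp only [LegendrianLink.Chord.height]
    refine and_congr ⟨fun h => ?_, fun h => ?_⟩ (and_congr ⟨fun h => ?_, fun h => ?_⟩
      ⟨fun h => ?_, fun h => ?_⟩)
    · linear_combination σ' * h - p' * e2
    · linear_combination σ' * h - σ * y * e2
    · linear_combination σ' * h - q' * e2
    · linear_combination σ' * h + σ * p * e2
    · linear_combination h + p * y * e1
    · linear_combination h - p * y * e1

/-- The size of the region in which the normal form near the chord `r` holds. -/
def scale (r : Λ.Chord) : ℝ := (N.exists_transit r).choose

theorem scale_pos (r : Λ.Chord) : 0 < N.scale r := (N.exists_transit r).choose_spec.1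

/-- The sign with which coordinates at the tail and at the tip of a chord are related. -/
def sign (r : Λ.Chord) : ℝ := (N.exists_transit r).choose_spec.2.choose

theorem sign_eq (r : Λ.Chord) : N.sign r = 1 ∨ N.sign r = -1 :=
  (N.exists_transit r).choose_spec.2.choose_spec.1

theorem sign_mul_self (r : Λ.Chord) : N.sign r * N.sign r = 1 := by
  rcases N.sign_eq r with h | h <;> rw [h] <;> norm_num

theorem abs_sign_mul (r : Λ.Chord) (x : ℝ) : |N.sign r * x| = |x| := by
  rcases N.sign_eq r with h | h <;> rw [h] <;> simp

theorem transit_iff (r : Λ.Chord) {z p y z' p' q' T : ℝ} (hz : |z| < N.scale r)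
    (hp : |p| < N.scale r) (hy : |y| < N.scale r) (hz' : |z'| < N.scale r)
    (hp' : |p'| < N.scale r) (hq' : |q'| < N.scale r) :
    lift T (N.map r.src (z, p, r.tailParam + y)) = N.map r.tgt (z', p', r.tipParam + q') ↔
      p' = -(N.sign r * y) ∧ q' = N.sign r * p ∧ z' = z + T - r.height + p * y :=
  (N.exists_transit r).choose_spec.2.choose_spec.2 z p y z' p' q' T hz hp hy hz' hp' hq'

theorem radius_le_height (r : Λ.Chord) : N.radius ≤ r.height := by
  by_contra! h
  have h0 : |(0 : ℝ)| < N.radius := by simpa using N.radius_pos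
  have hh : |0 + r.height| < N.radius := by rwa [zero_add, abs_of_pos r.height_pos]
  have h1 := N.lift_map r.src h0 hh h0 (q := r.tailParam)
  rw [N.core, r.param_tailParam, r.lift_tail, ← r.param_tipParam, ← N.core] at h1
  have h2 := (N.injective _ _ (0, 0, r.tipParam) ⟨h0, h0⟩ (0 + r.height, 0, r.tailParam)
    ⟨hh, h0⟩ h1).2.1
  simp at h2
  exact r.height_pos.ne' h2

theorem continuousAt_map (i : ι) {u : E3} (hu : u ∈ openBox N.radius) :
    ContinuousAt (N.map i) u := (N.contDiffAt i hu).continuousAt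

theorem mem_openBox_core (q : ℝ) : ((0, 0, q) : E3) ∈ openBox N.radius := by
  simp [openBox, N.radius_pos]

/-- Vertical segments between the strands of a thin neighbourhood of a link are either contained in
one strand or close to a chord. -/
theorem exists_transit_bound [Finite ι] : ∃ ε₁ > 0, ∀ (i j : ι) (z p q z' p' q' T : ℝ),
    |z| < ε₁ → |p| < ε₁ → |z'| < ε₁ → |p'| < ε₁ → 0 < T →
    lift T (N.map i (z, p, q)) = N.map j (z', p', q') →
    (i = j ∧ z' = z + T) ∨ ∃ (r : Λ.Chord) (n m : ℤ) (y : ℝ), r.src = i ∧ r.tgt = j ∧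
      q = r.tailParam + y + n ∧ p' = -(N.sign r * y) ∧ q' = r.tipParam + N.sign r * p + m ∧
      z' = z + T - r.height + p * y := by
  have hR := N.radius_pos
  have key : ∀ i j : ι, ∀ᶠ w : (ℝ × ℝ) × (ℝ × ℝ) in 𝓝 0, ∀ y ∈ Icc (0 : ℝ) 1 ×ˢ Icc (0 : ℝ) 1,
      ∀ T, N.radius / 2 ≤ T →
        lift T (N.map i (w.1.1, w.1.2, y.1)) = N.map j (w.2.1, w.2.2, y.2) →
        ∃ (r : Λ.Chord) (n m : ℤ) (y' : ℝ), r.src = i ∧ r.tgt = j ∧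
          y.1 = r.tailParam + y' + n ∧ w.2.2 = -(N.sign r * y') ∧
          y.2 = r.tipParam + N.sign r * w.1.2 + m ∧
          w.2.1 = w.1.1 + T - r.height + w.1.2 * y' := by
    intro i j
    refine IsCompact.eventually_forall_of_forall_eventually
      (isCompact_Icc.prod isCompact_Icc) fun y _ => ?_
    obtain ⟨s, t⟩ := y
    by_cases hch : ∃ r : Λ.Chord, r.src = i ∧ r.tgt = j ∧ Λ.param i s = r.tail ∧
        Λ.param j t = r.tip
    · obtain ⟨r, rfl, rfl, hs, ht⟩ := hch
      obtain ⟨n, rfl⟩ := r.exists_eq_tailParam_add hs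
      obtain ⟨m, rfl⟩ := r.exists_eq_tipParam_add ht
      have hsc := N.scale_pos r
      have hball : ∀ (F : ((ℝ × ℝ) × (ℝ × ℝ)) × (ℝ × ℝ) → ℝ) (δ : ℝ), 0 < δ → Continuous F →
          F (0, (r.tailParam + n, r.tipParam + m)) = 0 →
          ∀ᶠ z in 𝓝 (0, (r.tailParam + n, r.tipParam + m)), |F z| < δ := by
        intro F δ hδ hF h0
        have := (hF.abs.continuousAt (x := (0, (r.tailParam + n, r.tipParam + m)))).eventually
          (gt_mem_nhds (by change |F _| < δ; rw [h0, abs_zero]; exact hδ))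
        exact this
      filter_upwards [hball (fun z => z.1.1.1) _ hsc (by fun_prop) rfl,
        hball (fun z => z.1.1.2) _ hsc (by fun_prop) rfl,
        hball (fun z => z.1.2.1) _ hsc (by fun_prop) rfl,
        hball (fun z => z.1.2.2) _ hsc (by fun_prop) rfl,
        hball (fun z => z.1.1.1) _ hR (by fun_prop) rfl,
        hball (fun z => z.1.1.2) _ hR (by fun_prop) rfl,
        hball (fun z => z.1.2.1) _ hR (by fun_prop) rfl,
        hball (fun z => z.1.2.2) _ hR (by fun_prop) rfl,
        hball (fun z => z.2.1 - n - r.tailParam) _ hsc (by fun_prop) (by simp),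
        hball (fun z => z.2.2 - m - r.tipParam) _ hsc (by fun_prop) (by simp)]
        with z h1 h2 h3 h4 h5 h6 h7 h8 h9 h10 T hT heq
      have e1 := N.map_add_int r.src h5 h6 (r.tailParam + (z.2.1 - n - r.tailParam)) n
      have e2 := N.map_add_int r.tgt h7 h8 (r.tipParam + (z.2.2 - m - r.tipParam)) m
      rw [show r.tailParam + (z.2.1 - n - r.tailParam) + n = z.2.1 by ring] at e1
      rw [show r.tipParam + (z.2.2 - m - r.tipParam) + m = z.2.2 by ring] at e2
      rw [e1, e2, N.transit_iff r h1 h2 h9 h3 h4 h10] at heq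
      exact ⟨r, n, m, _, rfl, rfl, by ring, heq.1, by linarith [heq.2.1], heq.2.2⟩
    · have c1 : ContinuousAt (fun z : ((ℝ × ℝ) × (ℝ × ℝ)) × (ℝ × ℝ) =>
          N.map i (z.1.1.1, z.1.1.2, z.2.1)) (0, (s, t)) :=
        ContinuousAt.comp (f := fun z : ((ℝ × ℝ) × (ℝ × ℝ)) × (ℝ × ℝ) =>
          ((z.1.1.1, z.1.1.2, z.2.1) : E3)) (x := (0, (s, t)))
          (N.continuousAt_map i (N.mem_openBox_core s)) (by fun_prop)
      have c2 : ContinuousAt (fun z : ((ℝ × ℝ) × (ℝ × ℝ)) × (ℝ × ℝ) =>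
          N.map j (z.1.2.1, z.1.2.2, z.2.2)) (0, (s, t)) :=
        ContinuousAt.comp (f := fun z : ((ℝ × ℝ) × (ℝ × ℝ)) × (ℝ × ℝ) =>
          ((z.1.2.1, z.1.2.2, z.2.2) : E3)) (x := (0, (s, t)))
          (N.continuousAt_map j (N.mem_openBox_core t)) (by fun_prop)
      have hcl : IsClosed {u : E3 | u.1 = 0 ∧ u.2.1 = 0 ∧ N.radius / 2 ≤ u.2.2} := by
        have k1 : IsClosed {u : E3 | u.1 = 0} := isClosed_eq (by fun_prop) continuous_const
        have k2 : IsClosed {u : E3 | u.2.1 = 0} := isClosed_eq (by fun_prop) continuous_const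
        have k3 : IsClosed {u : E3 | N.radius / 2 ≤ u.2.2} :=
          isClosed_le continuous_const (by fun_prop)
        exact k1.inter (k2.inter k3)
      have hout : Λ.param j t - Λ.param i s ∉
          {u : E3 | u.1 = 0 ∧ u.2.1 = 0 ∧ N.radius / 2 ≤ u.2.2} := by
        rintro ⟨h1, h2, h3⟩
        simp only [Prod.fst_sub, Prod.snd_sub] at h1 h2 h3
        exact hch ⟨⟨i, j, Λ.param i s, Λ.param j t, mem_range_self s, mem_range_self t,
          by linarith, by linarith, by linarith⟩, rfl, rfl, rfl, rfl⟩
      have hsub : ContinuousAt (fun z : ((ℝ × ℝ) × (ℝ × ℝ)) × (ℝ × ℝ) =>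
          N.map j (z.1.2.1, z.1.2.2, z.2.2) - N.map i (z.1.1.1, z.1.1.2, z.2.1)) (0, (s, t)) :=
        c2.sub c1
      rw [← N.core i s, ← N.core j t] at hout
      filter_upwards [hsub.eventually (hcl.isOpen_compl.mem_nhds hout)] with z hz T hT heq
      refine absurd ?_ hz
      rw [← heq]
      simpa [lift] using hT
  have key' := eventually_all.2 fun i => eventually_all.2 (key i)
  obtain ⟨ε, hε, hball⟩ := Metric.eventually_nhds_iff_ball.1 key'
  refine ⟨min ε (N.radius / 2), lt_min hε (by linarith), ?_⟩
  intro i j z p q z' p' q' T hz hp hz' hp' hT heq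
  simp only [lt_min_iff] at hz hp hz' hp'
  have hzR : |z| < N.radius := by linarith
  have hpR : |p| < N.radius := by linarith
  have hzR' : |z'| < N.radius := by linarith
  have hpR' : |p'| < N.radius := by linarith
  rcases lt_or_ge T (N.radius / 2) with hlt | hge
  · left
    have hzT : |z + T| < N.radius := by
      have := abs_lt.1 hz.2
      rw [abs_lt]
      constructor <;> linarith
    rw [N.lift_map i hzR hzT hpR] at heq
    obtain ⟨h1, h2, -, -⟩ := N.injective i j (z + T, p, q) ⟨hzT, hpR⟩ (z', p', q')
      ⟨hzR', hpR'⟩ heq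
    exact ⟨h1, h2⟩
  · right
    have hmem : (((z, p), (z', p')) : (ℝ × ℝ) × (ℝ × ℝ)) ∈ Metric.ball 0 ε := by
      simp [Prod.norm_def, hz.1, hp.1, hz'.1, hp'.1]
    have e1 := N.map_add_int i hzR hpR (Int.fract q) ⌊q⌋
    have e2 := N.map_add_int j hzR' hpR' (Int.fract q') ⌊q'⌋
    have hfm : ∀ q : ℝ, Int.fract q ∈ Icc (0 : ℝ) 1 := fun q =>
      ⟨Int.fract_nonneg q, (Int.fract_lt_one q).le⟩
    rw [Int.fract_add_floor] at e1 e2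
    rw [e1, e2] at heq
    obtain ⟨r, n, m, y, h1, h2, h3, h4, h5, h6⟩ :=
      hball _ hmem i j (Int.fract q, Int.fract q') ⟨hfm _, hfm _⟩ T hge heq
    refine ⟨r, n + ⌊q⌋, m + ⌊q'⌋, y, h1, h2, ?_, h4, ?_, h6⟩
    · have := Int.fract_add_floor q
      push_cast
      simp only at h3
      linarith
    · have := Int.fract_add_floor q'
      push_cast
      simp only at h5
      linarith

end StandardNeighborhood

namespace LegendrianLink

variable {ι : Type*} (Λ : LegendrianLink ι)

theorem param_fract (i : ι) (s : ℝ) : Λ.param i (Int.fract s) = Λ.param i s := by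
  rw [← Λ.param_add_int i (Int.fract s) ⌊s⌋, Int.fract_add_floor]

/-- The pairs of parameters in `[0, 1]` of the ends of chords from `Λ_i` to `Λ_j`. -/
def chordParams (i j : ι) : Set (ℝ × ℝ) :=
  {y | ∃ r : Λ.Chord, r.src = i ∧ r.tgt = j ∧ Λ.param i y.1 = r.tail ∧ Λ.param j y.2 = r.tip}

end LegendrianLink

namespace StandardNeighborhood

variable {ι : Type*} {Λ : LegendrianLink ι} (N : StandardNeighborhood Λ)
include N

theorem exists_nhds_chordParams (i j : ι) (x : ℝ × ℝ) :
    ∃ V ∈ 𝓝 x, (V ∩ Λ.chordParams i j).Finite := by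
  by_cases hx : x ∈ Λ.chordParams i j
  · obtain ⟨r, rfl, rfl, hs, ht⟩ := hx
    obtain ⟨n, hn⟩ := r.exists_eq_tailParam_add hs
    obtain ⟨m, hm⟩ := r.exists_eq_tipParam_add ht
    refine ⟨Metric.ball x (N.scale r), Metric.ball_mem_nhds _ (N.scale_pos r),
      (Set.finite_singleton x).subset ?_⟩
    rintro y ⟨hy, r', hsrc, htgt, hs', ht'⟩
    rw [Metric.mem_ball, Prod.dist_eq, max_lt_iff, Real.dist_eq, Real.dist_eq] at hy
    have h0 : |(0 : ℝ)| < N.scale r := by simpa using N.scale_pos r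
    have e1 := Λ.param_add_int r.src (r.tailParam + (y.1 - x.1)) n
    have e2 := Λ.param_add_int r.tgt (r.tipParam + (y.2 - x.2)) m
    rw [show r.tailParam + (y.1 - x.1) + n = y.1 by rw [hn]; ring, hs', ← N.core] at e1
    rw [show r.tipParam + (y.2 - x.2) + m = y.2 by rw [hm]; ring, ht', ← N.core] at e2
    have e3 := r'.lift_tail
    rw [e1, e2, N.transit_iff r h0 h0 hy.1 h0 h0 hy.2] at e3
    obtain ⟨e4, e5, -⟩ := e3
    have e6 : |N.sign r * (y.1 - x.1)| = 0 := by rw [abs_eq_zero]; linarith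
    rw [N.abs_sign_mul, abs_eq_zero] at e6
    rw [mul_zero] at e5
    exact Prod.ext (by linarith) (by linarith)
  · have hcl : IsClosed {u : E3 | u.1 = 0 ∧ u.2.1 = 0 ∧ N.radius ≤ u.2.2} := by
      have k1 : IsClosed {u : E3 | u.1 = 0} := isClosed_eq (by fun_prop) continuous_const
      have k2 : IsClosed {u : E3 | u.2.1 = 0} := isClosed_eq (by fun_prop) continuous_const
      have k3 : IsClosed {u : E3 | N.radius ≤ u.2.2} := isClosed_le continuous_const (by fun_prop)
      exact k1.inter (k2.inter k3)
    have hout : Λ.param j x.2 - Λ.param i x.1 ∉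
        {u : E3 | u.1 = 0 ∧ u.2.1 = 0 ∧ N.radius ≤ u.2.2} := by
      rintro ⟨h1, h2, h3⟩
      simp only [Prod.fst_sub, Prod.snd_sub] at h1 h2 h3
      exact hx ⟨⟨i, j, Λ.param i x.1, Λ.param j x.2, mem_range_self _, mem_range_self _,
        by linarith, by linarith, by linarith [N.radius_pos]⟩, rfl, rfl, rfl, rfl⟩
    have hc : Continuous fun x : ℝ × ℝ => Λ.param j x.2 - Λ.param i x.1 := by
      have h1 := (Λ.smooth i).continuous
      have h2 := (Λ.smooth j).continuous
      fun_prop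
    refine ⟨_, hc.continuousAt.eventually (hcl.isOpen_compl.mem_nhds hout), ?_⟩
    convert Set.finite_empty
    rw [Set.eq_empty_iff_forall_notMem]
    rintro y ⟨hy, r, rfl, rfl, h1, h2⟩
    refine hy ?_
    rw [h1, h2]
    exact ⟨sub_eq_zero.2 r.same_x, sub_eq_zero.2 r.same_y, N.radius_le_height r⟩

theorem finite_chord [Finite ι] (hgen : Λ.ChordGeneric) : Finite Λ.Chord := by
  have hfin : ∀ i j, (Icc (0 : ℝ) 1 ×ˢ Icc (0 : ℝ) 1 ∩ Λ.chordParams i j).Finite := by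
    intro i j
    refine (isCompact_Icc.prod isCompact_Icc).induction_on
      (p := fun s => (s ∩ Λ.chordParams i j).Finite) (by simp) ?_ ?_ ?_
    · exact fun s t hst ht => ht.subset (inter_subset_inter_left _ hst)
    · intro s t hs ht
      rw [union_inter_distrib_right]
      exact hs.union ht
    · intro x _
      obtain ⟨V, hV, hf⟩ := N.exists_nhds_chordParams i j x
      exact ⟨V, mem_nhdsWithin_of_mem_nhds hV, hf⟩
  have : ∀ i j, Finite ↥(Icc (0 : ℝ) 1 ×ˢ Icc (0 : ℝ) 1 ∩ Λ.chordParams i j) := fun i j =>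
    (hfin i j).to_subtype
  let F : Λ.Chord → Σ ij : ι × ι,
      ↥(Icc (0 : ℝ) 1 ×ˢ Icc (0 : ℝ) 1 ∩ Λ.chordParams ij.1 ij.2) := fun r =>
    ⟨(r.src, r.tgt), (Int.fract r.tailParam, Int.fract r.tipParam),
      ⟨⟨Int.fract_nonneg _, (Int.fract_lt_one _).le⟩, ⟨Int.fract_nonneg _,
        (Int.fract_lt_one _).le⟩⟩, r, rfl, rfl,
      by rw [Λ.param_fract, r.param_tailParam], by rw [Λ.param_fract, r.param_tipParam]⟩
  refine Finite.of_injective F fun r r' h => ?_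
  have h1 : r.src = r'.src := congrArg (fun x => x.1.1) h
  have h2 : Int.fract r.tailParam = Int.fract r'.tailParam := congrArg (fun x => x.2.1.1) h
  refine LegendrianLink.Chord.eq_of_tail_eq hgen ?_
  rw [← r.param_tailParam, ← r'.param_tailParam, ← Λ.param_fract, h2, Λ.param_fract, h1]

end StandardNeighborhood

theorem exists_pos_le_abs_add_int (x : ℝ) (hx : ∀ n : ℤ, x + n ≠ 0) :
    ∃ d > 0, ∀ n : ℤ, d ≤ |x + n| := by
  refine ⟨|x - round x|, abs_pos.2 ?_, fun n => ?_⟩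
  · have := hx (-round x)
    push_cast at this
    rwa [sub_eq_add_neg]
  · have := round_le x (-n)
    push_cast at this
    rwa [sub_neg_eq_add] at this

theorem exists_pos_forall_of_finite {α : Type*} [Finite α] {P : α → ℝ → Prop}
    (hP : ∀ a, ∃ d > 0, P a d) (hmono : ∀ a d d', d' ≤ d → P a d → P a d') :
    ∃ d > 0, ∀ a, P a d := by
  have h : ∀ᶠ d in 𝓝[>] (0 : ℝ), ∀ a, P a d := by
    rw [eventually_all]
    intro a
    obtain ⟨d, hd, h⟩ := hP a
    filter_upwards [Ioo_mem_nhdsGT hd] with d' hd' using hmono a d d' hd'.2.le h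
  obtain ⟨d, h1, h2⟩ := (h.and self_mem_nhdsWithin).exists
  exact ⟨d, h2, h1⟩

namespace StandardNeighborhood

variable {ι : Type*} {Λ : LegendrianLink ι} (N : StandardNeighborhood Λ)

/-- The size `ε` is small for the geometry of the link and of the standard neighbourhood. -/
structure IsFine (ε : ℝ) : Prop where
  pos : 0 < ε
  lt_quarter : ε < 1 / 4
  lt_radius : 4 * ε < N.radius
  lt_scale : ∀ r, ε < N.scale r
  transit : ∀ (i j : ι) (z p q z' p' q' T : ℝ),
    |z| ≤ ε → |p| ≤ ε → |z'| ≤ ε → |p'| ≤ ε → 0 < T →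
    lift T (N.map i (z, p, q)) = N.map j (z', p', q') →
    (i = j ∧ z' = z + T) ∨ ∃ (r : Λ.Chord) (n m : ℤ) (y : ℝ), r.src = i ∧ r.tgt = j ∧
      q = r.tailParam + y + n ∧ p' = -(N.sign r * y) ∧ q' = r.tipParam + N.sign r * p + m ∧
      z' = z + T - r.height + p * y
  tail_sep : ∀ (r r' : Λ.Chord) (n : ℤ), r.src = r'.src →
    |r'.tailParam - r.tailParam + n| ≤ 2 * ε → r = r'
  tip_sep : ∀ (r r' : Λ.Chord) (n : ℤ), r.tgt = r'.tgt →
    |r'.tipParam - r.tipParam + n| ≤ 2 * ε → r = r'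
  mixed_sep : ∀ (r r' : Λ.Chord) (n : ℤ), r.tgt = r'.src →
    2 * ε < |r'.tailParam - r.tipParam + n|

theorem exists_isFine [Finite ι] (hgen : Λ.ChordGeneric) : ∃ ε₀ > 0, ε₀ ≤ N.radius ∧
    (∀ ε, 0 < ε → ε < ε₀ → N.IsFine ε) ∧ ∀ (r r' : Λ.Chord) (n : ℤ), r.tgt = r'.src →
      4 * ε₀ ≤ |r'.tailParam - r.tipParam + n| := by
  have := N.finite_chord hgen
  have hmem {i j : ι} {s t : ℝ} (n : ℤ) (hij : i = j) (h : t - s + n = 0) :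
      Λ.param i s = Λ.param j t := by
    rw [← Λ.param_add_int j t n, hij]
    congr 1; linarith
  obtain ⟨ε₁, h1, H1⟩ := N.exists_transit_bound
  obtain ⟨ε₂, h2, H2⟩ := exists_pos_forall_of_finite (P := fun (r : Λ.Chord) d => d ≤ N.scale r)
    (fun r => ⟨N.scale r, N.scale_pos r, le_rfl⟩) (fun r d d' h h' => h.trans h')
  obtain ⟨ε₃, h3, H3⟩ := exists_pos_forall_of_finite
    (P := fun (x : Λ.Chord × Λ.Chord) d => x.1.src = x.2.src → x.1 ≠ x.2 →
      ∀ n : ℤ, d ≤ |x.2.tailParam - x.1.tailParam + n|)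
    (fun x => by
      by_cases hx : x.1.src = x.2.src ∧ x.1 ≠ x.2
      · obtain ⟨d, hd, hd'⟩ := exists_pos_le_abs_add_int (x.2.tailParam - x.1.tailParam)
          fun n hn => hx.2 (LegendrianLink.Chord.eq_of_tail_eq hgen (by
            rw [← x.1.param_tailParam, ← x.2.param_tailParam, hmem n hx.1 hn]))
        exact ⟨d, hd, fun _ _ => hd'⟩
      · exact ⟨1, one_pos, fun h h' => absurd ⟨h, h'⟩ hx⟩)
    (fun x d d' h h' a b n => h.trans (h' a b n))
  obtain ⟨ε₄, h4, H4⟩ := exists_pos_forall_of_finite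
    (P := fun (x : Λ.Chord × Λ.Chord) d => x.1.tgt = x.2.tgt → x.1 ≠ x.2 →
      ∀ n : ℤ, d ≤ |x.2.tipParam - x.1.tipParam + n|)
    (fun x => by
      by_cases hx : x.1.tgt = x.2.tgt ∧ x.1 ≠ x.2
      · obtain ⟨d, hd, hd'⟩ := exists_pos_le_abs_add_int (x.2.tipParam - x.1.tipParam)
          fun n hn => hx.2 (LegendrianLink.Chord.eq_of_tip_eq hgen (by
            rw [← x.1.param_tipParam, ← x.2.param_tipParam, hmem n hx.1 hn]))
        exact ⟨d, hd, fun _ _ => hd'⟩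
      · exact ⟨1, one_pos, fun h h' => absurd ⟨h, h'⟩ hx⟩)
    (fun x d d' h h' a b n => h.trans (h' a b n))
  obtain ⟨ε₅, h5, H5⟩ := exists_pos_forall_of_finite
    (P := fun (x : Λ.Chord × Λ.Chord) d => x.1.tgt = x.2.src →
      ∀ n : ℤ, d ≤ |x.2.tailParam - x.1.tipParam + n|)
    (fun x => by
      by_cases hx : x.1.tgt = x.2.src
      · obtain ⟨d, hd, hd'⟩ := exists_pos_le_abs_add_int (x.2.tailParam - x.1.tipParam)
          fun n hn => LegendrianLink.Chord.tip_ne_tail hgen (r := x.1) (r' := x.2) (by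
            rw [← x.1.param_tipParam, ← x.2.param_tailParam, hmem n hx hn])
        exact ⟨d, hd, fun _ => hd'⟩
      · exact ⟨1, one_pos, fun h => absurd h hx⟩)
    (fun x d d' h h' a n => h.trans (h' a n))
  let m := min (min (min ε₁ ε₂) (min ε₃ ε₄)) (min ε₅ (min N.radius 1))
  have hm : 0 < m := by
    have := N.radius_pos
    positivity
  have m1 : m ≤ ε₁ := (min_le_left _ _).trans ((min_le_left _ _).trans (min_le_left _ _))
  have m2 : m ≤ ε₂ := (min_le_left _ _).trans ((min_le_left _ _).trans (min_le_right _ _))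
  have m3 : m ≤ ε₃ := (min_le_left _ _).trans ((min_le_right _ _).trans (min_le_left _ _))
  have m4 : m ≤ ε₄ := (min_le_left _ _).trans ((min_le_right _ _).trans (min_le_right _ _))
  have m5 : m ≤ ε₅ := (min_le_right _ _).trans (min_le_left _ _)
  have m6 : m ≤ N.radius := (min_le_right _ _).trans ((min_le_right _ _).trans (min_le_left _ _))
  have m7 : m ≤ 1 := (min_le_right _ _).trans ((min_le_right _ _).trans (min_le_right _ _))
  refine ⟨m / 4, by linarith, by linarith, fun ε hε hlt => ?_, fun r r' n h => ?_⟩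
  · refine ⟨hε, by linarith, by linarith, fun r => by linarith [H2 r], ?_, ?_, ?_, ?_⟩
    · intro i j z p q z' p' q' T a b c d
      exact H1 i j z p q z' p' q' T (by linarith) (by linarith) (by linarith) (by linarith)
    · intro r r' n h h'
      by_contra hne
      have := H3 (r, r') h hne n
      simp only at this
      linarith
    · intro r r' n h h'
      by_contra hne
      have := H4 (r, r') h hne n
      simp only at this
      linarith
    · intro r r' n h
      have := H5 (r, r') h n
      simp only at this
      linarith
  · have := H5 (r, r') h n
    simp only at this
    linarith

end StandardNeighborhood

/-! ### Adapted twists -/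

theorem signType_cast_eq {c : SignType} (hc : c ≠ 0) : (c : ℝ) = 1 ∨ (c : ℝ) = -1 := by
  cases c
  · exact absurd rfl hc
  · right; rfl
  · left; rfl

theorem signType_cast_mul_self {c : SignType} (hc : c ≠ 0) : (c : ℝ) * (c : ℝ) = 1 := by
  rcases signType_cast_eq hc with h | h <;> rw [h] <;> norm_num

theorem abs_signType_cast_mul {c : SignType} (hc : c ≠ 0) (x : ℝ) : |(c : ℝ) * x| = |x| := by
  rcases signType_cast_eq hc with h | h <;> rw [h] <;> simp

/-- The fractional rotation which a handle must perform to connect the tip of `r` with the tail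
of `r'`. -/
def gap {ι : Type*} {Λ : LegendrianLink ι} (c : ι → SignType) (r r' : Λ.Chord) : ℝ :=
  Int.fract ((c r.tgt : ℝ) * (r'.tailParam - r.tipParam))

section Gap

variable {ι : Type*} {Λ : LegendrianLink ι} {c : ι → SignType} {r r' : Λ.Chord}

theorem exists_gap_eq (hc : c r.tgt ≠ 0) :
    ∃ m : ℤ, (c r.tgt : ℝ) * gap c r r' = r'.tailParam - r.tipParam + m := by
  refine ⟨-((c r.tgt : ℤ) * ⌊(c r.tgt : ℝ) * (r'.tailParam - r.tipParam)⌋), ?_⟩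
  have h := signType_cast_mul_self hc
  unfold gap Int.fract
  push_cast
  linear_combination (r'.tailParam - r.tipParam) * h

variable {N : StandardNeighborhood Λ} {ε : ℝ}

theorem gap_bounds (hN : N.IsFine ε) (hr : r.tgt = r'.src) (hc : c r.tgt ≠ 0) :
    2 * ε < gap c r r' ∧ gap c r r' < 1 - 2 * ε := by
  obtain ⟨m, hm⟩ := exists_gap_eq (r' := r') hc
  have h0 : 0 ≤ gap c r r' := Int.fract_nonneg _
  have h1 : gap c r r' < 1 := Int.fract_lt_one _
  constructor
  · have := hN.mixed_sep r r' m hr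
    rwa [← hm, abs_signType_cast_mul hc, abs_of_nonneg h0] at this
  · have := hN.mixed_sep r r' (m - (c r.tgt : ℤ)) hr
    push_cast at this
    rw [← add_sub_assoc, ← hm, ← mul_sub_one, abs_signType_cast_mul hc,
      abs_sub_comm, abs_of_nonneg (by linarith)] at this
    linarith

variable {η : ℝ} {f : ℝ → ℝ}

/-- Adapted twists are affine at the points through which orbits connecting chords pass. -/
theorem IsAdaptedTwist.affine_of_passing (hf : IsAdaptedTwist Λ c ε η f) (hε : 0 < ε)
    (hr : r.tgt = r'.src) (hc : c r.tgt ≠ 0) {p x y : ℝ} (hp : |p| ≤ ε) (hx : |x| ≤ ε)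
    (hy : |y| ≤ ε)
    (h : y = x + (c r.tgt : ℝ) * scaledTwist f ε p - (c r.tgt : ℝ) * gap c r r') :
    |p| < ε / 2 ∧ scaledTwist f ε p = p / ε + 1 / 2 ∧ deriv f (p / ε) = 1 := by
  obtain ⟨δ, h0, h1, h2, h3⟩ := hf.affine
  obtain ⟨m, hm⟩ := exists_gap_eq (r' := r') hc
  have ht : Λ.param r.tgt (r.tipParam + (-m : ℤ)) = r.tip := by
    rw [Λ.param_add_int, r.param_tipParam]
  have h4 := h3 r r' hr hc (r.tipParam + (-m : ℤ)) r'.tailParam ht r'.param_tailParam p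
    (r.tipParam + (-m : ℤ) + x) hp (by simpa using hx) (by
      rw [hm] at h
      convert hy using 2
      push_cast
      linarith)
  have h5 : |p / ε| ≤ 1 / 2 - δ := by
    rw [abs_div, abs_of_pos hε, div_le_iff₀ hε]
    linarith
  refine ⟨?_, hf.eq_of_deriv_eq_one h2 h5, h2 _ h5⟩
  have := mul_pos hε h0
  linarith

theorem exists_isAdaptedTwist {ε₀ : ℝ} (hε : 0 < ε) (hlt : ε < ε₀)
    (hsep : ∀ (r r' : Λ.Chord) (n : ℤ), r.tgt = r'.src →
      4 * ε₀ ≤ |r'.tailParam - r.tipParam + n|) :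
    ∃ (η : ℝ) (f : ℝ → ℝ), IsAdaptedTwist Λ c ε η f := by
  have hδ : 0 < min (1 / 4) ε₀ := lt_min (by norm_num) (hε.trans hlt)
  have hδ' : min (1 / 4) ε₀ < 1 / 2 := (min_le_left _ _).trans_lt (by norm_num)
  have hδ'' : min (1 / 4) ε₀ ≤ ε₀ := min_le_right _ _
  generalize min (1 / 4) ε₀ = δ at hδ hδ' hδ''
  obtain ⟨η, f, hf, hd⟩ := exists_isTwist hδ hδ'
  refine ⟨η, f, hf, δ, hδ, hδ', hd, ?_⟩
  intro r r' hr hc t s ht hs p q hp hq hqs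
  obtain ⟨n, rfl⟩ := r.exists_eq_tipParam_add ht
  obtain ⟨m, rfl⟩ := r'.exists_eq_tailParam_add hs
  have k1 := hsep r r' (m - n) hr
  have k2 := hsep r r' (m - n - (c r.tgt : ℤ)) hr
  push_cast at k1 k2
  have hF0 := hf.scaledTwist_nonneg (ε := ε) p
  have hF1 := hf.scaledTwist_le_one (ε := ε) p
  set F := scaledTwist f ε p with hF
  have e1 : |(c r.tgt : ℝ) * F - (r'.tailParam - r.tipParam + (m - n))| ≤ 2 * ε := by
    rw [abs_le] at *
    constructor <;> linarith [hq.1, hq.2, hqs.1, hqs.2]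
  have e2 : 2 * ε₀ < F := by
    have := abs_sub_abs_le_abs_sub (r'.tailParam - r.tipParam + (m - n) : ℝ) ((c r.tgt : ℝ) * F)
    rw [abs_sub_comm, abs_signType_cast_mul hc, abs_of_nonneg hF0] at this
    linarith
  have e3 : 2 * ε₀ < 1 - F := by
    have := abs_sub_abs_le_abs_sub (r'.tailParam - r.tipParam + (m - n - (c r.tgt : ℝ)))
      ((c r.tgt : ℝ) * (F - 1))
    rw [abs_signType_cast_mul hc, abs_sub_comm F, abs_of_nonneg (sub_nonneg.2 hF1),
      abs_sub_comm, show (c r.tgt : ℝ) * (F - 1) - (r'.tailParam - r.tipParam +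
        (m - n - (c r.tgt : ℝ))) = (c r.tgt : ℝ) * F - (r'.tailParam - r.tipParam + (m - n))
        by ring] at this
    linarith
  have hend : ∀ p, |p| ≤ 1 / 2 - δ → f p = p + 1 / 2 := fun p hp => hf.eq_of_deriv_eq_one hd hp
  have a1 := hend (1 / 2 - δ) (by rw [abs_of_pos]; linarith)
  have a2 := hend (-(1 / 2 - δ)) (by rw [abs_neg, abs_of_pos]; linarith)
  have b1 : p / ε ≤ 1 / 2 - δ := by
    by_contra! hlt
    have := hf.monotone hlt.le
    rw [a1] at this
    have : 1 / 2 - δ + 1 / 2 ≤ F := this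
    linarith
  have b2 : -(1 / 2 - δ) ≤ p / ε := by
    by_contra! hlt
    have := hf.monotone hlt.le
    rw [a2] at this
    have : F ≤ -(1 / 2 - δ) + 1 / 2 := this
    linarith
  rw [div_le_iff₀ hε] at b1
  rw [le_div_iff₀ hε] at b2
  rw [abs_le]
  constructor <;> linarith

end Gap

/-! ### Points of the surgered manifold -/

namespace SurgeryData

variable {ι : Type*} (S : SurgeryData ι)

/-- The hypotheses on the data under which the surgered manifold is a manifold. -/
structure IsGood : Prop where
  twist : IsTwist S.η S.f
  pos : 0 < S.ε
  lt_radius : S.ε < S.nbhd.radius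

/-- Half the height of the part of the neighbourhood which is removed. -/
def width : ℝ := (1 - S.η) * S.ε

/-- The drop in height between the two descriptions of the top of a handle. -/
def drop (i : ι) (p : ℝ) : ℝ := (S.coeff i : ℝ) * twistPrimitive S.f S.ε p

/-- The rotation performed by a handle. -/
def turn (i : ι) (p : ℝ) : ℝ := (S.coeff i : ℝ) * scaledTwist S.f S.ε p

variable {S}

namespace IsGood

variable (hS : S.IsGood)
include hS

theorem width_pos : 0 < S.width := mul_pos (sub_pos.2 hS.twist.margin_lt_one) hS.pos

theorem width_lt : S.width < S.ε := by
  have := mul_pos hS.twist.margin_pos hS.pos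
  unfold width
  linarith

theorem abs_drop_le (i : ι) (p : ℝ) : |S.drop i p| ≤ S.width := by
  have h := hS.twist.abs_twistPrimitive_le hS.pos p
  unfold drop
  by_cases hc : S.coeff i = 0
  · simpa [hc] using hS.width_pos.le
  · rwa [abs_signType_cast_mul hc]

theorem drop_eq_zero (i : ι) {p : ℝ} (hp : S.width ≤ |p|) : S.drop i p = 0 := by
  rw [drop, hS.twist.twistPrimitive_eq_zero hS.pos hp, mul_zero]

theorem exists_turn_eq (i : ι) {p : ℝ} (hp : S.width ≤ |p|) : ∃ n : ℤ, S.turn i p = n := by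
  rcases le_abs.1 hp with h | h
  · exact ⟨S.coeff i, by rw [turn, hS.twist.scaledTwist_eq_one hS.pos h]; simp⟩
  · exact ⟨0, by rw [turn, hS.twist.scaledTwist_eq_zero hS.pos (le_neg.1 h)]; simp⟩

theorem continuous_drop (i : ι) : Continuous (S.drop i) :=
  continuous_const.mul (hS.twist.continuous_twistPrimitive hS.pos)

theorem map_mem_exterior {i : ι} {z p q : ℝ} (hz : |z| < S.nbhd.radius) (hp : |p| < S.nbhd.radius)
    (h : S.width < |z| ∨ S.width < |p|) : S.nbhd.map i (z, p, q) ∈ S.pieceDomain none := by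
  rintro j - ⟨v, ⟨h1, h2⟩, h3⟩
  have hw := hS.width_lt
  have hr := hS.lt_radius
  change |v.1| ≤ S.width at h1
  change |v.2.1| ≤ S.width at h2
  obtain ⟨-, e1, e2, -⟩ := S.nbhd.injective j i v ⟨by linarith, by linarith⟩ (z, p, q) ⟨hz, hp⟩ h3
  simp only at e1 e2
  rw [e1, e2] at h
  rcases h with h | h <;> linarith

theorem param_mem_exterior {i : ι} (hi : S.coeff i = 0) (s : ℝ) :
    S.link.param i s ∈ S.pieceDomain none := by
  rintro j hj ⟨v, ⟨h1, h2⟩, h3⟩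
  have hw := hS.width_lt
  have hr := hS.lt_radius
  change |v.1| ≤ S.width at h1
  change |v.2.1| ≤ S.width at h2
  rw [← S.nbhd.core] at h3
  obtain ⟨e, -⟩ := S.nbhd.injective j i v ⟨by linarith, by linarith⟩ (0, 0, s)
    (S.nbhd.mem_openBox_core s) h3
  exact hj (e ▸ hi)

theorem handle_bounds {i : ι} {v : E3} (hv : v ∈ S.pieceDomain (some i)) :
    S.coeff i ≠ 0 ∧ |v.2.1| < S.nbhd.radius ∧ -S.ε < v.1 ∧ v.1 - S.drop i v.2.1 < S.ε := by
  obtain ⟨h1, h2, h3, h4⟩ := hv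
  have hr := hS.lt_radius
  refine ⟨h1, by linarith, h3, ?_⟩
  unfold drop
  linarith

theorem abs_lt_of_side {i : ι} {v : E3} (hv : v ∈ S.pieceDomain (some i))
    (h : v.1 < -S.width ∨ S.width < |v.2.1|) : |v.1| < S.ε := by
  obtain ⟨-, -, h3, h4⟩ := hS.handle_bounds hv
  have hw := hS.width_pos
  have hw' := hS.width_lt
  rw [abs_lt]
  refine ⟨h3, ?_⟩
  rcases h with h | h
  · linarith
  · rw [hS.drop_eq_zero i h.le] at h4
    linarith

end IsGood

/-- Coordinates near the top of a handle as coordinates of the exterior. -/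
def topMap (S : SurgeryData ι) (i : ι) (v : E3) : E3 :=
  (v.1 - S.drop i v.2.1, v.2.1, v.2.2 + S.turn i v.2.1)

open Classical in
/-- A normal form of the points of the pieces which is invariant under the gluing. -/
def normalForm (S : SurgeryData ι) : S.Pieces → E3 ⊕ (ι × ℝ × ℝ × ℝ)
  | ⟨none, u⟩ => Sum.inl u.1
  | ⟨some i, v⟩ =>
    if v.1.1 < -S.width ∨ S.width < |v.1.2.1| then Sum.inl (S.nbhd.map i v.1)
    else if S.width < v.1.1 - S.drop i v.1.2.1 then Sum.inl (S.nbhd.map i (S.topMap i v.1))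
    else Sum.inr (i, v.1.1, v.1.2.1, Int.fract v.1.2.2)

theorem IsGood.normalForm_glue (hS : S.IsGood) {a b : S.Pieces} (h : S.Glue a b) :
    S.normalForm a = S.normalForm b := by
  have hr := hS.lt_radius
  cases h with
  | period i z p q h h' =>
    have hb := hS.handle_bounds h
    simp only [normalForm]
    split_ifs with h1 h2
    · rw [S.nbhd.periodic i (z, p, q) ⟨(hS.abs_lt_of_side h h1).trans hr, hb.2.1⟩]
    · have := S.nbhd.periodic i (S.topMap i (z, p, q)) ⟨?_, hb.2.1⟩
      · rw [← this]
        simp only [topMap, add_right_comm]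
      · simp only [topMap]
        have := hS.width_pos
        simp only at hb
        rw [abs_lt]
        constructor <;> linarith
    · simp
  | bottomSide i z p q h h' hz =>
    exact if_pos hz
  | top i z p q z' q' h h' hz' hq' hz =>
    have hb := hS.handle_bounds h
    change S.width < z' at hz
    have hz'' : z' = z - S.drop i p := hz'
    have hq'' : q' = q + S.turn i p := hq'
    simp only [normalForm]
    have hw := hS.width_pos
    have hd := abs_le.1 (hS.abs_drop_le i p)
    split_ifs with h1 h2
    · have h1' : S.width < |p| := by
        rcases h1 with h1 | h1
        · linarith
        · exact h1
      have hd0 := hS.drop_eq_zero i h1'.le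
      obtain ⟨n, hn⟩ := hS.exists_turn_eq i h1'.le
      rw [hd0, sub_zero] at hz''
      subst hz''
      rw [hq'', hn, S.nbhd.map_add_int i ((hS.abs_lt_of_side h (Or.inr h1')).trans hr) hb.2.1]
    · simp only [topMap, hz'', hq'']
    · exact absurd (hz'' ▸ hz) h2

/-- The normal form of a point of the surgered manifold. -/
def IsGood.quotForm (hS : S.IsGood) : S.Manifold → E3 ⊕ (ι × ℝ × ℝ × ℝ) :=
  Quot.lift S.normalForm fun _ _ h => hS.normalForm_glue h

theorem IsGood.normalForm_eq (hS : S.IsGood) {a b : Option ι} {u v : E3}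
    {hu : u ∈ S.pieceDomain a} {hv : v ∈ S.pieceDomain b} (h : S.point a u hu = S.point b v hv) :
    S.normalForm ⟨a, u, hu⟩ = S.normalForm ⟨b, v, hv⟩ :=
  congrArg hS.quotForm h

theorem IsGood.exterior_injective (hS : S.IsGood) {u v : E3} {hu : u ∈ S.pieceDomain none}
    {hv : v ∈ S.pieceDomain none} (h : S.point none u hu = S.point none v hv) : u = v :=
  Sum.inl_injective (hS.normalForm_eq h)

theorem IsGood.handle_eq_exterior (hS : S.IsGood) {i : ι} {v u : E3}
    {hv : v ∈ S.pieceDomain (some i)} {hu : u ∈ S.pieceDomain none}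
    (h : S.point (some i) v hv = S.point none u hu) :
    ((v.1 < -S.width ∨ S.width < |v.2.1|) ∧ u = S.nbhd.map i v) ∨
    (|v.2.1| ≤ S.width ∧ S.width < v.1 - S.drop i v.2.1 ∧ u = S.nbhd.map i (S.topMap i v)) := by
  have := hS.normalForm_eq h
  simp only [normalForm] at this
  split_ifs at this with h1 h2
  · exact Or.inl ⟨h1, (Sum.inl_injective this).symm⟩
  · push Not at h1
    exact Or.inr ⟨h1.2, h2, (Sum.inl_injective this).symm⟩

theorem point_congr (S : SurgeryData ι) {a : Option ι} {u v : E3} (h : u = v)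
    (hu : u ∈ S.pieceDomain a) (hv : v ∈ S.pieceDomain a) : S.point a u hu = S.point a v hv := by
  subst h; rfl

theorem point_add_nat (i : ι) {z p q : ℝ} (n : ℕ) (h : (z, p, q) ∈ S.pieceDomain (some i))
    (h' : (z, p, q + n) ∈ S.pieceDomain (some i)) :
    S.point (some i) (z, p, q) h = S.point (some i) (z, p, q + n) h' := by
  induction n with
  | zero => simp
  | succ n ih =>
    rw [ih h]
    have h2 : ((z, p, q + n + 1) : E3) = (z, p, q + (n + 1 : ℕ)) := by push_cast; rw [add_assoc]
    exact (Quot.sound (Glue.period (S := S) i z p (q + n) h h)).trans (S.point_congr h2 h h')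

theorem point_add_int (i : ι) {z p q q' : ℝ} (n : ℤ) (hq : q' = q + n)
    (h : (z, p, q) ∈ S.pieceDomain (some i)) (h' : (z, p, q') ∈ S.pieceDomain (some i)) :
    S.point (some i) (z, p, q) h = S.point (some i) (z, p, q') h' := by
  subst hq
  obtain ⟨k, rfl | rfl⟩ := n.eq_nat_or_neg
  · exact_mod_cast point_add_nat i k h h
  · have := point_add_nat (S := S) i (q := q + ((-k : ℤ) : ℝ)) k h' (by simpa using h)
    exact (this.trans (S.point_congr (by simp) _ h)).symm

theorem IsGood.handle_injective (hS : S.IsGood) {i j : ι} {v w : E3}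
    {hv : v ∈ S.pieceDomain (some i)} {hw : w ∈ S.pieceDomain (some j)}
    (h : S.point (some i) v hv = S.point (some j) w hw) :
    i = j ∧ w.1 = v.1 ∧ w.2.1 = v.2.1 ∧ ∃ n : ℤ, w.2.2 = v.2.2 + n := by
  have hr := hS.lt_radius
  have hm := hS.width_pos
  have hbv := hS.handle_bounds hv
  have hbw := hS.handle_bounds hw
  have htop : ∀ {k : ι} {x : E3}, x ∈ S.pieceDomain (some k) → S.width < x.1 - S.drop k x.2.1 →
      S.topMap k x ∈ openBox S.nbhd.radius := by
    intro k x hx hlt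
    have hb := hS.handle_bounds hx
    refine ⟨?_, hb.2.1⟩
    simp only [topMap]
    rw [abs_lt]
    constructor <;> linarith
  have hmix : ∀ {k l : ι} {x y : E3} (hx : x ∈ S.pieceDomain (some k))
      (hy : y ∈ S.pieceDomain (some l)), (x.1 < -S.width ∨ S.width < |x.2.1|) →
      S.width < y.1 - S.drop l y.2.1 → S.nbhd.map k x = S.nbhd.map l (S.topMap l y) →
      k = l ∧ y.1 = x.1 ∧ y.2.1 = x.2.1 ∧ ∃ n : ℤ, y.2.2 = x.2.2 + n := by
    intro k l x y hx hy h1 h2 h3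
    have hb := hS.handle_bounds hx
    obtain ⟨rfl, e1, e2, n, e3⟩ := S.nbhd.injective _ _ x
      ⟨(hS.abs_lt_of_side hx h1).trans hr, hb.2.1⟩ _ (htop hy h2) h3
    simp only [topMap] at e1 e2 e3
    have h1' : S.width < |x.2.1| := by
      rcases h1 with h1 | h1
      · linarith
      · exact h1
    rw [e2] at e1 e3
    rw [hS.drop_eq_zero k h1'.le] at e1
    obtain ⟨m, hm⟩ := hS.exists_turn_eq k h1'.le
    rw [hm] at e3
    exact ⟨rfl, by linarith, e2, n - m, by push_cast; linarith⟩
  have key := hS.normalForm_eq h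
  simp only [normalForm] at key
  split_ifs at key with h1 h2 h3 h4 h5 h6 h7
  · exact S.nbhd.injective _ _ v ⟨(hS.abs_lt_of_side hv h1).trans hr, hbv.2.1⟩ w
      ⟨(hS.abs_lt_of_side hw h2).trans hr, hbw.2.1⟩ (Sum.inl_injective key)
  · exact hmix hv hw h1 h3 (Sum.inl_injective key)
  · obtain ⟨rfl, e1, e2, n, e3⟩ := hmix hw hv h5 h4 (Sum.inl_injective key).symm
    exact ⟨rfl, e1.symm, e2.symm, -n, by push_cast; linarith⟩
  · obtain ⟨rfl, e1, e2, n, e3⟩ := S.nbhd.injective _ _ _ (htop hv h4) _ (htop hw h6)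
      (Sum.inl_injective key)
    simp only [topMap] at e1 e2 e3
    rw [e2] at e1 e3
    exact ⟨rfl, by linarith, e2, n, by linarith⟩
  · have key := Sum.inr_injective key
    simp only [Prod.mk.injEq] at key
    obtain ⟨rfl, e1, e2, e3⟩ := key
    obtain ⟨n, hn⟩ := Int.fract_eq_fract.1 e3
    exact ⟨rfl, e1.symm, e2.symm, -n, by push_cast; linarith⟩

theorem IsGood.isOpen_pieceDomain [Finite ι] (hS : S.IsGood) (a : Option ι) :
    IsOpen (S.pieceDomain a) := by
  have hw := hS.width_lt
  have hr := hS.lt_radius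
  cases a with
  | none =>
    have hK : ∀ i, IsClosed (S.nbhd.map i '' {v | |v.1| ≤ S.width ∧ |v.2.1| ≤ S.width}) := by
      intro i
      convert S.nbhd.isClosed_image i
        (K := Icc (-S.width) S.width ×ˢ Icc (-S.width) S.width) (isCompact_Icc.prod isCompact_Icc)
        (fun x hx => ⟨(abs_le.2 hx.1).trans_lt (by linarith),
          (abs_le.2 hx.2).trans_lt (by linarith)⟩) using 2
      ext v
      simp only [abs_le, mem_ofPred_eq, mem_prod, mem_Icc]
    have : S.pieceDomain none = ⋂ i, {u | S.coeff i ≠ 0 →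
        u ∉ S.nbhd.map i '' {v | |v.1| ≤ S.width ∧ |v.2.1| ≤ S.width}} := by
      ext u
      simp only [mem_iInter]
      rfl
    rw [this]
    refine isOpen_iInter_of_finite fun i => ?_
    by_cases hi : S.coeff i = 0
    · simp [hi]
    · convert (hK i).isOpen_compl using 1
      exact Set.ext fun u => ⟨fun h => h hi, fun h _ => h⟩
  | some i =>
    have hd := hS.continuous_drop i
    have : S.pieceDomain (some i) = {v | S.coeff i ≠ 0} ∩ ({v | |v.2.1| < S.ε} ∩
        ({v | -S.ε < v.1} ∩ {v | v.1 < S.ε + S.drop i v.2.1})) := rfl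
    rw [this]
    have k1 : IsOpen {v : E3 | |v.2.1| < S.ε} := isOpen_lt (by fun_prop) continuous_const
    have k2 : IsOpen {v : E3 | -S.ε < v.1} := isOpen_lt continuous_const (by fun_prop)
    have k3 : IsOpen {v : E3 | v.1 < S.ε + S.drop i v.2.1} := isOpen_lt (by fun_prop) (by fun_prop)
    exact isOpen_const.inter (k1.inter (k2.inter k3))

end SurgeryData

namespace SurgeryData

variable {ι : Type*} {S : SurgeryData ι}

/-! ### The Reeb flow -/

/-- Translation along the Reeb vector field in the coordinates of a piece. -/
def slide : Option ι → ℝ → E3 → E3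
  | none, τ, u => lift τ u
  | some _, τ, u => (u.1 + τ, u.2.1, u.2.2)

theorem slide_zero (a : Option ι) (u : E3) : slide a 0 u = u := by
  cases a <;> simp [slide, lift]

theorem slide_slide (a : Option ι) (σ τ : ℝ) (u : E3) :
    slide a σ (slide a τ u) = slide a (τ + σ) u := by
  cases a <;> simp [slide, lift, add_assoc]

theorem continuous_slide (a : Option ι) (u : E3) : Continuous fun τ => slide a τ u := by
  cases a <;> simp only [slide, lift] <;> fun_prop

/-- The constant Reeb vector of a piece. -/
def reebVector : Option ι → E3
  | none => (0, 0, 1)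
  | some _ => (1, 0, 0)

theorem slide_eq (a : Option ι) (τ : ℝ) (u : E3) : slide a τ u = u + τ • reebVector a := by
  cases a <;> ext <;> simp [slide, lift, reebVector]

theorem isReebVector_pieceForm {a : Option ι} {u v : E3} :
    IsReebVector (pieceForm a) u v ↔ v = reebVector a := by
  cases a
  · exact isReebVector_alphaStd
  · exact isReebVector_alphaModel

theorem IsGood.coherence_handle_exterior (hS : S.IsGood) {i : ι} {v u : E3} {J : Set ℝ}
    (hJ : IsPreconnected J) (hv : ∀ τ ∈ J, slide (some i) τ v ∈ S.pieceDomain (some i))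
    (hu : ∀ τ ∈ J, lift τ u ∈ S.pieceDomain none) {τ₀ : ℝ} (h₀ : τ₀ ∈ J)
    (h : S.point (some i) (slide (some i) τ₀ v) (hv τ₀ h₀) =
      S.point none (lift τ₀ u) (hu τ₀ h₀)) {τ : ℝ} (hτ : τ ∈ J) :
    S.point (some i) (slide (some i) τ v) (hv τ hτ) = S.point none (lift τ u) (hu τ hτ) := by
  obtain ⟨z, p, q⟩ := v
  have hm := hS.width_pos
  have hm' := hS.width_lt
  have hr := hS.lt_radius
  have hord := hJ.ordConnected
  have hi : S.coeff i ≠ 0 := (hv τ₀ h₀).1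
  have hp : |p| < S.nbhd.radius := (hS.handle_bounds (hv τ₀ h₀)).2.1
  -- no value between two values of the height may lie in the removed part
  have hivt : ∀ k : ℝ, ∀ τ₁ ∈ J, ∀ τ₂ ∈ J, k ≤ τ₁ → τ₂ ≤ k → k ∈ J := fun k τ₁ h1 τ₂ h2 h3 h4 =>
    hord.out h2 h1 ⟨h4, h3⟩
  rcases hS.handle_eq_exterior h with ⟨h1, h2⟩ | ⟨h1, h2, h3⟩
  · -- bottom and sides
    have hmap : ∀ τ, |z + τ| < S.nbhd.radius →
        lift τ u = S.nbhd.map i (z + τ, p, q) := by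
      intro τ hτ
      have h3 : |z + τ₀| < S.nbhd.radius := (hS.abs_lt_of_side (hv τ₀ h₀) h1).trans hr
      have h4 := S.nbhd.lift_map i (T := τ - τ₀) (q := q) h3 (by ring_nf at hτ ⊢; exact hτ) hp
      rw [show z + τ₀ + (τ - τ₀) = z + τ by ring] at h4
      rw [← h4]
      change lift τ₀ u = S.nbhd.map i (z + τ₀, p, q) at h2
      rw [← h2, lift_lift, add_sub_cancel]
    have hside : z + τ < -S.width ∨ S.width < |p| := by
      rcases h1 with h1 | h1
      · by_contra! hcon
        change z + τ₀ < -S.width at h1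
        have hk := hivt (-S.width - z) τ hτ τ₀ h₀ (by linarith) (by linarith)
        have h5 := hu _ hk
        rw [hmap _ (by rw [add_sub_cancel, abs_neg, abs_of_pos hm]; linarith), add_sub_cancel] at h5
        exact h5 i hi ⟨(-S.width, p, q), ⟨by simp [abs_of_pos hm]; rfl, hcon.2⟩, rfl⟩
      · exact Or.inr h1
    have hz := hS.abs_lt_of_side (hv τ hτ) hside
    have he := hmap τ (hz.trans hr)
    have hg := Quot.sound (Glue.bottomSide i (z + τ) p q (hv τ hτ) (he ▸ hu τ hτ) hside)
    exact hg.trans (S.point_congr he.symm _ _)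
  · -- top
    change |p| ≤ S.width at h1
    change S.width < z + τ₀ - S.drop i p at h2
    have hbd : ∀ τ ∈ J, z + τ - S.drop i p < S.ε := fun τ hτ =>
      (hS.handle_bounds (hv τ hτ)).2.2.2
    have hmap : ∀ τ, |z + τ - S.drop i p| < S.nbhd.radius →
        lift τ u = S.nbhd.map i (z + τ - S.drop i p, p, q + S.turn i p) := by
      intro τ hτ
      have h5 : |z + τ₀ - S.drop i p| < S.nbhd.radius := by
        have := hbd τ₀ h₀
        rw [abs_lt]; constructor <;> linarith
      have h4 := S.nbhd.lift_map i (T := τ - τ₀) (q := q + S.turn i p) h5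
        (by rw [show z + τ₀ - S.drop i p + (τ - τ₀) = z + τ - S.drop i p by ring]; exact hτ) hp
      rw [show z + τ₀ - S.drop i p + (τ - τ₀) = z + τ - S.drop i p by ring] at h4
      rw [← h4]
      change lift τ₀ u = S.nbhd.map i (z + τ₀ - S.drop i p, p, q + S.turn i p) at h3
      rw [← h3, lift_lift, add_sub_cancel]
    have htop : S.width < z + τ - S.drop i p := by
      by_contra! hcon
      have hk := hivt (S.width - z + S.drop i p) τ₀ h₀ τ hτ (by linarith) (by linarith)
      have h5 := hu _ hk
      have e : z + (S.width - z + S.drop i p) - S.drop i p = S.width := by ring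
      rw [hmap _ (by rw [e, abs_of_pos hm]; linarith), e] at h5
      exact h5 i hi ⟨(S.width, p, q + S.turn i p), ⟨by simp [abs_of_pos hm]; rfl, h1⟩, rfl⟩
    have he := hmap τ (by
      have := hbd τ hτ
      rw [abs_lt]; constructor <;> linarith)
    have hg := Quot.sound (Glue.top i (z + τ) p q _ _ (hv τ hτ) (he ▸ hu τ hτ) rfl rfl htop)
    exact hg.trans (S.point_congr he.symm _ _)

/-- Two Reeb segments in pieces which meet at one time agree. -/
theorem IsGood.coherence (hS : S.IsGood) {a b : Option ι} {v u : E3} {J : Set ℝ}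
    (hJ : IsPreconnected J) (hv : ∀ τ ∈ J, slide a τ v ∈ S.pieceDomain a)
    (hu : ∀ τ ∈ J, slide b τ u ∈ S.pieceDomain b) {τ₀ : ℝ} (h₀ : τ₀ ∈ J)
    (h : S.point a (slide a τ₀ v) (hv τ₀ h₀) = S.point b (slide b τ₀ u) (hu τ₀ h₀))
    {τ : ℝ} (hτ : τ ∈ J) :
    S.point a (slide a τ v) (hv τ hτ) = S.point b (slide b τ u) (hu τ hτ) := by
  rcases a with _ | i <;> rcases b with _ | j
  · have h1 := hS.exterior_injective h
    have : v = u := by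
      simp only [slide, lift, Prod.mk.injEq, add_left_inj] at h1
      exact Prod.ext h1.1 (Prod.ext h1.2.1 h1.2.2)
    subst this
    rfl
  · exact (hS.coherence_handle_exterior hJ hu hv h₀ h.symm hτ).symm
  · exact hS.coherence_handle_exterior hJ hv hu h₀ h hτ
  · obtain ⟨rfl, h1, h2, n, h3⟩ := hS.handle_injective h
    simp only [slide] at h1 h2 h3
    obtain ⟨z, p, q⟩ := v
    obtain ⟨z', p', q'⟩ := u
    simp only [add_left_inj] at h1 h2 h3
    subst h1 h2
    exact point_add_int i n h3 _ _

/-- The curves that are locally Reeb segments in pieces. -/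
def IsLocallyStraight (S : SurgeryData ι) (A : ℝ) (γ : ℝ → S.Manifold) : Prop :=
  ∀ t ∈ Icc 0 A, ∃ (a : Option ι) (u : E3), ∃ δ > 0, ∀ s ∈ Icc 0 A, |s - t| < δ →
    ∃ h : slide a (s - t) u ∈ S.pieceDomain a, γ s = S.point a (slide a (s - t) u) h

theorem isReebCurve_iff {A : ℝ} {γ : ℝ → S.Manifold} :
    S.IsReebCurve A γ ↔ S.IsLocallyStraight A γ := by
  constructor
  · intro hγ t ht
    obtain ⟨a, u, hu⟩ := hγ t ht
    rw [eventually_nhdsWithin_iff] at hu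
    obtain ⟨δ, hδ, hball⟩ := Metric.eventually_nhds_iff_ball.1 hu
    refine ⟨a, u t, δ, hδ, fun s hs hst => ?_⟩
    have hconv : Convex ℝ (Icc 0 A ∩ Metric.ball t δ) := (convex_Icc 0 A).inter (convex_ball t δ)
    have hd : ∀ x ∈ Icc 0 A ∩ Metric.ball t δ,
        HasDerivWithinAt (fun x => u x - x • reebVector a) 0 (Icc 0 A ∩ Metric.ball t δ) x := by
      rintro x ⟨hx1, hx2⟩
      obtain ⟨-, v, hv, hr⟩ := hball x hx2 hx1
      rw [isReebVector_pieceForm] at hr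
      subst hr
      have h1 := hv.mono (inter_subset_left (t := Metric.ball t δ))
      have h2 : HasDerivWithinAt (fun x : ℝ => x • (reebVector a : E3)) (reebVector a)
          (Icc 0 A ∩ Metric.ball t δ) x := by
        simpa using ((hasDerivAt_id x).smul_const (reebVector a : E3)).hasDerivWithinAt
      exact (h1.sub h2).congr_deriv (sub_self _)
    have hbound := hconv.norm_image_sub_le_of_norm_hasDerivWithin_le hd (C := 0) (by simp)
      ⟨ht, Metric.mem_ball_self hδ⟩ ⟨hs, by simpa [Real.dist_eq] using hst⟩
    rw [zero_mul, norm_le_zero_iff, sub_eq_zero] at hbound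
    have he : u s = slide a (s - t) (u t) := by
      rw [slide_eq, sub_smul]
      rw [sub_eq_iff_eq_add] at hbound
      rw [hbound]
      abel
    obtain ⟨⟨h1, h2⟩, -⟩ := hball s (by simpa [Real.dist_eq] using hst) hs
    exact ⟨he ▸ h1, h2.trans (S.point_congr he _ _)⟩
  · intro hγ t ht
    obtain ⟨a, u, δ, hδ, h⟩ := hγ t ht
    refine ⟨a, fun s => slide a (s - t) u, ?_⟩
    rw [eventually_nhdsWithin_iff]
    filter_upwards [Metric.ball_mem_nhds t hδ] with s hs hs'
    refine ⟨h s hs' (by simpa [Real.dist_eq] using hs), reebVector a, ?_,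
      isReebVector_pieceForm.2 rfl⟩
    have h1 : HasDerivAt (fun s => s - t) 1 s := (hasDerivAt_id s).sub_const t
    have h2 := (h1.smul_const (reebVector a : E3)).const_add u
    simp only [slide_eq]
    simpa using h2.hasDerivWithinAt

theorem IsGood.curve_unique (hS : S.IsGood) {A : ℝ} {γ γ' : ℝ → S.Manifold}
    (h : S.IsReebCurve A γ) (h' : S.IsReebCurve A γ') (h0 : γ 0 = γ' 0) {t : ℝ}
    (ht : t ∈ Icc 0 A) : γ t = γ' t := by
  rw [isReebCurve_iff] at h h'
  have hlc : IsLocallyConstant fun x : Icc 0 A => γ x = γ' x := by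
    rw [IsLocallyConstant.iff_eventually_eq]
    rintro ⟨x, hx⟩
    obtain ⟨a, u, δ, hδ, hu⟩ := h x hx
    obtain ⟨b, v, δ', hδ', hv⟩ := h' x hx
    have hball : Metric.ball (⟨x, hx⟩ : Icc 0 A) (min δ δ') ∈ 𝓝 (⟨x, hx⟩ : Icc 0 A) :=
      Metric.ball_mem_nhds _ (lt_min hδ hδ')
    filter_upwards [hball] with y hy
    have hy : |(y : ℝ) - x| < min δ δ' := hy
    let J : Set ℝ := {τ | x + τ ∈ Icc 0 A ∧ |τ| < min δ δ'}
    have hJ : IsPreconnected J := by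
      have : J = Icc (-x) (A - x) ∩ Ioo (-(min δ δ')) (min δ δ') := by
        ext τ
        simp only [J, mem_ofPred_eq, mem_inter_iff, mem_Icc, mem_Ioo, abs_lt]
        constructor <;> rintro ⟨⟨h1, h2⟩, h3⟩ <;> exact ⟨⟨by linarith, by linarith⟩, h3⟩
      rw [this]
      exact ((convex_Icc _ _).inter (convex_Ioo _ _)).isPreconnected
    have hu' : ∀ τ (hτ : τ ∈ J), ∃ h, γ (x + τ) = S.point a (slide a τ u) h := fun τ hτ => by
      have := hu (x + τ) hτ.1 (by simpa using hτ.2.trans_le (min_le_left _ _))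
      simpa using this
    have hv' : ∀ τ (hτ : τ ∈ J), ∃ h, γ' (x + τ) = S.point b (slide b τ v) h := fun τ hτ => by
      have := hv (x + τ) hτ.1 (by simpa using hτ.2.trans_le (min_le_right _ _))
      simpa using this
    have key : ∀ σ ∈ J, ∀ τ ∈ J, γ (x + σ) = γ' (x + σ) → γ (x + τ) = γ' (x + τ) := by
      intro σ hσ τ hτ heq
      rw [(hu' σ hσ).2, (hv' σ hσ).2] at heq
      rw [(hu' τ hτ).2, (hv' τ hτ).2]
      exact hS.coherence hJ (fun τ hτ => (hu' τ hτ).1) (fun τ hτ => (hv' τ hτ).1) hσ heq hτ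
    have m0 : (0 : ℝ) ∈ J := ⟨by rw [add_zero]; exact hx, by rw [abs_zero]; exact lt_min hδ hδ'⟩
    have my : (y : ℝ) - x ∈ J := ⟨by rw [add_sub_cancel]; exact y.2, hy⟩
    have k1 := key _ m0 _ my
    have k2 := key _ my _ m0
    simp only [add_zero, add_sub_cancel] at k1 k2
    exact propext ⟨k2, k1⟩
  have hA : (0 : ℝ) ≤ A := ht.1.trans ht.2
  have : PreconnectedSpace (Icc 0 A) := Subtype.preconnectedSpace isPreconnected_Icc
  have := hlc.apply_eq_of_preconnectedSpace ⟨0, le_rfl, hA⟩ ⟨t, ht⟩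
  exact this.mp h0

/-- `y` is reached from `x` by the Reeb flow after time `T`. -/
def Flow (S : SurgeryData ι) (x : S.Manifold) (T : ℝ) (y : S.Manifold) : Prop :=
  0 ≤ T ∧ ∃ γ : ℝ → S.Manifold, S.IsReebCurve T γ ∧ γ 0 = x ∧ γ T = y

theorem IsReebCurve.flow {A a b : ℝ} {γ : ℝ → S.Manifold} (h : S.IsReebCurve A γ) (h0 : 0 ≤ a)
    (hab : a ≤ b) (hb : b ≤ A) : S.Flow (γ a) (b - a) (γ b) := by
  refine ⟨by linarith, fun s => γ (a + s), ?_, by simp, by simp⟩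
  rw [isReebCurve_iff] at h ⊢
  intro t ht
  obtain ⟨c, u, δ, hδ, hu⟩ := h (a + t) ⟨by linarith [ht.1], by linarith [ht.2]⟩
  refine ⟨c, u, δ, hδ, fun s hs hst => ?_⟩
  have := hu (a + s) ⟨by linarith [hs.1], by linarith [hs.2]⟩ (by simpa using hst)
  simpa using this

theorem IsReebCurve.flow_zero {A t : ℝ} {γ : ℝ → S.Manifold} (h : S.IsReebCurve A γ)
    (ht : t ∈ Icc 0 A) : S.Flow (γ 0) t (γ t) := by
  simpa using IsReebCurve.flow h le_rfl ht.1 ht.2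

theorem IsGood.flow_unique (hS : S.IsGood) {x y y' : S.Manifold} {T : ℝ} (h : S.Flow x T y)
    (h' : S.Flow x T y') : y = y' := by
  obtain ⟨hT, γ, h1, rfl, rfl⟩ := h
  obtain ⟨-, γ', h1', h2, rfl⟩ := h'
  exact hS.curve_unique h1 h1' h2.symm ⟨hT, le_rfl⟩

theorem Flow.segment {a : Option ι} {u : E3} {T : ℝ} (hT : 0 ≤ T)
    (h : ∀ τ ∈ Icc 0 T, slide a τ u ∈ S.pieceDomain a) (h0 : u ∈ S.pieceDomain a) :
    S.Flow (S.point a u h0) T (S.point a (slide a T u) (h T ⟨hT, le_rfl⟩)) := by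
  classical
  refine ⟨hT, fun τ => if hτ : τ ∈ Icc 0 T then S.point a (slide a τ u) (h τ hτ)
    else S.point a u h0, ?_, ?_, ?_⟩
  · rw [isReebCurve_iff]
    intro t ht
    refine ⟨a, slide a t u, 1, one_pos, fun s hs _ => ?_⟩
    have e : slide a (s - t) (slide a t u) = slide a s u := by
      rw [slide_slide, add_sub_cancel]
    exact ⟨e ▸ h s hs, by dsimp only; rw [dif_pos hs]; exact S.point_congr e.symm _ _⟩
  · dsimp only
    rw [dif_pos ⟨le_rfl, hT⟩]
    exact S.point_congr (slide_zero a u) _ _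
  · dsimp only
    rw [dif_pos ⟨hT, le_rfl⟩]

theorem IsGood.flow_trans [Finite ι] (hS : S.IsGood) {x y z : S.Manifold} {T T' : ℝ}
    (h : S.Flow x T y) (h' : S.Flow y T' z) : S.Flow x (T + T') z := by
  obtain ⟨hT, γ, hγ, rfl, rfl⟩ := h
  obtain ⟨hT', γ', hγ', h0, rfl⟩ := h'
  rw [isReebCurve_iff] at hγ hγ'
  refine ⟨by linarith, fun s => if s ≤ T then γ s else γ' (s - T), ?_, by simp [hT], ?_⟩
  · rw [isReebCurve_iff]
    intro t ht
    rcases lt_trichotomy t T with hlt | rfl | hgt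
    · obtain ⟨a, u, δ, hδ, hu⟩ := hγ t ⟨ht.1, hlt.le⟩
      refine ⟨a, u, min δ (T - t), lt_min hδ (by linarith), fun s hs hst => ?_⟩
      rw [lt_min_iff] at hst
      have hsT : s ≤ T := by linarith [(abs_lt.1 hst.2).2]
      simp only [if_pos hsT]
      exact hu s ⟨hs.1, hsT⟩ hst.1
    · obtain ⟨a, u, δ, hδ, hu⟩ := hγ t ⟨ht.1, le_rfl⟩
      obtain ⟨b, v, δ', hδ', hv⟩ := hγ' 0 ⟨le_rfl, hT'⟩
      have hv0 : v ∈ S.pieceDomain b := by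
        obtain ⟨h1, -⟩ := hv 0 ⟨le_rfl, hT'⟩ (by simpa using hδ')
        simpa [slide_zero] using h1
      have hopen : ∀ᶠ τ in 𝓝 (0 : ℝ), slide b τ v ∈ S.pieceDomain b :=
        (continuous_slide b v).continuousAt.eventually
          ((hS.isOpen_pieceDomain b).mem_nhds (by simpa [slide_zero] using hv0))
      obtain ⟨δ'', hδ'', hball⟩ := Metric.eventually_nhds_iff_ball.1 hopen
      refine ⟨b, v, min δ (min δ' δ''), lt_min hδ (lt_min hδ' hδ''), fun s hs hst => ?_⟩
      simp only [lt_min_iff] at hst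
      have hdom : slide b (s - t) v ∈ S.pieceDomain b :=
        hball _ (by simpa [Real.dist_eq] using hst.2.2)
      refine ⟨hdom, ?_⟩
      rcases le_or_gt s t with hle | hgt
      · simp only [if_pos hle]
        have hu' : ∀ τ ∈ Icc (s - t) 0, ∃ h, γ (t + τ) = S.point a (slide a τ u) h := by
          intro τ hτ
          have := hu (t + τ) ⟨by linarith [hτ.1, hs.1], by linarith [hτ.2]⟩ (by
            rw [add_sub_cancel_left]
            rw [abs_of_nonpos hτ.2]
            rw [abs_of_nonpos (by linarith)] at hst
            linarith [hτ.1, hst.1])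
          simpa using this
        have hv' : ∀ τ ∈ Icc (s - t) 0, slide b τ v ∈ S.pieceDomain b := by
          intro τ hτ
          refine hball τ ?_
          rw [mem_ball_zero_iff, Real.norm_eq_abs, abs_of_nonpos hτ.2]
          have := hst.2.2
          rw [abs_of_nonpos (by linarith)] at this
          linarith [hτ.1]
        have m0 : (0 : ℝ) ∈ Icc (s - t) 0 := ⟨by linarith, le_rfl⟩
        have ms : s - t ∈ Icc (s - t) 0 := ⟨le_rfl, by linarith⟩
        have heq : S.point a (slide a 0 u) (hu' 0 m0).1 = S.point b (slide b 0 v) (hv' 0 m0) := by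
          rw [← (hu' 0 m0).2, add_zero, ← h0]
          obtain ⟨h1, h2⟩ := hv 0 ⟨le_rfl, hT'⟩ (by simpa using hδ')
          rw [h2]
          exact S.point_congr (by simp) _ _
        have hc := hS.coherence isPreconnected_Icc (fun τ hτ => (hu' τ hτ).1) hv' m0 heq ms
        rw [← hc, ← (hu' (s - t) ms).2, add_sub_cancel]
      · simp only [if_neg hgt.not_ge]
        obtain ⟨h1, h2⟩ := hv (s - t) ⟨by linarith, by linarith [hs.2]⟩ (by simpa using hst.2.1)
        rw [h2]
        exact S.point_congr (by simp) _ _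
    · obtain ⟨a, u, δ, hδ, hu⟩ := hγ' (t - T) ⟨by linarith, by linarith [ht.2]⟩
      refine ⟨a, u, min δ (t - T), lt_min hδ (by linarith), fun s hs hst => ?_⟩
      rw [lt_min_iff] at hst
      have hsT : T < s := by linarith [(abs_lt.1 hst.2).1]
      simp only [if_neg hsT.not_ge]
      have := hu (s - T) ⟨by linarith, by linarith [hs.2]⟩ (by simpa using hst.1)
      simpa using this
  · rcases hT'.eq_or_lt with rfl | hlt
    · simp [h0]
    · have : ¬ T + T' ≤ T := by linarith
      simp [this]

end SurgeryData

namespace SurgeryData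

variable {ι : Type*} {S : SurgeryData ι}

/-! ### Passing through a handle -/

theorem Flow.refl (x : S.Manifold) (hx : ∃ a u h, x = S.point a u h) : S.Flow x 0 x := by
  obtain ⟨a, u, h, rfl⟩ := hx
  have := Flow.segment (S := S) (a := a) (u := u) le_rfl (fun τ hτ => by
    have : τ = 0 := le_antisymm hτ.2 hτ.1
    rwa [this, slide_zero]) h
  convert this using 1
  exact S.point_congr (slide_zero a u).symm _ _

theorem IsGood.flow_split (hS : S.IsGood) {x y z : S.Manifold} {T T' : ℝ}
    (h : S.Flow x (T + T') z) (hT' : 0 ≤ T') (h' : S.Flow x T y) : S.Flow y T' z := by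
  obtain ⟨h0, γ, hγ, rfl, rfl⟩ := h
  have h1 := IsReebCurve.flow_zero hγ (t := T) ⟨h'.1, by linarith⟩
  have h2 := IsReebCurve.flow hγ h'.1 (show T ≤ T + T' by linarith) le_rfl
  rw [hS.flow_unique h1 h', add_sub_cancel_left] at h2
  exact h2

theorem Flow.exterior {u : E3} {T : ℝ} (hT : 0 ≤ T)
    (h : ∀ τ ∈ Icc 0 T, lift τ u ∈ S.pieceDomain none) (hu : u ∈ S.pieceDomain none)
    (hu' : lift T u ∈ S.pieceDomain none) :
    S.Flow (S.point none u hu) T (S.point none (lift T u) hu') :=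
  Flow.segment (a := none) hT h hu

theorem flow_handle_map {i : ι} {z z' p q : ℝ} (hzz : z ≤ z')
    (h : (z, p, q) ∈ S.pieceDomain (some i)) (h' : (z', p, q) ∈ S.pieceDomain (some i)) :
    S.Flow (S.point (some i) _ h) (z' - z) (S.point (some i) _ h') := by
  have := Flow.segment (S := S) (a := some i) (u := (z, p, q)) (T := z' - z) (by linarith)
    (fun τ hτ => ⟨h.1, h.2.1, by
      have := h.2.2.1
      simp only [slide] at this ⊢
      linarith [hτ.1], by
      have := h'.2.2.2
      simp only [slide] at this ⊢
      linarith [hτ.2]⟩) h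
  convert this using 1
  exact S.point_congr (by simp [slide]) _ _

theorem bottom_glue {i : ι} {z p q : ℝ} (h : (z, p, q) ∈ S.pieceDomain (some i))
    (h' : S.nbhd.map i (z, p, q) ∈ S.pieceDomain none) (hz : z < -S.width) :
    S.point (some i) _ h = S.point none _ h' :=
  Quot.sound (Glue.bottomSide i z p q h h' (Or.inl hz))

theorem top_glue {i : ι} {z p q : ℝ} (h : (z + S.drop i p, p, q) ∈ S.pieceDomain (some i))
    (h' : S.nbhd.map i (z, p, q + S.turn i p) ∈ S.pieceDomain none) (hz : S.width < z) :
    S.point (some i) _ h = S.point none _ h' :=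
  Quot.sound (Glue.top i (z + S.drop i p) p q z _ h h' (by unfold drop; ring) rfl hz)

namespace IsGood

variable (hS : S.IsGood)
include hS

/-- Vertical segments in the part of the neighbourhood which is not removed. -/
theorem flow_exterior_map {i : ι} {z z' p q : ℝ} (hzz : z ≤ z') (hz : |z| < S.nbhd.radius)
    (hz' : |z'| < S.nbhd.radius) (hp : |p| < S.nbhd.radius)
    (h : z' < -S.width ∨ S.width < z ∨ S.width < |p|)
    (hu : S.nbhd.map i (z, p, q) ∈ S.pieceDomain none)
    (hu' : S.nbhd.map i (z', p, q) ∈ S.pieceDomain none) :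
    S.Flow (S.point none _ hu) (z' - z) (S.point none _ hu') := by
  have key : ∀ τ ∈ Icc 0 (z' - z), lift τ (S.nbhd.map i (z, p, q)) = S.nbhd.map i (z + τ, p, q) ∧
      lift τ (S.nbhd.map i (z, p, q)) ∈ S.pieceDomain none := by
    intro τ hτ
    have hb : |z + τ| < S.nbhd.radius := by
      rw [abs_lt] at *
      constructor <;> linarith [hτ.1, hτ.2]
    have e := S.nbhd.lift_map i (q := q) hz hb hp
    refine ⟨e, e ▸ hS.map_mem_exterior hb hp ?_⟩
    rcases h with h | h | h
    · exact Or.inl (lt_abs.2 (Or.inr (by linarith [hτ.2])))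
    · exact Or.inl (lt_abs.2 (Or.inl (by linarith [hτ.1])))
    · exact Or.inr h
  have hm : z' - z ∈ Icc 0 (z' - z) := ⟨by linarith, le_rfl⟩
  have := Flow.exterior (by linarith) (fun τ hτ => (key τ hτ).2) hu (key _ hm).2
  convert this using 1
  refine S.point_congr ?_ _ _
  rw [(key _ hm).1, add_sub_cancel]

theorem handle_mem {i : ι} (hi : S.coeff i ≠ 0) {z p q : ℝ} (hp : |p| ≤ S.width) (h : -S.ε < z)
    (h' : z - S.drop i p < S.ε) : (z, p, q) ∈ S.pieceDomain (some i) :=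
  ⟨hi, hp.trans_lt hS.width_lt, h, by
    change z < S.ε + S.drop i p
    linarith⟩

/-- From below the handle to a point of the handle. -/
theorem flow_into_handle [Finite ι] {i : ι} {z z' p q : ℝ}
    (hp : |p| ≤ S.width) (hz : |z| < S.nbhd.radius) (hz0 : z < -S.width)
    (hu : S.nbhd.map i (z, p, q) ∈ S.pieceDomain none) (hzz : z < z')
    (hu' : (z', p, q) ∈ S.pieceDomain (some i)) :
    S.Flow (S.point none _ hu) (z' - z) (S.point (some i) _ hu') := by
  have hm := hS.width_pos
  have hm' := hS.width_lt
  have hr := hS.lt_radius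
  obtain ⟨hi, hpr, h1, h2⟩ := hS.handle_bounds hu'
  simp only at h1 h2
  -- an intermediate height at which the point lies in the exterior and in the handle
  obtain ⟨a, ha1, ha2, ha3, ha4⟩ : ∃ a, z ≤ a ∧ a ≤ z' ∧ -S.ε < a ∧ a < -S.width := by
    rcases lt_or_ge z' (-S.width) with h | h
    · exact ⟨z', hzz.le, le_rfl, h1, h⟩
    · refine ⟨max z (-(S.width + S.ε) / 2), le_max_left _ _, max_le hzz.le (by linarith),
        lt_max_of_lt_right (by linarith), max_lt hz0 (by linarith)⟩
  have haR : |a| < S.nbhd.radius := by rw [abs_lt] at *; constructor <;> linarith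
  have hda := abs_le.1 (hS.abs_drop_le i p)
  have hae : S.nbhd.map i (a, p, q) ∈ S.pieceDomain none :=
    hS.map_mem_exterior haR hpr (Or.inl (lt_abs.2 (Or.inr (by linarith))))
  have hah := hS.handle_mem (q := q) hi hp ha3 (by linarith)
  have f1 := hS.flow_exterior_map ha1 hz haR hpr (Or.inl ha4) hu hae
  rw [← bottom_glue hah hae ha4] at f1
  have f2 := flow_handle_map ha2 hah hu'
  have := hS.flow_trans f1 f2
  rwa [show a - z + (z' - a) = z' - z by ring] at this

/-- Passage through a handle. -/
theorem flow_passage [Finite ι] {i : ι} (hi : S.coeff i ≠ 0) {z z' p q : ℝ}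
    (hz : |z| < S.nbhd.radius) (hz' : |z'| < S.nbhd.radius) (hp : |p| < S.nbhd.radius)
    (hz0 : z < -S.width) (hz1 : S.width < z') (hu : S.nbhd.map i (z, p, q) ∈ S.pieceDomain none)
    (hu' : S.nbhd.map i (z', p, q + S.turn i p) ∈ S.pieceDomain none) :
    S.Flow (S.point none _ hu) (z' - z + S.drop i p) (S.point none _ hu') := by
  have hm := hS.width_pos
  have hm' := hS.width_lt
  have hr := hS.lt_radius
  rcases lt_or_ge S.width |p| with h | h
  · obtain ⟨n, hn⟩ := hS.exists_turn_eq i h.le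
    have e : S.nbhd.map i (z', p, q + S.turn i p) = S.nbhd.map i (z', p, q) := by
      rw [hn, S.nbhd.map_add_int i hz' hp]
    have := hS.flow_exterior_map (by linarith) hz hz' hp (Or.inr (Or.inr h)) hu (e ▸ hu')
    rw [hS.drop_eq_zero i h.le, add_zero]
    convert this using 1
    exact S.point_congr e _ _
  · have hda := abs_le.1 (hS.abs_drop_le i p)
    obtain ⟨b, hb1, hb2, hb3⟩ : ∃ b, b ≤ z' ∧ S.width < b ∧ b < S.ε :=
      ⟨min z' ((S.width + S.ε) / 2), min_le_left _ _, lt_min hz1 (by linarith),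
        min_lt_of_right_lt (by linarith)⟩
    have hbR : |b| < S.nbhd.radius := by rw [abs_lt] at *; constructor <;> linarith
    have hbe : S.nbhd.map i (b, p, q + S.turn i p) ∈ S.pieceDomain none :=
      hS.map_mem_exterior hbR hp (Or.inl (lt_abs.2 (Or.inl hb2)))
    have hbh := hS.handle_mem (z := b + S.drop i p) (q := q) hi h (by linarith) (by linarith)
    have f1 := hS.flow_into_handle h hz hz0 hu (by linarith) hbh
    rw [top_glue hbh hbe hb2] at f1
    have f2 := hS.flow_exterior_map hb1 hbR hz' hp (Or.inr (Or.inl hb2)) hbe hu'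
    have := hS.flow_trans f1 f2
    rwa [show b + S.drop i p - z + (z' - b) = z' - z + S.drop i p by ring] at this

/-- While an orbit passes through a handle, it stays in the neighbourhood. -/
theorem eq_map_of_flow_passage [Finite ι] {i : ι} (hi : S.coeff i ≠ 0) {p q τ : ℝ}
    (hp : |p| ≤ S.ε) (hτ : 0 < τ) (hτ' : τ < 2 * S.ε + S.drop i p)
    (hu : S.nbhd.map i (-S.ε, p, q) ∈ S.pieceDomain none) {v : E3}
    {hv : v ∈ S.pieceDomain none} (h : S.Flow (S.point none _ hu) τ (S.point none v hv)) :
    ∃ z q' : ℝ, |z| < S.ε ∧ v = S.nbhd.map i (z, p, q') := by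
  have hm := hS.width_pos
  have hm' := hS.width_lt
  have hr := hS.lt_radius
  have he := hS.pos
  have heR : |(-S.ε)| < S.nbhd.radius := by rwa [abs_neg, abs_of_pos he]
  rcases lt_or_ge S.width |p| with hlt | hge
  · rw [hS.drop_eq_zero i hlt.le] at hτ'
    have hz : |-S.ε + τ| < S.ε := by rw [abs_lt]; constructor <;> linarith
    have hmem := hS.map_mem_exterior (i := i) (q := q) (hz.trans hr) (hp.trans_lt hr) (Or.inr hlt)
    have f := hS.flow_exterior_map (by linarith) heR (hz.trans hr) (hp.trans_lt hr)
      (Or.inr (Or.inr hlt)) hu hmem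
    rw [show -S.ε + τ - -S.ε = τ by ring] at f
    exact ⟨_, _, hz, hS.exterior_injective (hS.flow_unique h f)⟩
  · have hmem := hS.handle_mem (z := -S.ε + τ) (q := q) hi hge (by linarith) (by linarith)
    have f := hS.flow_into_handle hge heR (by linarith) hu (by linarith) hmem
    rw [show -S.ε + τ - -S.ε = τ by ring] at f
    rcases hS.handle_eq_exterior (hS.flow_unique f h) with ⟨h1, h2⟩ | ⟨-, h1, h2⟩
    · exact ⟨_, _, hS.abs_lt_of_side hmem h1, h2⟩
    · have hb := (hS.handle_bounds hmem).2.2.2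
      exact ⟨_, _, by simp only at hb h1; rw [abs_lt]; constructor <;> linarith, h2⟩

end IsGood

end SurgeryData

namespace SurgeryData

variable {ι : Type*} (S : SurgeryData ι)

/-! ### The equations of orbits with a given word -/

/-- The standing assumptions: the neighbourhood is thin and the twist function is adapted to it. -/
structure IsAdapted : Prop where
  generic : S.link.ChordGeneric
  fine : S.nbhd.IsFine S.ε
  twist : IsAdaptedTwist S.link S.coeff S.ε S.η S.f

/-- The `p`-coordinate at the tip of `r` of the vertical line with offset `y` at the tail of `r`. -/
def arrival (r : S.link.Chord) (y : ℝ) : ℝ := -(S.nbhd.sign r * y)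

/-- The offset from the tail of `r'` with which an orbit leaves the handle which it enters along `r`
from the point with coordinate `x` and offset `y` at the tail of `r`. -/
def offset (r r' : S.link.Chord) (x y : ℝ) : ℝ :=
  S.nbhd.sign r * x + S.turn r.tgt (S.arrival r y) - (S.coeff r.tgt : ℝ) * gap S.coeff r r'

/-- The time needed to reach the bottom of the handle at the tip of `r`. -/
def climb (r : S.link.Chord) (z x y : ℝ) : ℝ := r.height - S.ε - z - x * y

/-- The time needed to pass through a handle. -/
def crossing (i : ι) (p : ℝ) : ℝ := 2 * S.ε + S.drop i p

/-- The orbit which starts at height `z`, with `p`-coordinate `x` and with offset `y`, at the tail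
of the first chord of the list follows the chords of the list and ends after time `A` on `Λ⁰`. -/
def Run : List S.link.Chord → ℝ → ℝ → ℝ → ℝ → Prop
  | [], _, _, _, _ => False
  | [r], z, _, y, A => y = 0 ∧ S.coeff r.tgt = 0 ∧ A = r.height - z
  | r :: r' :: w, z, x, y, A => r.tgt = r'.src ∧ S.coeff r.tgt ≠ 0 ∧ |y| ≤ S.ε ∧
      |S.offset r r' x y| ≤ S.ε ∧ ∃ A', Run (r' :: w) S.ε (S.arrival r y) (S.offset r r' x y) A' ∧
        A = S.climb r z x y + S.crossing r.tgt (S.arrival r y) + A'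

variable {S}

theorem abs_arrival (r : S.link.Chord) (y : ℝ) : |S.arrival r y| = |y| := by
  rw [arrival, abs_neg, S.nbhd.abs_sign_mul]

namespace IsAdapted

variable (hS : S.IsAdapted)
include hS

theorem pos : 0 < S.ε := hS.fine.pos

theorem good : S.IsGood where
  twist := hS.twist.toIsTwist
  pos := hS.pos
  lt_radius := by linarith [hS.fine.lt_radius, hS.pos]

theorem abs_le_of_run {w : List S.link.Chord} {z x y A : ℝ} (h : S.Run w z x y A) : |y| ≤ S.ε := by
  match w, h with
  | [_], h => rw [h.1, abs_zero]; exact hS.pos.le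
  | _ :: _ :: _, h => exact h.2.2.1

theorem offset_eq {r r' : S.link.Chord} (hr : r.tgt = r'.src) (hc : S.coeff r.tgt ≠ 0) {x y : ℝ}
    (hx : |x| ≤ S.ε) (hy : |y| ≤ S.ε) (hy' : |S.offset r r' x y| ≤ S.ε) :
    S.offset r r' x y = S.nbhd.sign r * x + (S.coeff r.tgt : ℝ) * (S.arrival r y / S.ε + 1 / 2)
      - (S.coeff r.tgt : ℝ) * gap S.coeff r r' ∧ deriv S.f (S.arrival r y / S.ε) = 1 := by
  obtain ⟨-, h2, h3⟩ := hS.twist.affine_of_passing hS.pos hr hc (p := S.arrival r y)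
    (by rwa [abs_arrival]) (x := S.nbhd.sign r * x) (by rwa [S.nbhd.abs_sign_mul]) hy' rfl
  refine ⟨?_, h3⟩
  rw [← h2]
  rfl

theorem abs_sub_le_of_run {w : List S.link.Chord} {z x y A z' x' y' A' : ℝ} (hx : |x| ≤ S.ε)
    (hx' : |x'| ≤ S.ε) (h : S.Run w z x y A) (h' : S.Run w z' x' y' A') : |y - y'| ≤ |x - x'| := by
  match w, h, h' with
  | [_], h, h' => rw [h.1, h'.1, sub_self, abs_zero]; exact abs_nonneg _
  | r :: r' :: w, ⟨h1, h2, h3, h4, B, h5, _⟩, ⟨_, _, h3', h4', B', h5', _⟩ =>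
    have ih := abs_sub_le_of_run (by rwa [abs_arrival]) (by rwa [abs_arrival]) h5 h5'
    obtain ⟨e, -⟩ := hS.offset_eq h1 h2 hx h3 h4
    obtain ⟨e', -⟩ := hS.offset_eq h1 h2 hx' h3' h4'
    have hε := hS.pos
    have hε' := hS.fine.lt_quarter
    have k1 : S.arrival r y - S.arrival r y' = -(S.nbhd.sign r * (y - y')) := by
      unfold arrival; ring
    have k2 : |S.arrival r y - S.arrival r y'| = |y - y'| := by
      rw [k1, abs_neg, S.nbhd.abs_sign_mul]
    have k3 : S.nbhd.sign r * (x - x') =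
        (S.offset r r' x y - S.offset r r' x' y') -
          (S.coeff r.tgt : ℝ) * ((S.arrival r y - S.arrival r y') / S.ε) := by
      rw [e, e']; ring
    have k4 : |(S.coeff r.tgt : ℝ) * ((S.arrival r y - S.arrival r y') / S.ε)| =
        |y - y'| / S.ε := by
      rw [abs_signType_cast_mul h2, abs_div, k2, abs_of_pos hε]
    have k5 : 4 * |y - y'| ≤ |y - y'| / S.ε := by
      rw [le_div_iff₀ hε]
      nlinarith [abs_nonneg (y - y')]
    have k6 := abs_sub_abs_le_abs_sub
      ((S.coeff r.tgt : ℝ) * ((S.arrival r y - S.arrival r y') / S.ε))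
      (S.offset r r' x y - S.offset r r' x' y')
    rw [abs_sub_comm ((S.coeff r.tgt : ℝ) * _), ← k3, S.nbhd.abs_sign_mul, k4] at k6
    rw [k2] at ih
    linarith [abs_nonneg (y - y')]

theorem run_unique {w : List S.link.Chord} {z x y A y' A' : ℝ} (hx : |x| ≤ S.ε)
    (h : S.Run w z x y A) (h' : S.Run w z x y' A') : y = y' ∧ A = A' := by
  have hy : y = y' := by
    have := hS.abs_sub_le_of_run hx hx h h'
    rw [sub_self, abs_zero] at this
    exact sub_eq_zero.1 (abs_nonpos_iff.1 this)
  subst hy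
  refine ⟨rfl, ?_⟩
  match w, h, h' with
  | [_], h, h' => rw [h.2.2, h'.2.2]
  | r :: r' :: w, ⟨_, _, h3, _, B, h5, e⟩, ⟨_, _, _, _, B', h5', e'⟩ =>
    rw [e, e', (run_unique (by rwa [abs_arrival]) h5 h5').2]

theorem exists_run (w : List S.link.Chord) (hw : w ≠ [])
    (hchain : List.IsChain (fun r r' : S.link.Chord => r.tgt = r'.src ∧ S.coeff r.tgt ≠ 0) w)
    (hend : S.coeff (w.getLast hw).tgt = 0) (z : ℝ) {x : ℝ} (hx : |x| ≤ S.ε) :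
    ∃ y A, S.Run w z x y A := by
  match w, hw, hchain, hend with
  | [r], _, _, hend => exact ⟨0, _, rfl, hend, rfl⟩
  | r :: r' :: w, _, hchain, hend =>
    obtain ⟨⟨h1, h2⟩, hchain'⟩ := List.isChain_cons_cons.1 hchain
    have ih : ∀ p : ℝ, ∃ y, |p| ≤ S.ε → ∃ A, S.Run (r' :: w) S.ε p y A := fun p => by
      by_cases hp : |p| ≤ S.ε
      · obtain ⟨y, A, h⟩ := exists_run (r' :: w) (List.cons_ne_nil _ _) hchain'
          (by rwa [List.getLast_cons_cons] at hend) S.ε hp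
        exact ⟨y, fun _ => ⟨A, h⟩⟩
      · exact ⟨0, fun h => absurd h hp⟩
    choose Y hY using ih
    have hε := hS.pos
    obtain ⟨g1, g2⟩ := gap_bounds (r' := r') hS.fine h1 h2
    have hYle : ∀ p, |p| ≤ S.ε → |(S.coeff r.tgt : ℝ) * Y p| ≤ S.ε := fun p hp => by
      obtain ⟨A, h⟩ := hY p hp
      rw [abs_signType_cast_mul h2]
      exact hS.abs_le_of_run h
    have hYcont : ContinuousOn Y (Icc (-S.ε) S.ε) := by
      refine (LipschitzOnWith.of_dist_le_mul (K := 1) fun p hp p' hp' => ?_).continuousOn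
      obtain ⟨A, h⟩ := hY p (abs_le.2 hp)
      obtain ⟨A', h'⟩ := hY p' (abs_le.2 hp')
      rw [NNReal.coe_one, one_mul]
      exact hS.abs_sub_le_of_run (abs_le.2 hp) (abs_le.2 hp') h h'
    have hx' : |(S.coeff r.tgt : ℝ) * (S.nbhd.sign r * x)| ≤ S.ε := by
      rwa [abs_signType_cast_mul h2, S.nbhd.abs_sign_mul]
    have hcont : ContinuousOn (fun p => (S.coeff r.tgt : ℝ) * (S.nbhd.sign r * x) +
        scaledTwist S.f S.ε p - gap S.coeff r r' - (S.coeff r.tgt : ℝ) * Y p)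
        (Icc (-S.ε) S.ε) := by
      have := (hS.twist.toIsTwist.contDiff_scaledTwist (ε := S.ε)).continuous.continuousOn
        (s := Icc (-S.ε) S.ε)
      fun_prop
    have hw := hS.good.width_lt
    have f0 : scaledTwist S.f S.ε (-S.ε) = 0 :=
      hS.twist.toIsTwist.scaledTwist_eq_zero hε (neg_le_neg hw.le)
    have f1 : scaledTwist S.f S.ε S.ε = 1 := hS.twist.toIsTwist.scaledTwist_eq_one hε hw.le
    have m0 : |(-S.ε)| ≤ S.ε := by rw [abs_neg, abs_of_pos hε]
    have m1 : |S.ε| ≤ S.ε := (abs_of_pos hε).le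
    have b0 := abs_le.1 (hYle _ m0)
    have b1 := abs_le.1 (hYle _ m1)
    have b2 := abs_le.1 hx'
    obtain ⟨p, hp, hp0⟩ := intermediate_value_Icc (by linarith) hcont (show (0 : ℝ) ∈ _ by
      simp only [f0, f1]
      constructor <;> linarith)
    have hpε := abs_le.2 hp
    obtain ⟨A, hA⟩ := hY p hpε
    have hs := S.nbhd.sign_mul_self r
    have harr : S.arrival r (-(S.nbhd.sign r * p)) = p := by
      unfold arrival; linear_combination p * hs
    have hoff : S.offset r r' x (-(S.nbhd.sign r * p)) = Y p := by
      unfold offset turn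
      rw [harr]
      have hc := signType_cast_mul_self h2
      simp only at hp0
      linear_combination (S.coeff r.tgt : ℝ) * hp0 - (S.nbhd.sign r * x - Y p) * hc
    refine ⟨-(S.nbhd.sign r * p), _, h1, h2, ?_, ?_, A, ?_, rfl⟩
    · rwa [abs_neg, S.nbhd.abs_sign_mul]
    · rw [hoff]; exact hS.abs_le_of_run hA
    · rwa [harr, hoff]

end IsAdapted

end SurgeryData

namespace SurgeryData

variable {ι : Type*} {S : SurgeryData ι}

/-! ### Following a chord -/

/-- The positions at which orbits leave `Λ⁰` or a handle. -/
def IsStart (S : SurgeryData ι) (i : ι) (z x : ℝ) : Prop :=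
  (z = S.ε ∧ |x| ≤ S.ε ∧ S.coeff i ≠ 0) ∨ (z = 0 ∧ x = 0 ∧ S.coeff i = 0)

theorem map_tail_offset {r r' : S.link.Chord} (hr : r.tgt = r'.src) (hc : S.coeff r.tgt ≠ 0)
    {z x y p : ℝ} (hz : |z| < S.nbhd.radius) (hp : |p| < S.nbhd.radius) :
    S.nbhd.map r'.src (z, p, r'.tailParam + S.offset r r' x y) =
      S.nbhd.map r.tgt (z, p, r.tipParam + S.nbhd.sign r * x + S.turn r.tgt (S.arrival r y)) := by
  obtain ⟨m, hm⟩ := exists_gap_eq (r' := r') hc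
  rw [← hr, ← S.nbhd.map_add_int _ hz hp _ m]
  congr 3
  unfold offset
  rw [hm]
  ring

namespace IsAdapted

variable (hS : S.IsAdapted)
include hS

theorem start_bounds {i : ι} {z x : ℝ} (h : S.IsStart i z x) : 0 ≤ z ∧ z ≤ S.ε ∧ |x| ≤ S.ε := by
  have := hS.pos
  rcases h with ⟨rfl, h, -⟩ | ⟨rfl, rfl, -⟩
  · exact ⟨this.le, le_rfl, h⟩
  · exact ⟨le_rfl, this.le, by rw [abs_zero]; exact this.le⟩

theorem mem_exterior_of_start {i : ι} {z x : ℝ} (h : S.IsStart i z x) (q : ℝ) :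
    S.nbhd.map i (z, x, q) ∈ S.pieceDomain none := by
  have hw := hS.good.width_lt
  have hr := hS.good.lt_radius
  rcases h with ⟨rfl, h, -⟩ | ⟨rfl, rfl, hc⟩
  · exact hS.good.map_mem_exterior (by rwa [abs_of_pos hS.pos]) (by linarith)
      (Or.inl (by rwa [abs_of_pos hS.pos]))
  · rw [S.nbhd.core]
    exact hS.good.param_mem_exterior hc q

theorem eq_of_lift_eq {r : S.link.Chord} {z x y z' p' q' τ : ℝ} {j : ι}
    (h : S.IsStart r.src z x) (hy : |y| ≤ S.ε) (hτ : 0 < τ) (hz' : |z'| ≤ S.ε) (hp' : |p'| ≤ S.ε)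
    (hj : S.coeff j ≠ 0 ∨ z' = 0)
    (heq : lift τ (S.nbhd.map r.src (z, x, r.tailParam + y)) = S.nbhd.map j (z', p', q')) :
    j = r.tgt ∧ p' = S.arrival r y ∧ z' = z + τ - r.height + x * y := by
  have hb := hS.start_bounds h
  rcases hS.fine.transit _ _ _ _ _ _ _ _ _ (by rw [abs_of_nonneg hb.1]; exact hb.2.1) hb.2.2 hz' hp'
    hτ heq with ⟨h1, h2⟩ | ⟨r', n, m, y', h1, h2, h3, h4, -, h6⟩
  · exfalso
    rcases h with ⟨rfl, -, -⟩ | ⟨rfl, -, hc⟩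
    · linarith [(abs_le.1 hz').2]
    · rcases hj with hj | rfl
      · exact hj (h1 ▸ hc)
      · linarith
  · have hy' : |y'| ≤ S.ε := by rwa [h4, abs_neg, S.nbhd.abs_sign_mul] at hp'
    have hyy : |y - y'| ≤ 2 * S.ε := (abs_sub _ _).trans (by linarith)
    have hrr := hS.fine.tail_sep r r' n h1.symm (by
      rwa [show r'.tailParam - r.tailParam + n = y - y' by linarith])
    subst hrr
    have hn : (n : ℝ) = y - y' := by linarith
    have hn0 : n = 0 := by
      rw [← hn, ← Int.cast_abs] at hyy
      have : ((|n| : ℤ) : ℝ) < 1 := by linarith [hS.fine.lt_quarter]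
      rwa [← Int.cast_one, Int.cast_lt, Int.abs_lt_one_iff] at this
    rw [hn0, Int.cast_zero] at hn
    have : y' = y := by linarith
    subst this
    exact ⟨h2.symm, h4, h6⟩

theorem climb_pos {r : S.link.Chord} {z x y : ℝ} (h : S.IsStart r.src z x) (hy : |y| ≤ S.ε) :
    0 < S.climb r z x y := by
  have hb := hS.start_bounds h
  have h1 := S.nbhd.radius_le_height r
  have h2 := hS.fine.lt_radius
  have h3 := hS.fine.lt_quarter
  have h4 : x * y ≤ S.ε * 1 := (le_abs_self _).trans (by
    rw [abs_mul]
    exact mul_le_mul hb.2.2 (by linarith) (abs_nonneg _) hS.pos.le)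
  unfold climb
  linarith [hS.pos]

theorem size_lt_crossing (i : ι) (p : ℝ) : S.ε < S.crossing i p := by
  have := abs_le.1 (hS.good.abs_drop_le i p)
  have := hS.good.width_lt
  unfold crossing
  linarith

theorem lift_climb {r : S.link.Chord} {z x y : ℝ} (h : S.IsStart r.src z x) (hy : |y| ≤ S.ε) :
    lift (S.climb r z x y) (S.nbhd.map r.src (z, x, r.tailParam + y)) =
      S.nbhd.map r.tgt (-S.ε, S.arrival r y, r.tipParam + S.nbhd.sign r * x) := by
  have hb := hS.start_bounds h
  have hs := hS.fine.lt_scale r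
  rw [S.nbhd.transit_iff r]
  · refine ⟨rfl, rfl, ?_⟩
    unfold climb
    ring
  · rw [abs_of_nonneg hb.1]; linarith
  · linarith
  · linarith
  · rwa [abs_neg, abs_of_pos hS.pos]
  · rw [abs_arrival]; linarith
  · rw [S.nbhd.abs_sign_mul]; linarith

theorem lift_height {r : S.link.Chord} {z x : ℝ} (h : S.IsStart r.src z x) :
    lift (r.height - z) (S.nbhd.map r.src (z, x, r.tailParam + 0)) =
      S.link.param r.tgt (r.tipParam + S.nbhd.sign r * x) := by
  have hb := hS.start_bounds h
  have hs := hS.fine.lt_scale r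
  have h0 : |(0 : ℝ)| < S.nbhd.scale r := by rw [abs_zero]; exact hS.pos.trans hs
  rw [← S.nbhd.core, S.nbhd.transit_iff r _ _ h0 h0 h0]
  · exact ⟨by ring, rfl, by ring⟩
  · rw [S.nbhd.abs_sign_mul]; linarith
  · rw [abs_of_nonneg hb.1]; linarith
  · linarith

theorem lift_mem_exterior {r : S.link.Chord} {z x y τ : ℝ} (h : S.IsStart r.src z x)
    (hy : |y| ≤ S.ε) (hτ : 0 ≤ τ) (hτ' : S.coeff r.tgt ≠ 0 → τ ≤ S.climb r z x y) :
    lift τ (S.nbhd.map r.src (z, x, r.tailParam + y)) ∈ S.pieceDomain none := by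
  rcases hτ.eq_or_lt with rfl | hτ
  · rw [lift_zero]
    exact hS.mem_exterior_of_start h _
  · rintro j hj ⟨⟨z', p', q'⟩, ⟨h1, h2⟩, h3⟩
    change |z'| ≤ S.width at h1
    change |p'| ≤ S.width at h2
    have hw := hS.good.width_lt
    obtain ⟨rfl, -, h4⟩ := hS.eq_of_lift_eq h hy hτ (h1.trans hw.le) (h2.trans hw.le) (Or.inl hj)
      h3.symm
    have h5 := hτ' hj
    unfold climb at h5
    linarith [(abs_le.1 h1).1]

theorem bottom_mem_exterior {i : ι} {p : ℝ} (hp : |p| ≤ S.ε) (q : ℝ) :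
    S.nbhd.map i (-S.ε, p, q) ∈ S.pieceDomain none := by
  have hr := hS.good.lt_radius
  have he : |(-S.ε)| = S.ε := by rw [abs_neg, abs_of_pos hS.pos]
  exact hS.good.map_mem_exterior (by rwa [he]) (by linarith)
    (Or.inl (by rw [he]; exact hS.good.width_lt))

theorem flow_climb {r : S.link.Chord} {z x y : ℝ} (h : S.IsStart r.src z x) (hy : |y| ≤ S.ε)
    (hu : S.nbhd.map r.src (z, x, r.tailParam + y) ∈ S.pieceDomain none)
    (hu' : S.nbhd.map r.tgt (-S.ε, S.arrival r y, r.tipParam + S.nbhd.sign r * x) ∈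
      S.pieceDomain none) :
    S.Flow (S.point none _ hu) (S.climb r z x y) (S.point none _ hu') := by
  have key := fun τ (hτ : τ ∈ Icc 0 (S.climb r z x y)) =>
    hS.lift_mem_exterior h hy hτ.1 (fun _ => hτ.2)
  have := Flow.exterior (hS.climb_pos h hy).le key hu (key _ ⟨(hS.climb_pos h hy).le, le_rfl⟩)
  convert this using 1
  exact S.point_congr (hS.lift_climb h hy).symm _ _

theorem flow_cross [Finite ι] {r r' : S.link.Chord} (hr : r.tgt = r'.src) (hc : S.coeff r.tgt ≠ 0)
    {x y : ℝ} (hy : |y| ≤ S.ε)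
    (hu : S.nbhd.map r.tgt (-S.ε, S.arrival r y, r.tipParam + S.nbhd.sign r * x) ∈
      S.pieceDomain none)
    (hu' : S.nbhd.map r'.src (S.ε, S.arrival r y, r'.tailParam + S.offset r r' x y) ∈
      S.pieceDomain none) :
    S.Flow (S.point none _ hu) (S.crossing r.tgt (S.arrival r y)) (S.point none _ hu') := by
  have hε := hS.pos
  have hlt := hS.good.lt_radius
  have hw := hS.good.width_lt
  have hz : |S.ε| < S.nbhd.radius := by rwa [abs_of_pos hε]
  have hz' : |(-S.ε)| < S.nbhd.radius := by rwa [abs_neg]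
  have hp : |S.arrival r y| < S.nbhd.radius := by rw [abs_arrival]; linarith
  have e := map_tail_offset hr hc (x := x) (y := y) hz hp
  have := hS.good.flow_passage hc hz' hz hp (by linarith) hw hu (e ▸ hu')
  convert this using 1
  · unfold crossing; ring
  · exact S.point_congr e _ _

end IsAdapted

/-! ### Orbits with a given word -/

/-- The orbit from `x₀` passes, between the times `0` and `A`, exactly through the squares of the
word `w`, at the times `a k`, `b k`. -/
def Passes (S : SurgeryData ι) (x₀ : S.Manifold) (A : ℝ) (w : List S.link.Chord) (a b : ℕ → ℝ) :
    Prop :=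
  (∀ k, k + 1 < w.length → 0 < a k ∧ a k < b k ∧ b k < A) ∧
  (∀ k, k + 2 < w.length → b k < a (k + 1)) ∧
  (∀ (k : ℕ) (h : k + 1 < w.length),
    (∀ x, S.Flow x₀ (a k) x → x ∈ S.entrySquare (w[k]'(Nat.lt_of_succ_lt h))) ∧
    ∀ x, S.Flow x₀ (b k) x → x ∈ S.exitSquare (w[k + 1]'h)) ∧
  ∀ τ x, 0 < τ → τ ≤ A → S.Flow x₀ τ x → ∀ r : S.link.Chord,
    (x ∈ S.entrySquare r → ∃ k, k + 1 < w.length ∧ τ = a k) ∧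
    (x ∈ S.exitSquare r → ∃ k, k + 1 < w.length ∧ τ = b k)

end SurgeryData

namespace SurgeryData

variable {ι : Type*} {S : SurgeryData ι}

theorem mem_entrySquare {r : S.link.Chord} {p q : ℝ} (hc : S.coeff r.tgt ≠ 0) (hp : |p| ≤ S.ε)
    (hq : |q| ≤ S.ε) (h : S.nbhd.map r.tgt (-S.ε, p, r.tipParam + q) ∈ S.pieceDomain none) :
    S.point none _ h ∈ S.entrySquare r :=
  ⟨hc, _, _, _, r.param_tipParam, hp, by rwa [add_sub_cancel_left], h, rfl⟩

theorem mem_exitSquare {r : S.link.Chord} {p q : ℝ} (hc : S.coeff r.src ≠ 0) (hp : |p| ≤ S.ε)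
    (hq : |q| ≤ S.ε) (h : S.nbhd.map r.src (S.ε, p, r.tailParam + q) ∈ S.pieceDomain none) :
    S.point none _ h ∈ S.exitSquare r :=
  ⟨hc, _, _, _, r.param_tailParam, hp, by rwa [add_sub_cancel_left], h, rfl⟩

namespace IsAdapted

variable (hS : S.IsAdapted)
include hS

theorem mem_box {z p q : ℝ} (hz : |z| ≤ S.ε) (hp : |p| ≤ S.ε) :
    ((z, p, q) : E3) ∈ openBox S.nbhd.radius :=
  ⟨hz.trans_lt hS.good.lt_radius, hp.trans_lt hS.good.lt_radius⟩

theorem abs_neg_size : |(-S.ε)| ≤ S.ε := by rw [abs_neg, abs_of_pos hS.pos]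

theorem abs_size : |S.ε| ≤ S.ε := (abs_of_pos hS.pos).le

/-- Before the first handle the orbit from a starting point meets no exit square, and it meets an
entry square at most at the end. -/
theorem squares_climb {r : S.link.Chord} {z x y τ : ℝ} (h : S.IsStart r.src z x)
    (hy : |y| ≤ S.ε) (hτ : 0 < τ)
    (hu : lift τ (S.nbhd.map r.src (z, x, r.tailParam + y)) ∈ S.pieceDomain none)
    (r' : S.link.Chord) :
    (S.point none _ hu ∈ S.entrySquare r' → S.coeff r.tgt ≠ 0 ∧ τ = S.climb r z x y) ∧
    (S.point none _ hu ∈ S.exitSquare r' → S.coeff r.tgt ≠ 0 ∧ S.climb r z x y < τ) := by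
  have hε := hS.pos
  constructor
  · rintro ⟨hc, t, p, q, -, hp, -, h1, h2⟩
    obtain ⟨e, -, h3⟩ := hS.eq_of_lift_eq h hy hτ hS.abs_neg_size hp (Or.inl hc)
      (hS.good.exterior_injective h2)
    refine ⟨e ▸ hc, ?_⟩
    unfold climb
    linarith
  · rintro ⟨hc, t, p, q, -, hp, -, h1, h2⟩
    obtain ⟨e, -, h3⟩ := hS.eq_of_lift_eq h hy hτ hS.abs_size hp (Or.inl hc)
      (hS.good.exterior_injective h2)
    refine ⟨e ▸ hc, ?_⟩
    unfold climb
    linarith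

/-- Inside a handle an orbit meets no square. -/
theorem squares_cross [Finite ι] {i : ι} (hi : S.coeff i ≠ 0) {p q τ : ℝ} (hp : |p| ≤ S.ε)
    (hτ : 0 < τ) (hτ' : τ < S.crossing i p) (hu : S.nbhd.map i (-S.ε, p, q) ∈ S.pieceDomain none)
    {x : S.Manifold} (h : S.Flow (S.point none _ hu) τ x) (r : S.link.Chord) :
    x ∉ S.entrySquare r ∧ x ∉ S.exitSquare r := by
  have key : ∀ (j : ι) (z' p' q' : ℝ) (hv : S.nbhd.map j (z', p', q') ∈ S.pieceDomain none),
      |p'| ≤ S.ε → |z'| = S.ε → x ≠ S.point none _ hv := by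
    rintro j z' p' q' hv hp' hz' rfl
    obtain ⟨z'', q'', h1, h2⟩ := hS.good.eq_map_of_flow_passage hi hp hτ hτ' hu h
    have := (S.nbhd.injective _ _ _ (hS.mem_box hz'.le hp') _ (hS.mem_box h1.le hp) h2).2.1
    simp only at this
    rw [this, hz'] at h1
    exact h1.false
  constructor
  · rintro ⟨-, t, p', q', -, hp', -, hv, rfl⟩
    exact key _ _ _ _ hv hp' (by rw [abs_neg, abs_of_pos hS.pos]) rfl
  · rintro ⟨-, t, p', q', -, hp', -, hv, rfl⟩
    exact key _ _ _ _ hv hp' (abs_of_pos hS.pos) rfl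

theorem not_mem_entrySquare_exit {i : ι} {p q : ℝ} (hp : |p| ≤ S.ε)
    (hu : S.nbhd.map i (S.ε, p, q) ∈ S.pieceDomain none) (r : S.link.Chord) :
    S.point none _ hu ∉ S.entrySquare r := by
  rintro ⟨-, t, p', q', -, hp', -, hv, h⟩
  have := (S.nbhd.injective _ _ _ (hS.mem_box hS.abs_size hp) _ (hS.mem_box hS.abs_neg_size hp')
    (hS.good.exterior_injective h)).2.1
  simp only at this
  linarith [hS.pos]

theorem flow_run_singleton {r : S.link.Chord} {z x : ℝ} (h : S.IsStart r.src z x)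
    (hc : S.coeff r.tgt = 0)
    (hu : S.nbhd.map r.src (z, x, r.tailParam + 0) ∈ S.pieceDomain none)
    (hu' : S.link.param r.tgt (r.tipParam + S.nbhd.sign r * x) ∈ S.pieceDomain none) :
    S.Flow (S.point none _ hu) (r.height - z) (S.point none _ hu') := by
  have hb := hS.start_bounds h
  have h1 := S.nbhd.radius_le_height r
  have h2 := hS.fine.lt_radius
  have hε := hS.pos
  have key := fun τ (hτ : τ ∈ Icc 0 (r.height - z)) =>
    hS.lift_mem_exterior h (by rw [abs_zero]; exact hε.le) hτ.1 (fun h => absurd hc h)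
  have h0 : 0 ≤ r.height - z := by linarith
  have := Flow.exterior h0 key hu (key _ ⟨h0, le_rfl⟩)
  convert this using 1
  exact S.point_congr (hS.lift_height h).symm _ _

theorem exists_passes [Finite ι] {r : S.link.Chord} {w : List S.link.Chord} {z x y A : ℝ}
    (h : S.IsStart r.src z x) (hrun : S.Run (r :: w) z x y A)
    (hu : S.nbhd.map r.src (z, x, r.tailParam + y) ∈ S.pieceDomain none) :
    0 < A ∧ (∃ j t e, S.IsBoundaryPoint j t e ∧ S.Flow (S.point none _ hu) A e) ∧
      ∃ a b, S.Passes (S.point none _ hu) A (r :: w) a b := by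
  have hε := hS.pos
  match w, hrun with
  | [], ⟨hy, hc, hA⟩ =>
    subst hy hA
    have hb := hS.start_bounds h
    have h1 := S.nbhd.radius_le_height r
    have h2 := hS.fine.lt_radius
    have hu' := hS.good.param_mem_exterior hc (r.tipParam + S.nbhd.sign r * x)
    refine ⟨by linarith, ⟨_, _, _, ⟨hc, hu', rfl⟩, hS.flow_run_singleton h hc hu hu'⟩, 0, 0,
      ?_, ?_, ?_, ?_⟩
    · intro k hk; simp at hk
    · intro k hk; simp at hk
    · intro k hk; simp at hk
    · intro τ x' hτ hτ' hf r'
      have h0 : |(0 : ℝ)| ≤ S.ε := by rw [abs_zero]; exact hε.le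
      have key := fun σ (hσ : σ ∈ Icc 0 τ) =>
        hS.lift_mem_exterior h h0 hσ.1 (fun h => absurd hc h)
      have f := Flow.exterior hτ.le key hu (key _ ⟨hτ.le, le_rfl⟩)
      rw [hS.good.flow_unique hf f]
      have := hS.squares_climb h h0 hτ (key _ ⟨hτ.le, le_rfl⟩) r'
      exact ⟨fun h => absurd hc (this.1 h).1, fun h => absurd hc (this.2 h).1⟩
  | r' :: w, ⟨hr, hc, hy, hy', A', hrun', hA⟩ =>
    have hp : |S.arrival r y| ≤ S.ε := by rwa [abs_arrival]
    have hst : S.IsStart r'.src S.ε (S.arrival r y) := Or.inl ⟨rfl, hp, hr ▸ hc⟩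
    have hu1 := hS.bottom_mem_exterior (i := r.tgt) hp (r.tipParam + S.nbhd.sign r * x)
    have hu2 := hS.mem_exterior_of_start hst (r'.tailParam + S.offset r r' x y)
    obtain ⟨hA', ⟨j, t, e, he, hfe⟩, a, b, P1, P2, P3, P4⟩ := exists_passes hst hrun' hu2
    have f1 := hS.flow_climb h hy hu hu1
    have f2 := hS.flow_cross hr hc hy hu1 hu2
    have f3 := hS.good.flow_trans f1 f2
    have t1 := hS.climb_pos h hy
    have t2 : 0 < S.crossing r.tgt (S.arrival r y) := hε.trans (hS.size_lt_crossing _ _)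
    generalize hT : S.climb r z x y = T at *
    generalize hD : S.crossing r.tgt (S.arrival r y) = D at *
    refine ⟨by linarith, ⟨j, t, e, he, hA ▸ hS.good.flow_trans f3 hfe⟩,
      fun k => Nat.casesOn k T fun k => T + D + a k,
      fun k => Nat.casesOn k (T + D) fun k => T + D + b k, ?_, ?_, ?_, ?_⟩
    · rintro (_ | k) hk
      · exact ⟨t1, show T < T + D by linarith, show T + D < A by linarith⟩
      · obtain ⟨k1, k2, k3⟩ := P1 k (by simpa using hk)
        exact ⟨show 0 < T + D + a k by linarith, show T + D + a k < T + D + b k by linarith,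
          show T + D + b k < A by linarith⟩
    · rintro (_ | k) hk
      · have := (P1 0 (by simpa using hk)).1
        show T + D < T + D + a 0
        linarith
      · have := P2 k (by simpa using hk)
        show T + D + b k < T + D + a (k + 1)
        linarith
    · rintro (_ | k) hk
      · refine ⟨fun X hX => ?_, fun X hX => ?_⟩
        · rw [hS.good.flow_unique hX f1]
          exact mem_entrySquare hc hp (by
            rw [S.nbhd.abs_sign_mul]; exact (hS.start_bounds h).2.2) hu1
        · rw [hS.good.flow_unique hX f3]
          exact mem_exitSquare (hr ▸ hc) hp hy' hu2
      · have hk' : k + 1 < (r' :: w).length := by simpa using hk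
        obtain ⟨k1, k2⟩ := P3 k hk'
        obtain ⟨k3, k4, -⟩ := P1 k hk'
        exact ⟨fun X hX => k1 X (hS.good.flow_split hX k3.le f3),
          fun X hX => k2 X (hS.good.flow_split hX (k3.trans k4).le f3)⟩
    · intro τ X hτ hτ' hX r''
      rcases le_or_gt τ T with h1 | h1
      · have key := fun σ (hσ : σ ∈ Icc 0 τ) =>
          hS.lift_mem_exterior h hy hσ.1 (fun _ => hT ▸ hσ.2.trans h1)
        have f := Flow.exterior hτ.le key hu (key _ ⟨hτ.le, le_rfl⟩)
        rw [hS.good.flow_unique hX f]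
        have := hS.squares_climb h hy hτ (key _ ⟨hτ.le, le_rfl⟩) r''
        rw [hT] at this
        exact ⟨fun h => ⟨0, by simp, (this.1 h).2⟩, fun h => absurd h1 (this.2 h).2.not_ge⟩
      · have hX1 := hS.good.flow_split (T' := τ - T) (by rwa [add_sub_cancel]) (by linarith) f1
        rcases lt_trichotomy τ (T + D) with h2 | h2 | h2
        · have := hS.squares_cross hc hp (by linarith) (by rw [hD]; linarith) hu1 hX1 r''
          exact ⟨fun h => absurd h this.1, fun h => absurd h this.2⟩
        · subst h2
          rw [hS.good.flow_unique hX f3]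
          exact ⟨fun h => absurd h (hS.not_mem_entrySquare_exit hp hu2 r''),
            fun _ => ⟨0, by simp, rfl⟩⟩
        · obtain ⟨k1, k2⟩ := P4 (τ - (T + D)) X (by linarith) (by linarith)
            (hS.good.flow_split (by rwa [add_sub_cancel]) (by linarith) f3) r''
          refine ⟨fun h => ?_, fun h => ?_⟩
          · obtain ⟨k, k3, k4⟩ := k1 h
            exact ⟨k + 1, by simpa using k3, show τ = T + D + a k by linarith⟩
          · obtain ⟨k, k3, k4⟩ := k2 h
            exact ⟨k + 1, by simpa using k3, show τ = T + D + b k by linarith⟩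

end IsAdapted

end SurgeryData

namespace SurgeryData

variable {ι : Type*} {S : SurgeryData ι}

/-! ### Every orbit between points of `Λ⁰` follows a word -/

/-- The bottoms of the handles. -/
def bottoms (S : SurgeryData ι) : Set E3 :=
  ⋃ j : {j // S.coeff j ≠ 0},
    S.nbhd.map j '' {v | (v.1, v.2.1) ∈ ({-S.ε} ×ˢ Icc (-S.ε) S.ε : Set (ℝ × ℝ))}

namespace IsAdapted

variable (hS : S.IsAdapted)
include hS

theorem isClosed_bottoms [Finite ι] : IsClosed S.bottoms := by
  refine isClosed_iUnion_of_finite fun j => S.nbhd.isClosed_image _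
    (isCompact_singleton.prod isCompact_Icc) ?_
  rintro ⟨z, p⟩ ⟨rfl, hp⟩
  exact (hS.mem_box (q := 0) hS.abs_neg_size (abs_le.2 hp))

/-- A vertical line from a starting point remains in the exterior until it meets the bottom of a
handle. -/
theorem lift_mem_exterior_of_first {i : ι} {z x q T : ℝ} (h : S.IsStart i z x)
    (hT : ∀ τ, 0 ≤ τ → τ < T → lift τ (S.nbhd.map i (z, x, q)) ∉ S.bottoms) {τ : ℝ} (hτ : 0 ≤ τ)
    (hτT : τ ≤ T) : lift τ (S.nbhd.map i (z, x, q)) ∈ S.pieceDomain none := by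
  rintro j hj ⟨⟨z', p', q'⟩, ⟨h1, h2⟩, h3⟩
  change |z'| ≤ S.width at h1
  change |p'| ≤ S.width at h2
  have hε := hS.pos
  have hw := hS.good.width_lt
  have hr := hS.good.lt_radius
  have hz' := abs_le.1 h1
  have hp' : |p'| < S.nbhd.radius := by linarith
  rcases le_or_gt (z' + S.ε) τ with hle | hlt
  · refine hT (τ - (z' + S.ε)) (by linarith) (by linarith) (mem_iUnion.2 ⟨⟨j, hj⟩,
      (-S.ε, p', q'), ⟨rfl, abs_le.1 (h2.trans hw.le)⟩, ?_⟩)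
    have := S.nbhd.lift_map j (z := z') (p := p') (q := q') (T := -(z' + S.ε)) (by linarith)
      (by rw [show z' + -(z' + S.ε) = -S.ε by ring, abs_neg, abs_of_pos hε]; exact hr) hp'
    rw [h3, lift_lift, show z' + -(z' + S.ε) = -S.ε by ring] at this
    rw [← this]
    rfl
  · have hz0 : |z' - τ| ≤ S.ε := abs_le.2 ⟨by linarith, by linarith⟩
    have := S.nbhd.lift_map j (z := z') (p := p') (q := q') (T := -τ) (by linarith)
      (hz0.trans_lt hr) hp'
    rw [h3, lift_lift, add_neg_cancel, lift_zero, ← sub_eq_add_neg] at this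
    have hb := hS.start_bounds h
    obtain ⟨e1, e2, -⟩ := S.nbhd.injective _ _ _
      (hS.mem_box (by rw [abs_of_nonneg hb.1]; exact hb.2.1) hb.2.2) _
      (hS.mem_box hz0 (h2.trans hw.le)) this
    simp only at e2
    rcases h with ⟨rfl, -, -⟩ | ⟨-, -, hc⟩
    · linarith
    · exact hj (e1 ▸ hc)

theorem param_ne_map {i j : ι} (hi : S.coeff i ≠ 0) (hj : S.coeff j = 0) {z p q t : ℝ}
    (hz : |z| ≤ S.ε) (hp : |p| ≤ S.ε) : S.link.param j t ≠ S.nbhd.map i (z, p, q) := by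
  intro h
  rw [← S.nbhd.core] at h
  obtain ⟨e, -⟩ := S.nbhd.injective _ _ _ (S.nbhd.mem_openBox_core t) _ (hS.mem_box hz hp) h
  exact hi (e ▸ hj)

/-- The first chord followed by an orbit from a starting point. -/
theorem exists_chord {i j : ι} {z x q z' p' q' T : ℝ} (h : S.IsStart i z x) (hT : 0 < T)
    (hz' : |z'| ≤ S.ε) (hp' : |p'| ≤ S.ε) (hz0 : z' ≤ 0)
    (heq : lift T (S.nbhd.map i (z, x, q)) = S.nbhd.map j (z', p', q')) :
    ∃ (r : S.link.Chord) (n m : ℤ) (y : ℝ), r.src = i ∧ r.tgt = j ∧ |y| ≤ S.ε ∧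
      q = r.tailParam + y + n ∧ p' = S.arrival r y ∧ q' = r.tipParam + S.nbhd.sign r * x + m ∧
      T = z' - z + r.height - x * y := by
  have hb := hS.start_bounds h
  rcases hS.fine.transit _ _ _ _ _ _ _ _ _ (by rw [abs_of_nonneg hb.1]; exact hb.2.1) hb.2.2 hz' hp'
    hT heq with ⟨-, h2⟩ | ⟨r, n, m, y, h1, h2, h3, h4, h5, h6⟩
  · linarith
  · exact ⟨r, n, m, y, h1, h2, by rwa [h4, abs_neg, S.nbhd.abs_sign_mul] at hp', h3, h4, h5,
      by linarith⟩

theorem abs_offset_lt {r r' : S.link.Chord} (hr : r.tgt = r'.src) (hc : S.coeff r.tgt ≠ 0)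
    {x y : ℝ} (hx : |x| ≤ S.ε) : |S.offset r r' x y| < 1 - S.ε := by
  obtain ⟨g1, g2⟩ := gap_bounds (r' := r') hS.fine hr hc
  have hε := hS.pos
  have f0 := hS.twist.toIsTwist.scaledTwist_nonneg (ε := S.ε) (S.arrival r y)
  have f1 := hS.twist.toIsTwist.scaledTwist_le_one (ε := S.ε) (S.arrival r y)
  have h1 : S.offset r r' x y = S.nbhd.sign r * x + (S.coeff r.tgt : ℝ) *
      (scaledTwist S.f S.ε (S.arrival r y) - gap S.coeff r r') := by
    unfold offset turn; ring
  have h2 : |scaledTwist S.f S.ε (S.arrival r y) - gap S.coeff r r'| < 1 - 2 * S.ε := by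
    rw [abs_lt]; constructor <;> linarith
  rw [h1]
  refine (abs_add_le _ _).trans_lt ?_
  rw [S.nbhd.abs_sign_mul, abs_signType_cast_mul hc]
  linarith

theorem exists_run_of_flow [Finite ι] (n : ℕ) {i j : ι} {z x q A t : ℝ} {e : S.Manifold}
    (h : S.IsStart i z x) (hA : 0 < A) (hn : A ≤ n * S.ε)
    (hu : S.nbhd.map i (z, x, q) ∈ S.pieceDomain none) (he : S.IsBoundaryPoint j t e)
    (hf : S.Flow (S.point none _ hu) A e) :
    ∃ (r : S.link.Chord) (w : List S.link.Chord) (y : ℝ) (m : ℤ), r.src = i ∧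
      q = r.tailParam + y + m ∧ S.Run (r :: w) z x y A := by
  obtain ⟨hc, hv, rfl⟩ := he
  have hε := hS.pos
  have hb := hS.start_bounds h
  have habs0 : |(0 : ℝ)| ≤ S.ε := by rw [abs_zero]; exact hε.le
  induction n generalizing i z x q A with
  | zero => rw [Nat.cast_zero, zero_mul] at hn; linarith
  | succ n ih =>
  by_cases hhit : ∃ τ ∈ Icc 0 A, lift τ (S.nbhd.map i (z, x, q)) ∈ S.bottoms
  · have hcl : IsClosed {τ | lift τ (S.nbhd.map i (z, x, q)) ∈ S.bottoms} :=
      hS.isClosed_bottoms.preimage (by unfold lift; fun_prop)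
    obtain ⟨T, ⟨⟨hT0, hTA⟩, hTB⟩, hmin⟩ := (isCompact_Icc.inter_right hcl).exists_isLeast hhit
    obtain ⟨⟨k, hk⟩, ⟨z', p, q'⟩, ⟨hz', hp'⟩, heq⟩ := mem_iUnion.1 hTB
    have hp := abs_le.2 hp'
    simp only [mem_singleton_iff] at hz' heq
    subst hz'
    have key := fun τ (hτ : τ ∈ Icc 0 T) => hS.lift_mem_exterior_of_first (q := q) (T := T) h
      (fun τ h0 hτ hmem => absurd (hmin ⟨⟨h0, hτ.le.trans hTA⟩, hmem⟩) hτ.not_ge) hτ.1 hτ.2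
    have hT0' : 0 < T := by
      refine hT0.lt_of_ne ?_
      rintro rfl
      rw [lift_zero] at heq
      obtain ⟨e1, e2, -⟩ := S.nbhd.injective _ _ _ (hS.mem_box hS.abs_neg_size hp) _
        (hS.mem_box (by rw [abs_of_nonneg hb.1]; exact hb.2.1) hb.2.2) heq
      simp only at e2
      linarith
    have hu1 := hS.bottom_mem_exterior (i := k) hp q'
    have f1 : S.Flow (S.point none _ hu) T (S.point none _ hu1) := by
      have := Flow.exterior hT0 key hu (key T ⟨hT0, le_rfl⟩)
      convert this using 1
      exact S.point_congr heq _ _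
    obtain ⟨r, a, m, y, rfl, rfl, hy, rfl, rfl, rfl, rfl⟩ :=
      hS.exists_chord h hT0' hS.abs_neg_size hp (by linarith) heq.symm
    have f2 := hS.good.flow_split (T' := A - _) (by rwa [add_sub_cancel]) (sub_nonneg.2 hTA) f1
    have hst : S.IsStart r.tgt S.ε (S.arrival r y) := Or.inl ⟨rfl, hp, hk⟩
    have hu2 := hS.mem_exterior_of_start hst
      (r.tipParam + S.nbhd.sign r * x + m + S.turn r.tgt (S.arrival r y))
    have f3 : S.Flow (S.point none _ hu1) (S.crossing r.tgt (S.arrival r y))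
        (S.point none _ hu2) := by
      have := hS.good.flow_passage hk (by rw [abs_neg, abs_of_pos hε]; exact hS.good.lt_radius)
        (by rw [abs_of_pos hε]; exact hS.good.lt_radius) (hp.trans_lt hS.good.lt_radius)
        (by linarith [hS.good.width_lt]) hS.good.width_lt hu1 hu2
      convert this using 1
      unfold crossing; ring
    have hcr := hS.size_lt_crossing r.tgt (S.arrival r y)
    have hlt : S.crossing r.tgt (S.arrival r y) < A - (-S.ε - z + r.height - x * y) := by
      by_contra! hle
      rcases hle.lt_or_eq with hlt | heq'
      · rcases (sub_nonneg.2 hTA).eq_or_lt with h0 | h0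
        · rw [← h0] at f2
          exact hS.param_ne_map hk hc hS.abs_neg_size hp (hS.good.exterior_injective
            (hS.good.flow_unique f2 (Flow.refl _ ⟨_, _, hu1, rfl⟩)))
        · obtain ⟨z'', q'', h1, h2⟩ := hS.good.eq_map_of_flow_passage hk hp h0 hlt hu1 f2
          exact hS.param_ne_map hk hc h1.le hp h2
      · rw [heq'] at f2
        exact hS.param_ne_map hk hc hS.abs_size hp
          (hS.good.exterior_injective (hS.good.flow_unique f2 f3))
    have f4 := hS.good.flow_split (T' := A - _ - S.crossing r.tgt (S.arrival r y))
      (by rwa [add_sub_cancel]) (by linarith) f3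
    obtain ⟨r', w, y', m', h1, h2, h3⟩ := ih hst (by linarith)
      (by push_cast at hn; linarith) hu2 f4 ⟨hε.le, le_rfl, hp⟩
    have hy' := hS.abs_le_of_run h3
    have hoff := hS.abs_offset_lt (y := y) h1.symm hk hb.2.2
    obtain ⟨l, hl⟩ := exists_gap_eq (r' := r') hk
    have hdiff : S.offset r r' x y - y' = ((m' - m - l : ℤ) : ℝ) := by
      unfold offset
      rw [hl]
      push_cast
      linarith
    have hint : m' - m - l = 0 := by
      rw [← Int.abs_lt_one_iff]
      have : |((m' - m - l : ℤ) : ℝ)| < 1 := by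
        rw [← hdiff]
        exact (abs_sub _ _).trans_lt (by linarith)
      exact_mod_cast this
    rw [hint, Int.cast_zero, sub_eq_zero] at hdiff
    subst hdiff
    refine ⟨r, r' :: w, y, a, rfl, rfl, h1.symm, hk, hy, hy', _, h3, ?_⟩
    unfold climb
    ring
  · push Not at hhit
    have key := fun τ (hτ : τ ∈ Icc 0 A) => hS.lift_mem_exterior_of_first (q := q) (T := A) h
      (fun τ h0 hτ => hhit τ ⟨h0, hτ.le⟩) hτ.1 hτ.2
    have f := Flow.exterior hA.le key hu (key A ⟨hA.le, le_rfl⟩)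
    have heq := hS.good.exterior_injective (hS.good.flow_unique f hf)
    rw [← S.nbhd.core] at heq
    obtain ⟨r, a, m, y, rfl, rfl, hy, rfl, hp, -, rfl⟩ :=
      hS.exists_chord h hA habs0 habs0 le_rfl heq
    have hy0 : y = 0 := by
      have := abs_arrival r y
      rwa [← hp, abs_zero, eq_comm, abs_eq_zero] at this
    subst hy0
    exact ⟨r, [], 0, a, rfl, rfl, rfl, hc, by ring⟩

end IsAdapted

end SurgeryData

theorem eq_of_strictMonoOn_of_image_eq {n n' : ℕ} {a a' : ℕ → ℝ} (ha : StrictMonoOn a (Iio n))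
    (ha' : StrictMonoOn a' (Iio n')) (h : a '' Iio n = a' '' Iio n') :
    n = n' ∧ ∀ k < n, a k = a' k := by
  have hs : (Finset.range n).image a = (Finset.range n').image a' := by
    rw [← Finset.coe_inj]
    simpa using h
  have h1 : ((Finset.range n).image a).card = n := by
    rw [Finset.card_image_of_injOn (by simpa using ha.injOn), Finset.card_range]
  have h2 : ((Finset.range n').image a').card = n' := by
    rw [Finset.card_image_of_injOn (by simpa using ha'.injOn), Finset.card_range]
  have hn : n = n' := by rw [← h1, hs, h2]
  subst hn
  refine ⟨rfl, fun k hk => ?_⟩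
  have e1 := Finset.orderEmbOfFin_unique h1 (f := fun k : Fin n => a k)
    (fun k => Finset.mem_image_of_mem _ (by simp)) (fun k l hkl => ha k.2 l.2 hkl)
  have e2 := Finset.orderEmbOfFin_unique h1 (f := fun k : Fin n => a' k)
    (fun k => hs ▸ Finset.mem_image_of_mem _ (by simp)) (fun k l hkl => ha' k.2 l.2 hkl)
  exact congrFun (e1.trans e2.symm) ⟨k, hk⟩

namespace SurgeryData

variable {ι : Type*} {S : SurgeryData ι}

theorem IsReebCurve.congr {A : ℝ} {γ γ' : ℝ → S.Manifold} (h : S.IsReebCurve A γ)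
    (h' : ∀ t ∈ Icc 0 A, γ' t = γ t) : S.IsReebCurve A γ' := by
  intro t ht
  obtain ⟨a, u, hu⟩ := h t ht
  refine ⟨a, u, ?_⟩
  filter_upwards [hu, self_mem_nhdsWithin] with s hs hs'
  rwa [h' s hs']

/-- The chord `κ` starts at the tail of the first chord of `w`, up to the offset for which it
follows the chords of `w`. -/
def ReebChord.Follows (κ : S.ReebChord) : List S.link.Chord → Prop
  | [] => False
  | r :: w => S.coeff r.src = 0 ∧ ∃ y h,
      κ.toFun 0 = S.point none (S.link.param r.src (r.tailParam + y)) h ∧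
      S.Run (r :: w) 0 0 y κ.length

theorem isChain_of_run {w : List S.link.Chord} {z x y A : ℝ} (h : S.Run w z x y A) :
    ∃ hw : w ≠ [], S.coeff (w.getLast hw).tgt = 0 ∧
      List.IsChain (fun r r' : S.link.Chord => r.tgt = r'.src ∧ S.coeff r.tgt ≠ 0) w := by
  match w, h with
  | [r], h => exact ⟨List.cons_ne_nil _ _, h.2.1, List.isChain_singleton _⟩
  | r :: r' :: w, ⟨h1, h2, _, _, B, h5, _⟩ =>
    obtain ⟨h6, h7, h8⟩ := isChain_of_run h5
    exact ⟨List.cons_ne_nil _ _, by rwa [List.getLast_cons_cons],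
      List.isChain_cons_cons.2 ⟨⟨h1, h2⟩, h8⟩⟩

theorem ReebChord.Follows.isBoundaryWord {κ : S.ReebChord} {w : List S.link.Chord}
    (h : κ.Follows w) : S.link.IsBoundaryWord S.coeff w := by
  match w, h with
  | r :: w, ⟨hc, y, hu, h0, hrun⟩ =>
    obtain ⟨h1, h2, h3⟩ := isChain_of_run hrun
    exact ⟨h1, hc, h2, h3⟩

namespace IsAdapted

variable (hS : S.IsAdapted)
include hS

theorem eq_of_mem_entrySquare {r r' : S.link.Chord} {x : S.Manifold} (h : x ∈ S.entrySquare r)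
    (h' : x ∈ S.entrySquare r') : r = r' := by
  obtain ⟨-, t, p, q, ht, hp, hq, hu, rfl⟩ := h
  obtain ⟨-, t', p', q', ht', hp', hq', hu', he⟩ := h'
  obtain ⟨e, -, -, n, hn⟩ := S.nbhd.injective _ _ _ (hS.mem_box hS.abs_neg_size hp) _
    (hS.mem_box hS.abs_neg_size hp') (hS.good.exterior_injective he)
  obtain ⟨m, rfl⟩ := r.exists_eq_tipParam_add ht
  obtain ⟨m', rfl⟩ := r'.exists_eq_tipParam_add ht'
  simp only at hn
  subst hn
  refine hS.fine.tip_sep r r' (m' - m - n) e ?_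
  rw [abs_le] at *
  push_cast
  constructor <;> linarith [hq.1, hq.2, hq'.1, hq'.2]

theorem eq_of_mem_exitSquare {r r' : S.link.Chord} {x : S.Manifold} (h : x ∈ S.exitSquare r)
    (h' : x ∈ S.exitSquare r') : r = r' := by
  obtain ⟨-, t, p, q, ht, hp, hq, hu, rfl⟩ := h
  obtain ⟨-, t', p', q', ht', hp', hq', hu', he⟩ := h'
  obtain ⟨e, -, -, n, hn⟩ := S.nbhd.injective _ _ _ (hS.mem_box hS.abs_size hp) _
    (hS.mem_box hS.abs_size hp') (hS.good.exterior_injective he)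
  obtain ⟨m, rfl⟩ := r.exists_eq_tailParam_add ht
  obtain ⟨m', rfl⟩ := r'.exists_eq_tailParam_add ht'
  simp only at hn
  subst hn
  refine hS.fine.tail_sep r r' (m' - m - n) e ?_
  rw [abs_le] at *
  push_cast
  constructor <;> linarith [hq.1, hq.2, hq'.1, hq'.2]

theorem hasWord_unique {κ : S.ReebChord} {w w' : List S.link.Chord} (h : κ.HasWord w)
    (h' : κ.HasWord w') : w = w' := by
  have key : ∀ {w : List S.link.Chord} {a b : ℕ → ℝ},
      (∀ k, k + 1 < w.length → 0 < a k ∧ a k < b k ∧ b k < κ.length) →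
      (∀ k, k + 2 < w.length → b k < a (k + 1)) →
      (∀ (k : ℕ) (h : k + 1 < w.length),
        κ.toFun (a k) ∈ S.entrySquare (w[k]'(Nat.lt_of_succ_lt h)) ∧
        κ.toFun (b k) ∈ S.exitSquare (w[k + 1]'h)) →
      (∀ τ ∈ Icc 0 κ.length, ∀ r : S.link.Chord,
        (κ.toFun τ ∈ S.entrySquare r → ∃ k, k + 1 < w.length ∧ τ = a k) ∧
        (κ.toFun τ ∈ S.exitSquare r → ∃ k, k + 1 < w.length ∧ τ = b k)) →
      StrictMonoOn a (Iio (w.length - 1)) ∧ StrictMonoOn b (Iio (w.length - 1)) ∧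
      a '' Iio (w.length - 1) = {τ | τ ∈ Icc 0 κ.length ∧ ∃ r, κ.toFun τ ∈ S.entrySquare r} ∧
      b '' Iio (w.length - 1) = {τ | τ ∈ Icc 0 κ.length ∧ ∃ r, κ.toFun τ ∈ S.exitSquare r} := by
    intro w a b h1 h2 h3 h4
    refine ⟨strictMonoOn_of_lt_add_one ordConnected_Iio fun k _ hk hk' => ?_,
      strictMonoOn_of_lt_add_one ordConnected_Iio fun k _ hk hk' => ?_, ?_, ?_⟩
    · rw [mem_Iio] at hk hk'
      exact (h1 k (by omega)).2.1.trans (h2 k (by omega))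
    · rw [mem_Iio] at hk hk'
      exact (h2 k (by omega)).trans (h1 (k + 1) (by omega)).2.1
    · ext τ
      constructor
      · rintro ⟨k, hk, rfl⟩
        rw [mem_Iio] at hk
        obtain ⟨k1, k2, k3⟩ := h1 k (by omega)
        exact ⟨⟨k1.le, (k2.trans k3).le⟩, _, (h3 k (by omega)).1⟩
      · rintro ⟨hτ, r, hr⟩
        obtain ⟨k, hk, rfl⟩ := (h4 τ hτ r).1 hr
        exact ⟨k, by rw [mem_Iio]; omega, rfl⟩
    · ext τ
      constructor
      · rintro ⟨k, hk, rfl⟩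
        rw [mem_Iio] at hk
        obtain ⟨k1, k2, k3⟩ := h1 k (by omega)
        exact ⟨⟨(k1.trans k2).le, k3.le⟩, _, (h3 k (by omega)).2⟩
      · rintro ⟨hτ, r, hr⟩
        obtain ⟨k, hk, rfl⟩ := (h4 τ hτ r).2 hr
        exact ⟨k, by rw [mem_Iio]; omega, rfl⟩
  obtain ⟨hne, hs, a, b, h1, h2, h3, h4⟩ := h
  obtain ⟨hne', hs', a', b', h1', h2', h3', h4'⟩ := h'
  obtain ⟨k1, k2, k3, k4⟩ := key h1 h2 h3 h4
  obtain ⟨k1', k2', k3', k4'⟩ := key h1' h2' h3' h4'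
  obtain ⟨hn, ha⟩ := eq_of_strictMonoOn_of_image_eq k1 k1' (k3.trans k3'.symm)
  obtain ⟨-, hb⟩ := eq_of_strictMonoOn_of_image_eq k2 k2' (k4.trans k4'.symm)
  have p1 := List.length_pos_iff.2 hne
  have p2 := List.length_pos_iff.2 hne'
  have hlen : w.length = w'.length := by omega
  refine List.ext_getElem hlen fun k hk hk' => ?_
  rcases lt_or_ge (k + 1) w.length with hlt | hge
  · have e1 := (h3 k hlt).1
    rw [ha k (by omega)] at e1
    exact hS.eq_of_mem_entrySquare e1 (h3' k (by omega)).1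
  · rcases k with _ | k
    · obtain ⟨r, rfl⟩ := List.length_eq_one_iff.1 (show w.length = 1 by omega)
      obtain ⟨r', rfl⟩ := List.length_eq_one_iff.1 (show w'.length = 1 by omega)
      obtain ⟨⟨u, hu⟩, -⟩ := hs r rfl
      obtain ⟨⟨u', hu'⟩, -⟩ := hs' r' rfl
      exact LegendrianLink.Chord.eq_of_tail_eq hS.generic
        (hS.good.exterior_injective (hu.symm.trans hu'))
    · have e1 := (h3 k hk).2
      rw [hb k (by omega)] at e1
      exact hS.eq_of_mem_exitSquare e1 (h3' k hk').2

theorem exists_follows [Finite ι] (κ : S.ReebChord) : ∃ w, κ.Follows w := by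
  obtain ⟨i, s, hc, hu, h0⟩ := κ.start_mem
  obtain ⟨j, t, he⟩ := κ.end_mem
  have hA := κ.length_pos
  have hf := IsReebCurve.flow_zero κ.reeb (t := κ.length) ⟨hA.le, le_rfl⟩
  rw [h0] at hf
  obtain ⟨n, hn⟩ := exists_nat_ge (κ.length / S.ε)
  rw [div_le_iff₀ hS.pos] at hn
  have e := S.nbhd.core i s
  rw [S.point_congr e.symm hu (e ▸ hu)] at hf
  obtain ⟨r, w, y, m, rfl, rfl, hrun⟩ := hS.exists_run_of_flow n
    (Or.inr ⟨rfl, rfl, hc⟩) hA hn _ he hf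
  have e' := S.link.param_add_int r.src (r.tailParam + y) m
  exact ⟨r :: w, hc, y, e' ▸ hu, h0.trans (S.point_congr e' _ _), hrun⟩

theorem hasWord_of_follows [Finite ι] {κ : S.ReebChord} {w : List S.link.Chord}
    (h : κ.Follows w) : κ.HasWord w := by
  match w, h with
  | r :: w, ⟨hc, y, hu, h0, hrun⟩ =>
    have e := S.nbhd.core r.src (r.tailParam + y)
    have hst : S.IsStart r.src 0 0 := Or.inr ⟨rfl, rfl, hc⟩
    have hu' := hS.mem_exterior_of_start hst (r.tailParam + y)
    have h0' : κ.toFun 0 = S.point none _ hu' := h0.trans (S.point_congr e.symm _ _)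
    obtain ⟨-, -, a, b, P1, P2, P3, P4⟩ := hS.exists_passes hst hrun hu'
    have hfl : ∀ τ ∈ Icc 0 κ.length, S.Flow (S.point none _ hu') τ (κ.toFun τ) := fun τ hτ =>
      h0' ▸ IsReebCurve.flow_zero κ.reeb hτ
    refine ⟨List.cons_ne_nil _ _, fun r' hr' => ?_, a, b, P1, P2, fun k hk => ?_,
      fun τ hτ r' => ?_⟩
    · obtain ⟨rfl, rfl⟩ := List.cons.inj hr'
      obtain ⟨rfl, hc', hA⟩ := hrun
      have e1 : S.link.param r.src (r.tailParam + 0) = r.tail := by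
        rw [add_zero, r.param_tailParam]
      have e2 : S.link.param r.tgt (r.tipParam + S.nbhd.sign r * 0) = r.tip := by
        rw [mul_zero, add_zero, r.param_tipParam]
      have hv := hS.good.param_mem_exterior hc' (r.tipParam + S.nbhd.sign r * 0)
      have f := hS.flow_run_singleton hst hc' hu' hv
      rw [← hA] at f
      exact ⟨⟨e1 ▸ hu, h0.trans (S.point_congr e1 _ _)⟩, e2 ▸ hv,
        (hS.good.flow_unique (hfl _ ⟨κ.length_pos.le, le_rfl⟩) f).trans (S.point_congr e2 _ _)⟩
    · obtain ⟨k1, k2, k3⟩ := P1 k hk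
      exact ⟨(P3 k hk).1 _ (hfl _ ⟨k1.le, (k2.trans k3).le⟩),
        (P3 k hk).2 _ (hfl _ ⟨(k1.trans k2).le, k3.le⟩)⟩
    · rcases hτ.1.eq_or_lt with rfl | hpos
      · rw [h0]
        constructor
        · rintro ⟨hc', t, p, q, -, hp, -, hv, he⟩
          exact absurd (hS.good.exterior_injective he) (hS.param_ne_map hc' hc hS.abs_neg_size hp)
        · rintro ⟨hc', t, p, q, -, hp, -, hv, he⟩
          exact absurd (hS.good.exterior_injective he) (hS.param_ne_map hc' hc hS.abs_size hp)
      · exact P4 τ _ hpos hτ.2 (hfl τ hτ) r'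

theorem eq_of_follows {κ κ' : S.ReebChord} {w : List S.link.Chord} (h : κ.Follows w)
    (h' : κ'.Follows w) : κ = κ' := by
  match w, h, h' with
  | r :: w, ⟨hc, y, hu, h0, hrun⟩, ⟨_, y', hu', h0', hrun'⟩ =>
    obtain ⟨rfl, hA⟩ := hS.run_unique (by rw [abs_zero]; exact hS.pos.le) hrun hrun'
    refine ReebChord.ext hA (funext fun t => ?_)
    rw [κ.const t, κ'.const t, ← hA]
    exact hS.good.curve_unique κ.reeb (hA ▸ κ'.reeb) (h0.trans h0'.symm)
      ⟨le_max_left _ _, max_le κ.length_pos.le (min_le_right _ _)⟩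

theorem exists_follows_of_isBoundaryWord [Finite ι] {w : List S.link.Chord}
    (h : S.link.IsBoundaryWord S.coeff w) : ∃ κ : S.ReebChord, κ.Follows w := by
  obtain ⟨hw, hc, hend, hchain⟩ := h
  obtain ⟨y, A, hrun⟩ := hS.exists_run w hw hchain hend 0 (x := 0)
    (by rw [abs_zero]; exact hS.pos.le)
  obtain ⟨r, w, rfl⟩ := List.exists_cons_of_ne_nil hw
  · change S.coeff r.src = 0 at hc
    have hst : S.IsStart r.src 0 0 := Or.inr ⟨rfl, rfl, hc⟩
    have hu := hS.mem_exterior_of_start hst (r.tailParam + y)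
    obtain ⟨hA, ⟨j, t, e, he, -, γ, hγ, h0, hγA⟩, -⟩ := hS.exists_passes hst hrun hu
    have hu' := hS.good.param_mem_exterior hc (r.tailParam + y)
    have h0' : γ 0 = S.point none _ hu' := h0.trans (S.point_congr (S.nbhd.core _ _) _ _)
    have c0 : max 0 (min 0 A) = 0 := by rw [min_eq_left hA.le, max_self]
    have cA : max 0 (min A A) = A := by rw [min_self, max_eq_right hA.le]
    refine ⟨⟨A, fun t => γ (max 0 (min t A)), hA, fun t => ?_, ?_, ⟨r.src, r.tailParam + y, ?_⟩,
      ⟨j, t, ?_⟩⟩, hc, y, hu', ?_, hrun⟩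
    · congr 1
      rw [min_eq_left (a := max 0 (min t A)) (max_le hA.le (min_le_right _ _)),
        max_eq_right (a := 0) (b := max 0 (min t A)) (le_max_left _ _)]
    · refine IsReebCurve.congr hγ fun t ht => ?_
      rw [min_eq_left ht.2, max_eq_right ht.1]
    · refine ⟨hc, hu', ?_⟩
      rw [c0, h0']
    · rw [cA, hγA]
      exact he
    · change γ (max 0 (min 0 A)) = _
      rw [c0, h0']

theorem exists_word [Finite ι] : ∃ word : S.ReebChord ≃ S.link.BoundaryWord S.coeff,
    ∀ (κ : S.ReebChord) (w : S.link.BoundaryWord S.coeff), word κ = w ↔ κ.HasWord w.1 := by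
  choose word hword using hS.exists_follows
  refine ⟨Equiv.ofBijective (fun κ => ⟨word κ, (hword κ).isBoundaryWord⟩) ⟨?_, ?_⟩, ?_⟩
  · intro κ κ' h
    have h1 := hword κ
    rw [show word κ = word κ' from congrArg Subtype.val h] at h1
    exact hS.eq_of_follows h1 (hword κ')
  · rintro ⟨w, hw⟩
    obtain ⟨κ, hκ⟩ := hS.exists_follows_of_isBoundaryWord hw
    exact ⟨κ, Subtype.ext (hS.hasWord_unique (hS.hasWord_of_follows (hword κ))
      (hS.hasWord_of_follows hκ))⟩
  · intro κ w
    have h1 := hS.hasWord_of_follows (hword κ)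
    constructor
    · rintro rfl
      exact h1
    · intro h
      exact Subtype.ext (hS.hasWord_unique h1 h)

end IsAdapted

end SurgeryData

namespace StandardNeighborhood

variable {ι : Type*} {Λ : LegendrianLink ι} (N : StandardNeighborhood Λ)

theorem exists_strictFDeriv (i : ι) {u : E3} (hu : u ∈ openBox N.radius) :
    ∃ M : E3 ≃L[ℝ] E3, HasStrictFDerivAt (N.map i) (M : E3 →L[ℝ] E3) u ∧
      ∀ v, alphaStd (N.map i u) (M v) = alphaModel u v := by
  have hinj : Function.Injective (fderiv ℝ (N.map i) u : E3 →ₗ[ℝ] E3) := by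
    rw [← LinearMap.ker_eq_bot, LinearMap.ker_eq_bot']
    intro v hv
    change fderiv ℝ (N.map i) u v = 0 at hv
    have h1 := N.area i hu v (0, 1, 0)
    have h2 := N.area i hu v (0, 0, 1)
    have h3 := N.contact i u hu v
    simp [hv] at h1 h2
    rw [hv, map_zero] at h3
    simp [alphaModel, h1] at h3
    ext
    · exact h3.symm
    · exact h2.symm
    · exact h1
  refine ⟨(LinearEquiv.ofInjectiveEndo _ hinj).toContinuousLinearEquiv, ?_, fun v =>
    N.contact i u hu v⟩
  exact (N.contDiffAt i hu).hasStrictFDerivAt (by simp)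

theorem deriv_param (i : ι) (s : ℝ) {M : E3 →L[ℝ] E3} (hM : HasFDerivAt (N.map i) M (0, 0, s)) :
    deriv (Λ.param i) s = M (0, 0, 1) := by
  have h1 : HasDerivAt (fun q : ℝ => ((0, 0, q) : E3)) (0, 0, 1) s :=
    (hasDerivAt_const s (0 : ℝ)).prodMk ((hasDerivAt_const s (0 : ℝ)).prodMk (hasDerivAt_id s))
  have h2 := (hM.comp_hasDerivAt s h1).deriv
  rw [← h2]
  congr 1
  ext1 q
  exact (N.core i q).symm

end StandardNeighborhood

namespace SurgeryData

variable {ι : Type*} {S : SurgeryData ι}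

/-! ### The flow near a Reeb chord -/

/-- The vertical translation by `T` from coordinates near the tail to coordinates near the tip of a
chord. -/
def climbMap (S : SurgeryData ι) (r : S.link.Chord) (T : ℝ) (v : E3) : E3 :=
  (v.1 + T - r.height + v.2.1 * v.2.2, -(S.nbhd.sign r * v.2.2), S.nbhd.sign r * v.2.1)

/-- The flow for time `D` through a handle, from coordinates near the tip of `r` to coordinates near
the tail of `r'`. -/
def crossMap (S : SurgeryData ι) (r r' : S.link.Chord) (D : ℝ) (v : E3) : E3 :=
  (v.1 + D - S.drop r.tgt v.2.1, v.2.1,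
    v.2.2 + S.turn r.tgt v.2.1 - (S.coeff r.tgt : ℝ) * gap S.coeff r r')

theorem hasFDerivAt_climbMap (r : S.link.Chord) (T : ℝ) (v : E3) :
    ∃ L : E3 →L[ℝ] E3, HasFDerivAt (S.climbMap r T) L v ∧ ∀ w, L w =
      (w.1 + (v.2.1 * w.2.2 + v.2.2 * w.2.1), -(S.nbhd.sign r * w.2.2), S.nbhd.sign r * w.2.1) := by
  let P1 := ContinuousLinearMap.fst ℝ ℝ (ℝ × ℝ)
  let P2 := (ContinuousLinearMap.fst ℝ ℝ ℝ).comp (ContinuousLinearMap.snd ℝ ℝ (ℝ × ℝ))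
  let P3 := (ContinuousLinearMap.snd ℝ ℝ ℝ).comp (ContinuousLinearMap.snd ℝ ℝ (ℝ × ℝ))
  have h2 : HasFDerivAt (fun v : E3 => v.2.1) P2 v := P2.hasFDerivAt
  have h3 : HasFDerivAt (fun v : E3 => v.2.2) P3 v := P3.hasFDerivAt
  have h1 : HasFDerivAt (fun v : E3 => v.1) P1 v := P1.hasFDerivAt
  exact ⟨_, (((h1.add_const T).sub_const r.height).add (h2.mul h3)).prodMk
    ((h3.const_mul (S.nbhd.sign r)).neg.prodMk (h2.const_mul (S.nbhd.sign r))), fun w => rfl⟩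

namespace IsAdapted

variable (hS : S.IsAdapted)
include hS

theorem hasFDerivAt_crossMap (r r' : S.link.Chord) (D : ℝ) (v : E3)
    (hv : deriv S.f (v.2.1 / S.ε) = 1) :
    ∃ L : E3 →L[ℝ] E3, HasFDerivAt (S.crossMap r r' D) L v ∧ ∀ w, L w =
      (w.1 - (S.coeff r.tgt : ℝ) * (v.2.1 / S.ε) * w.2.1, w.2.1,
        w.2.2 + (S.coeff r.tgt : ℝ) / S.ε * w.2.1) := by
  let P1 := ContinuousLinearMap.fst ℝ ℝ (ℝ × ℝ)
  let P2 := (ContinuousLinearMap.fst ℝ ℝ ℝ).comp (ContinuousLinearMap.snd ℝ ℝ (ℝ × ℝ))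
  let P3 := (ContinuousLinearMap.snd ℝ ℝ ℝ).comp (ContinuousLinearMap.snd ℝ ℝ (ℝ × ℝ))
  have h2 : HasFDerivAt (fun v : E3 => v.2.1) P2 v := P2.hasFDerivAt
  have h3 : HasFDerivAt (fun v : E3 => v.2.2) P3 v := P3.hasFDerivAt
  have h1 : HasFDerivAt (fun v : E3 => v.1) P1 v := P1.hasFDerivAt
  have hd : HasDerivAt (S.drop r.tgt) ((S.coeff r.tgt : ℝ) * (v.2.1 / S.ε)) v.2.1 := by
    have := (hS.twist.toIsTwist.hasDerivAt_twistPrimitive hS.pos v.2.1).const_mul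
      (S.coeff r.tgt : ℝ)
    rwa [hv, mul_one_div] at this
  have ht : HasDerivAt (S.turn r.tgt) ((S.coeff r.tgt : ℝ) / S.ε) v.2.1 := by
    have := (hS.twist.toIsTwist.hasDerivAt_scaledTwist (ε := S.ε) v.2.1).const_mul
      (S.coeff r.tgt : ℝ)
    rwa [hv, mul_one_div] at this
  have hd' : HasFDerivAt (fun v : E3 => S.drop r.tgt v.2.1)
      (((S.coeff r.tgt : ℝ) * (v.2.1 / S.ε)) • P2) v :=
    HasDerivAt.comp_hasFDerivAt (h₂ := S.drop r.tgt) v hd h2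
  have ht' : HasFDerivAt (fun v : E3 => S.turn r.tgt v.2.1) (((S.coeff r.tgt : ℝ) / S.ε) • P2) v :=
    HasDerivAt.comp_hasFDerivAt (h₂ := S.turn r.tgt) v ht h2
  exact ⟨_, ((h1.add_const D).sub hd').prodMk (h2.prodMk ((h3.add ht').sub_const
    ((S.coeff r.tgt : ℝ) * gap S.coeff r r'))), fun w => rfl⟩

theorem eventually_flow_climb [Finite ι] {r : S.link.Chord} {z x y T : ℝ} (h : S.IsStart r.src z x)
    (hy : |y| ≤ S.ε) (hT : 0 ≤ T) (hT' : S.coeff r.tgt ≠ 0 → T ≤ S.climb r z x y)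
    (hz : |z + T - r.height + x * y| ≤ S.ε) :
    ∀ᶠ v : E3 in 𝓝 (z, x, y),
      ∀ hu : S.nbhd.map r.src (v.1, v.2.1, r.tailParam + v.2.2) ∈ S.pieceDomain none,
      ∃ hu' : S.nbhd.map r.tgt ((S.climbMap r T v).1, (S.climbMap r T v).2.1,
        r.tipParam + (S.climbMap r T v).2.2) ∈ S.pieceDomain none,
      S.Flow (S.point none _ hu) T (S.point none _ hu') := by
  have hb := hS.start_bounds h
  have hs := hS.fine.lt_scale r
  have hzε : |z| ≤ S.ε := by rw [abs_of_nonneg hb.1]; exact hb.2.1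
  have hopen {g : E3 → ℝ} (hg : Continuous g) (h0 : |g (z, x, y)| ≤ S.ε) :
      ∀ᶠ v in 𝓝 ((z, x, y) : E3), |g v| < S.nbhd.scale r :=
    (continuous_abs.comp hg).continuousAt.eventually_lt continuousAt_const (h0.trans_lt hs)
  have e1 := hopen (g := fun v => v.1) (by fun_prop) hzε
  have e2 := hopen (g := fun v => v.2.1) (by fun_prop) hb.2.2
  have e3 := hopen (g := fun v => v.2.2) (by fun_prop) hy
  have e4 := hopen (g := fun v => v.1 + T - r.height + v.2.1 * v.2.2) (by fun_prop) hz
  have hcont : ContinuousAt (fun v : E3 => S.nbhd.map r.src (v.1, v.2.1, r.tailParam + v.2.2))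
      (z, x, y) :=
    (S.nbhd.continuousAt_map r.src (hS.mem_box hzε hb.2.2)).comp
      (f := fun v : E3 => ((v.1, v.2.1, r.tailParam + v.2.2) : E3)) (by fun_prop)
  have e5 : ∀ᶠ v : E3 in 𝓝 (z, x, y), ∀ τ ∈ Icc 0 T,
      lift τ (S.nbhd.map r.src (v.1, v.2.1, r.tailParam + v.2.2)) ∈ S.pieceDomain none := by
    refine isCompact_Icc.eventually_forall_of_forall_eventually fun τ hτ => ?_
    have hmem := hS.lift_mem_exterior h hy hτ.1 (fun hc => hτ.2.trans (hT' hc))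
    have hc : ContinuousAt (fun p : E3 × ℝ =>
        lift p.2 (S.nbhd.map r.src (p.1.1, p.1.2.1, r.tailParam + p.1.2.2))) ((z, x, y), τ) := by
      have k1 : ContinuousAt (fun p : E3 × ℝ =>
          S.nbhd.map r.src (p.1.1, p.1.2.1, r.tailParam + p.1.2.2)) ((z, x, y), τ) :=
        ContinuousAt.comp (f := Prod.fst) (x := (((z, x, y) : E3), τ)) hcont continuousAt_fst
      unfold lift
      fun_prop
    exact hc.eventually ((hS.good.isOpen_pieceDomain none).mem_nhds hmem)
  filter_upwards [e1, e2, e3, e4, e5] with v h1 h2 h3 h4 h5 hu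
  have e := (S.nbhd.transit_iff r (T := T) h1 h2 h3 h4 (p' := -(S.nbhd.sign r * v.2.2))
    (by rwa [abs_neg, S.nbhd.abs_sign_mul]) (q' := S.nbhd.sign r * v.2.1)
    (by rwa [S.nbhd.abs_sign_mul])).2 ⟨rfl, rfl, rfl⟩
  have hm := h5 T ⟨hT, le_rfl⟩
  refine ⟨e ▸ hm, ?_⟩
  have := Flow.exterior hT h5 hu hm
  convert this using 1
  exact S.point_congr e.symm _ _

theorem eventually_flow_cross [Finite ι] {r r' : S.link.Chord} (hr : r.tgt = r'.src)
    (hc : S.coeff r.tgt ≠ 0) {p q : ℝ} (hp : |p| ≤ S.ε) :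
    ∀ᶠ v : E3 in 𝓝 (-S.ε, p, q),
      ∀ hu : S.nbhd.map r.tgt (v.1, v.2.1, r.tipParam + v.2.2) ∈ S.pieceDomain none,
      ∃ hu' : S.nbhd.map r'.src ((S.crossMap r r' (S.crossing r.tgt p) v).1,
        (S.crossMap r r' (S.crossing r.tgt p) v).2.1,
        r'.tailParam + (S.crossMap r r' (S.crossing r.tgt p) v).2.2) ∈ S.pieceDomain none,
      S.Flow (S.point none _ hu) (S.crossing r.tgt p) (S.point none _ hu') := by
  have hε := hS.pos
  have hw := hS.good.width_lt
  have hR := hS.good.lt_radius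
  have hd := hS.good.continuous_drop r.tgt
  have hopen {g : E3 → ℝ} {c : ℝ} (hg : Continuous g) (h0 : g (-S.ε, p, q) < c) :
      ∀ᶠ v in 𝓝 ((-S.ε, p, q) : E3), g v < c :=
    hg.continuousAt.eventually_lt continuousAt_const h0
  have e1 := hopen (g := fun v => v.1) (c := -S.width) (by fun_prop) (by simpa using hw)
  have e2 := hopen (g := fun v => |v.1|) (c := S.nbhd.radius) (by fun_prop)
    (by simpa [abs_of_pos hε] using hR)
  have e3 := hopen (g := fun v => |v.2.1|) (c := S.nbhd.radius) (by fun_prop) (hp.trans_lt hR)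
  have hval : -S.ε + S.crossing r.tgt p - S.drop r.tgt p = S.ε := by unfold crossing; ring
  have e4 := hopen (g := fun v => -(v.1 + S.crossing r.tgt p - S.drop r.tgt v.2.1)) (c := -S.width)
    (by fun_prop) (by simpa [hval] using hw)
  have e5 := hopen (g := fun v => |v.1 + S.crossing r.tgt p - S.drop r.tgt v.2.1|)
    (c := S.nbhd.radius) (by fun_prop) (by simpa [hval, abs_of_pos hε] using hR)
  filter_upwards [e1, e2, e3, e4, e5] with v h1 h2 h3 h4 h5 hu
  have h4' := neg_lt_neg_iff.1 h4
  obtain ⟨m, hm⟩ := exists_gap_eq (r' := r') hc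
  have e : S.nbhd.map r'.src ((S.crossMap r r' (S.crossing r.tgt p) v).1,
        (S.crossMap r r' (S.crossing r.tgt p) v).2.1,
        r'.tailParam + (S.crossMap r r' (S.crossing r.tgt p) v).2.2) =
      S.nbhd.map r.tgt (v.1 + S.crossing r.tgt p - S.drop r.tgt v.2.1, v.2.1,
        r.tipParam + v.2.2 + S.turn r.tgt v.2.1) := by
    rw [← hr, ← S.nbhd.map_add_int _ h5 h3 _ (-m)]
    unfold crossMap
    congr 3
    rw [hm]
    push_cast
    ring
  have hu' := hS.good.map_mem_exterior (i := r.tgt) (q := r.tipParam + v.2.2 + S.turn r.tgt v.2.1)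
    h5 h3 (Or.inl (lt_abs.2 (Or.inl h4')))
  refine ⟨e ▸ hu', ?_⟩
  have := hS.good.flow_passage hc h2 h5 h3 h1 h4' hu hu'
  convert this using 1
  · ring
  · exact S.point_congr e _ _

end IsAdapted

end SurgeryData

namespace SurgeryData

variable {ι : Type*} {S : SurgeryData ι}

namespace IsAdapted

variable (hS : S.IsAdapted)
include hS

/-- The flow near an orbit which follows a word, in coordinates near its endpoints: it preserves the
contact form, and it does not map vectors which are closer to the direction of `Λ` than to the fibre
direction to vectors tangent to `Λ⁰`. -/
theorem exists_returnMap [Finite ι] {r : S.link.Chord} {w : List S.link.Chord} {z x y A : ℝ}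
    (h : S.IsStart r.src z x) (hrun : S.Run (r :: w) z x y A) :
    ∃ (j : ι) (t : ℝ) (F : E3 → E3) (L : E3 →L[ℝ] E3), S.coeff j = 0 ∧ F (z, x, y) = (0, 0, t) ∧
      HasFDerivAt F L (z, x, y) ∧
      (∀ᶠ v : E3 in 𝓝 (z, x, y),
        ∀ hu : S.nbhd.map r.src (v.1, v.2.1, r.tailParam + v.2.2) ∈ S.pieceDomain none,
        ∃ hu' : S.nbhd.map j (F v) ∈ S.pieceDomain none,
          S.Flow (S.point none _ hu) A (S.point none _ hu')) ∧
      ∀ v : E3, (L v).1 = v.1 + x * v.2.2 ∧ (|v.2.1| < |v.2.2| → (L v).2.1 ≠ 0) := by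
  have hε := hS.pos
  have hb := hS.start_bounds h
  match w, hrun with
  | [], ⟨hy, hc, hA⟩ =>
    subst hy hA
    have h1 := S.nbhd.radius_le_height r
    have h2 := hS.fine.lt_radius
    have h0 : |(0 : ℝ)| ≤ S.ε := by rw [abs_zero]; exact hε.le
    obtain ⟨L, hL, hL'⟩ := hasFDerivAt_climbMap r (r.height - z) (z, x, 0)
    have hF := hL.add_const (0, 0, r.tipParam)
    refine ⟨r.tgt, r.tipParam + S.nbhd.sign r * x, _, L, hc, ?_, hF, ?_, fun v => ?_⟩
    · simp [climbMap, add_comm]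
    · filter_upwards [hS.eventually_flow_climb h h0 (T := r.height - z) (by linarith)
        (fun h => absurd hc h) (by simpa using hε.le)] with v hv hu
      have e : S.climbMap r (r.height - z) v + (0, 0, r.tipParam) =
          ((S.climbMap r (r.height - z) v).1, (S.climbMap r (r.height - z) v).2.1,
            r.tipParam + (S.climbMap r (r.height - z) v).2.2) := by
        ext <;> simp [add_comm]
      rw [e]
      exact hv hu
    · rw [hL']
      refine ⟨by simp, fun hv hv0 => ?_⟩
      have : |S.nbhd.sign r * v.2.2| = 0 := by rw [abs_eq_zero]; exact neg_eq_zero.1 hv0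
      rw [S.nbhd.abs_sign_mul] at this
      linarith [abs_nonneg v.2.1]
  | r' :: w, ⟨hr, hc, hy, hy', A', hrun', hA⟩ =>
    have hp : |S.arrival r y| ≤ S.ε := by rwa [abs_arrival]
    have hst : S.IsStart r'.src S.ε (S.arrival r y) := Or.inl ⟨rfl, hp, hr ▸ hc⟩
    obtain ⟨j, t, F, L, hj, hF0, hF, hflow, hL⟩ := exists_returnMap hst hrun'
    obtain ⟨L₁, hL₁, hL₁'⟩ := hasFDerivAt_climbMap r (S.climb r z x y) (z, x, y)
    have e1 : S.climbMap r (S.climb r z x y) (z, x, y) =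
        (-S.ε, S.arrival r y, S.nbhd.sign r * x) := by
      simp only [climbMap, climb, arrival, Prod.mk.injEq, and_true]
      ring
    have hd := (hS.offset_eq hr hc hb.2.2 hy hy').2
    obtain ⟨L₂, hL₂, hL₂'⟩ := hS.hasFDerivAt_crossMap r r' (S.crossing r.tgt (S.arrival r y))
      (-S.ε, S.arrival r y, S.nbhd.sign r * x) hd
    have e2 : S.crossMap r r' (S.crossing r.tgt (S.arrival r y))
        (-S.ε, S.arrival r y, S.nbhd.sign r * x) = (S.ε, S.arrival r y, S.offset r r' x y) := by
      simp only [crossMap, crossing, offset, Prod.mk.injEq, and_true]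
      ring
    rw [← e2] at hF hflow
    have hF₂ := hF.comp _ hL₂
    rw [← e1] at hF₂
    refine ⟨j, t, _, _, hj, ?_, hF₂.comp _ hL₁, ?_, fun v => ?_⟩
    · simp only [Function.comp_apply, e1, e2, hF0]
    · have k1 := hS.eventually_flow_climb h hy (hS.climb_pos h hy).le (fun _ => le_rfl)
        (show |z + S.climb r z x y - r.height + x * y| ≤ S.ε by
          rw [show z + S.climb r z x y - r.height + x * y = -S.ε by unfold climb; ring]
          exact hS.abs_neg_size)
      have k2 := hS.eventually_flow_cross hr hc hp (q := S.nbhd.sign r * x)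
      have k3 := hL₂.continuousAt.eventually hflow
      rw [← e1] at k2 k3
      filter_upwards [k1, hL₁.continuousAt.eventually k2, hL₁.continuousAt.eventually k3]
        with v h1 h2 h3 hu
      obtain ⟨hu1, f1⟩ := h1 hu
      obtain ⟨hu2, f2⟩ := h2 hu1
      obtain ⟨hu3, f3⟩ := h3 hu2
      refine ⟨hu3, ?_⟩
      rw [hA]
      exact hS.good.flow_trans (hS.good.flow_trans f1 f2) f3
    · obtain ⟨k1, k2⟩ := hL (L₂ (L₁ v))
      change (L (L₂ (L₁ v))).1 = _ ∧ (_ → (L (L₂ (L₁ v))).2.1 ≠ 0)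
      have hs := S.nbhd.sign_mul_self r
      have hcc := signType_cast_mul_self hc
      constructor
      · rw [k1, hL₂', hL₁']
        simp only [arrival]
        linear_combination (-(y * v.2.1)) * hs
      · intro hv
        refine k2 ?_
        rw [hL₂', hL₁']
        simp only
        have hb1 : |-(S.nbhd.sign r * v.2.2)| = |v.2.2| := by rw [abs_neg, S.nbhd.abs_sign_mul]
        have hb2 : |(S.coeff r.tgt : ℝ) / S.ε * -(S.nbhd.sign r * v.2.2)| = |v.2.2| / S.ε := by
          rw [div_mul_eq_mul_div, abs_div, abs_signType_cast_mul hc, hb1, abs_of_pos hε]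
        have hb3 : 4 * |v.2.2| ≤ |v.2.2| / S.ε := by
          rw [le_div_iff₀ hε]
          nlinarith [abs_nonneg v.2.2, hS.fine.lt_quarter]
        have hb4 := abs_sub_abs_le_abs_sub
          ((S.coeff r.tgt : ℝ) / S.ε * -(S.nbhd.sign r * v.2.2)) (-(S.nbhd.sign r * v.2.1))
        rw [sub_neg_eq_add, abs_neg, S.nbhd.abs_sign_mul, hb2, add_comm] at hb4
        rw [hb1]
        linarith [abs_nonneg v.2.1]

theorem nondegenerate [Finite ι] (κ : S.ReebChord) : κ.Nondegenerate := by
  obtain ⟨w, hw⟩ := hS.exists_follows κ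
  match w, hw with
  | r :: w, ⟨hc, y, hu, h0, hrun⟩ =>
  have hst : S.IsStart r.src 0 0 := Or.inr ⟨rfl, rfl, hc⟩
  obtain ⟨j, t, F, L, hj, hF0, hF, hflow, hL⟩ := hS.exists_returnMap hst hrun
  set s := r.tailParam + y with hs
  obtain ⟨M, hM, -⟩ := S.nbhd.exists_strictFDeriv r.src (S.nbhd.mem_openBox_core s)
  obtain ⟨M', hM', hα⟩ := S.nbhd.exists_strictFDeriv j (S.nbhd.mem_openBox_core t)
  have hcore := S.nbhd.core r.src s
  let G := hM.localInverse (S.nbhd.map r.src) M (0, 0, s)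
  have hG0 : G (S.link.param r.src s) = (0, 0, s) := by
    rw [← hcore]
    exact hM.localInverse_apply_image
  have hG : HasFDerivAt G (M.symm : E3 →L[ℝ] E3) (S.link.param r.src s) := by
    rw [← hcore]
    exact hM.to_localInverse.hasFDerivAt
  have hGr : ∀ᶠ u in 𝓝 (S.link.param r.src s), S.nbhd.map r.src (G u) = u := by
    rw [← hcore]
    exact hM.eventually_right_inverse
  have e0 : G (S.link.param r.src s) - (0, 0, r.tailParam) = (0, 0, y) := by
    rw [hG0]
    simp [hs]
  have hG' := hG.sub_const (0, 0, r.tailParam)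
  have hM1 := hM'.hasFDerivAt
  rw [← hF0, ← e0] at hM1
  rw [← e0] at hF hflow
  have hψ := (hM1.comp _ hF).comp (f := fun u => G u - (0, 0, r.tailParam)) _ hG'
  have hψ0 : S.nbhd.map j (F (G (S.link.param r.src s) - (0, 0, r.tailParam))) =
      S.link.param j t := by
    rw [e0, hF0, S.nbhd.core]
  have hflow' : ∀ᶠ u in 𝓝 (S.link.param r.src s), ∀ hu : u ∈ S.pieceDomain none,
      ∃ hu' : S.nbhd.map j (F (G u - (0, 0, r.tailParam))) ∈ S.pieceDomain none,
        S.Flow (S.point none u hu) κ.length (S.point none _ hu') := by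
    filter_upwards [hG'.continuousAt.eventually hflow, hGr] with u h1 h2 hu
    have e : S.nbhd.map r.src ((G u - (0, 0, r.tailParam)).1, (G u - (0, 0, r.tailParam)).2.1,
        r.tailParam + (G u - (0, 0, r.tailParam)).2.2) = u := by
      rw [← h2]
      congr 1
      ext <;> simp [h2]
    obtain ⟨hu', f⟩ := h1 (e.symm ▸ hu)
    refine ⟨hu', ?_⟩
    rwa [S.point_congr e _ hu] at f
  have hend : S.IsBoundaryPoint j t (κ.toFun κ.length) := by
    obtain ⟨hu', f⟩ := hflow'.self_of_nhds hu
    have f' := IsReebCurve.flow_zero κ.reeb (t := κ.length) ⟨κ.length_pos.le, le_rfl⟩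
    rw [h0] at f'
    exact ⟨hj, hS.good.param_mem_exterior hj t, (hS.good.flow_unique f' f).trans
      (S.point_congr hψ0 _ _)⟩
  refine ⟨r.src, j, s, t, ⟨hc, hu, h0⟩, hend, _, _, hψ0, ?_, hψ, ?_⟩
  · filter_upwards [hflow', (hS.good.isOpen_pieceDomain none).mem_nhds hu] with u h1 h2
    obtain ⟨hu', -, γ, hγ, k1, k2⟩ := h1 h2
    exact ⟨γ, h2, hu', hγ, k1, k2⟩
  · have d1 := S.nbhd.deriv_param r.src s hM.hasFDerivAt
    have d2 := S.nbhd.deriv_param j t hM'.hasFDerivAt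
    have d3 : (((M' : E3 →L[ℝ] E3).comp L).comp (M.symm : E3 →L[ℝ] E3))
        (deriv (S.link.param r.src) s) = M' (L (0, 0, 1)) := by
      rw [d1]
      simp
    rw [d3, d2]
    obtain ⟨l1, l2⟩ := hL (0, 0, 1)
    simp only [mul_one, add_zero] at l1
    have l3 := l2 (by simp)
    generalize L (0, 0, 1) = b at l1 l3
    have hα' : ∀ v, alphaStd (S.link.param j t) (M' v) = v.1 := fun v => by
      rw [← S.nbhd.core, hα]
      simp [alphaModel]
    refine le_antisymm (sup_le ?_ ?_) fun v hv => ?_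
    · rw [Submodule.span_singleton_le_iff_mem, LinearMap.mem_ker]
      exact (hα' b).trans l1
    · rw [Submodule.span_singleton_le_iff_mem, LinearMap.mem_ker]
      exact hα' _
    · obtain ⟨u, rfl⟩ := M'.surjective v
      have hu1 : u.1 = 0 := (hα' u).symm.trans hv
      rw [Submodule.mem_sup]
      refine ⟨(u.2.1 / b.2.1) • M' b, Submodule.smul_mem _ _ (Submodule.mem_span_singleton_self _),
        (u.2.2 - u.2.1 / b.2.1 * b.2.2) • M' (0, 0, 1),
        Submodule.smul_mem _ _ (Submodule.mem_span_singleton_self _), ?_⟩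
      rw [← map_smul, ← map_smul, ← map_add]
      congr 1
      ext
      · simp [l1, hu1]
      · simp [div_mul_cancel₀ _ l3]
      · simp

end IsAdapted

end SurgeryData

end ChordSurgery

end

theorem mainTheorem4 {ι : Type*} [Finite ι] (Λ : ChordSurgery.LegendrianLink ι)
    (c : ι → SignType) (hunit : Λ.UnitSpeed) (hgood : Λ.GoodPosition) :
    Nonempty (ChordSurgery.StandardNeighborhood Λ) ∧
    ∀ N : ChordSurgery.StandardNeighborhood Λ, ∃ ε₀ : ℝ, 0 < ε₀ ∧ ε₀ ≤ N.radius ∧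
      ∀ ε : ℝ, 0 < ε → ε < ε₀ →
        (∃ (η : ℝ) (f : ℝ → ℝ), ChordSurgery.IsAdaptedTwist Λ c ε η f) ∧
        ∀ (η : ℝ) (f : ℝ → ℝ), ChordSurgery.IsAdaptedTwist Λ c ε η f →
          (∃ word : (ChordSurgery.SurgeryData.mk Λ c N ε η f).ReebChord ≃ Λ.BoundaryWord c,
            ∀ (κ : (ChordSurgery.SurgeryData.mk Λ c N ε η f).ReebChord) (w : Λ.BoundaryWord c),
              word κ = w ↔ κ.HasWord w.1) ∧
          ∀ κ : (ChordSurgery.SurgeryData.mk Λ c N ε η f).ReebChord, κ.Nondegenerate := by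
  refine ⟨Λ.nonempty_standardNeighborhood hunit hgood, fun N => ?_⟩
  obtain ⟨ε₀, h0, hle, hfine, hsep⟩ := N.exists_isFine hgood.1
  refine ⟨ε₀, h0, hle, fun ε hε hlt => ⟨ChordSurgery.exists_isAdaptedTwist hε hlt hsep,
    fun η f hf => ?_⟩⟩
  have hS : (ChordSurgery.SurgeryData.mk Λ c N ε η f).IsAdapted :=
    ⟨hgood.1, hfine ε hε hlt, hf⟩
  exact ⟨hS.exists_word, hS.nondegenerate⟩
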